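/- Let $m=n-1\in\mathbb N_0$, $d,\nu\in\mathbb R$, $\mathbb R_+=(0,\infty)$, $\overline{\mathbb R}_+=[0,\infty)$, $\langle\xi'\rangle=(1+|\xi'|^2)^{1/2}$, $\langle\xi',\mu\rangle=(1+|\xi'|^2+\mu^2)^{1/2}$, and write $D=-i\partial$. *Function spaces.* $H^s(\mathbb R_+)$, $s\in\mathbb R$, is the space of restrictions to $\mathbb R_+$ of elements of the $L^2$-Sobolev space $H^s(\mathbb R)$, with the quotient norm, and $H^{s,\delta}(\mathbb R_+)=\langle t\rangle^{-\delta}H^s(\mathbb R_+)$. With $(\theta u)(x)=u(e^{-x})$ for $u\in\mathcal D'(\mathbb R_+)$, let $\mathcal H^{s,\gamma}(\mathbb R_+)=t^{\gamma-1/2}\,\theta^{-1}H^s(\mathbb R)$ with the norm $\|u\|_{\mathcal H^{s,\gamma}(\mathbb R_+)}=\|\theta(t^{1/2-\gamma}u)\|_{H^s(\mathbb R)}$. For a cut-off function $\omega\in C^\infty_{\rm comp}(\overline{\mathbb R}_+)$, $\omega\equiv1$ near $0$, let $\mathcal K^{s,\gamma}(\mathbb R_+)$ be the space of all $u\in\mathcal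 D'(\mathbb R_+)$ with $\|u\|=\|\omega u\|_{\mathcal H^{s,\gamma}(\mathbb R_+)}+\|(1-\omega)u\|_{H^s(\mathbb R_+)}<\infty$, and let $\mathcal K^{s,\gamma}(\mathbb R_+)^\rho=\langle t\rangle^{-\rho}\mathcal K^{s,\gamma}(\mathbb R_+)$. Spaces with a weight carry the obvious norms. Let $(\kappa_\lambda u)(t)=\lambda^{1/2}u(\lambda t)$, $\lambda>0$, be the standard group action on $\mathcal D'(\mathbb R_+)$, and $\kappa^{-1}(\xi')=\kappa_{\langle\xi'\rangle}^{-1}$, $\kappa^{-1}(\xi',\mu)=\kappa_{\langle\xi',\mu\rangle}^{-1}$. *Symbol-kernels.* A weakly parameter-dependent Poisson symbol-kernel of order $d+\frac12$ and regularity $\nu$ is a smooth function $\widetilde k(x',x_n,\xi';\mu)$ of $x',\xi'\in\mathbb R^m$, $x_n\in\mathbb R_+$, $\mu\in\overline{\mathbb R}_+$ such that for all $\alpha,\beta\in\mathbb N_0^m$ and $j,\ell,\ell'\in\mathbb N_0$ there is a constant $C$ with $$\|D^\beta_{x'}D^\alpha_{\xi'}D^j_\mu x_n^\ell D_{x_n}^{\ell'}\widetilde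 k\|_{L^2(\mathbb R_+)}\le C\Big(\frac{\langle\xi'\rangle}{\langle\xi',\mu\rangle}\Big)^{\nu-[\ell-\ell']_+-|\alpha|}\langle\xi',\mu\rangle^{d-\ell+\ell'-|\alpha|-j}$$ for all $(x',\xi',\mu)$, where $[r]_+=\max\{r,0\}$. **Theorem.** Let $\widetilde k$ be a function of $(x',\xi',\mu)\in\mathbb R^m\times\mathbb R^m\times\overline{\mathbb R}_+$ that belongs to $C^\infty(\mathbb R^m\times\mathbb R^m\times\overline{\mathbb R}_+,\mathcal L(\mathbb C,H^{s,\delta}(\mathbb R_+)))$ for all $s,\delta\in\mathbb R$ and to $C^\infty(\mathbb R^m\times\mathbb R^m\times\overline{\mathbb R}_+,\mathcal L(\mathbb C,\mathcal K^{s,0}(\mathbb R_+)^\rho))$ for all $s,\rho\in\mathbb R$. Then $\widetilde k(x',\xi';\mu)$ is of the form $c\mapsto c\,\widetilde k(x',\cdot,\xi';\mu)$ for a weakly parameter-dependent Poisson symbol-kernel of order $d+\frac12$ and regularity $\nu$ if, and only if, for all $s,\rho\in\mathbb R$, all $\alpha,\beta\in\mathbb N_0^m$ and all $j\in\mathbb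 N_0$ there is a constant $C$ such that, for all $(x',\xi',\mu)$, $$\|\kappa^{-1}(\xi')D^\beta_{x'}D^\alpha_{\xi'}D^j_\mu\widetilde k(x',\xi';\mu)\|_{\mathcal L(\mathbb C,\mathcal K^{s,0}(\mathbb R_+)^\rho)}\le C\,\langle\xi'\rangle^{\nu-|\alpha|}\langle\xi',\mu\rangle^{d-\nu-j}$$ and $$\|\kappa^{-1}(\xi',\mu)D^\beta_{x'}D^\alpha_{\xi'}D^j_\mu\widetilde k(x',\xi';\mu)\|_{\mathcal L(\mathbb C,H^{s}(\mathbb R_+))}\le C\,\langle\xi'\rangle^{\nu-|\alpha|}\langle\xi',\mu\rangle^{d-\nu-j}.$$ -/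

import Mathlib

open Set TopologicalSpace MeasureTheory
open scoped Distributions SchwartzMap ContDiff ENNReal

noncomputable section

/-- Data of an operator `φ ↦ weight · (φ ∘ map)` from test functions on `Ω₁` to test functions on
`Ω₂`: `weight` and `map : Ω₂ → Ω₁` are smooth on `Ω₂`, and `map` has a continuous left inverse
`inv : Ω₁ → Ω₂`, so that compact supports stay compact. -/
structure WeightedMap (Ω₁ Ω₂ : Opens ℝ) where
  weight : ℝ → ℝ
  map : ℝ → ℝ
  inv : ℝ → ℝ
  contDiffOn_weight : ContDiffOn ℝ ∞ weight Ω₂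
  contDiffOn_map : ContDiffOn ℝ ∞ map Ω₂
  mapsTo : MapsTo map Ω₂ Ω₁
  continuousOn_inv : ContinuousOn inv Ω₁
  mapsTo_inv : MapsTo inv Ω₁ Ω₂
  leftInvOn : LeftInvOn inv map Ω₂

namespace WeightedMap

variable {Ω₁ Ω₂ : Opens ℝ} (W : WeightedMap Ω₁ Ω₂)

/-- The function `weight · (f ∘ map)` on `Ω₂`, extended by zero. -/
def pull (f : ℝ → ℝ) : ℝ → ℝ := (Ω₂ : Set ℝ).indicator fun x => W.weight x * f (W.map x)

/-- A compact set that contains the support of `pull f` if `f` is supported in `K`. -/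
def image (K : Compacts ℝ) (hK : (K : Set ℝ) ⊆ Ω₁) : Compacts ℝ :=
  ⟨W.inv '' K, K.isCompact.image_of_continuousOn (W.continuousOn_inv.mono hK)⟩

theorem image_subset (K : Compacts ℝ) (hK : (K : Set ℝ) ⊆ Ω₁) :
    (W.image K hK : Set ℝ) ⊆ Ω₂ := by
  rintro _ ⟨x, hx, rfl⟩
  exact W.mapsTo_inv (hK hx)

theorem pull_eq_zero (K : Compacts ℝ) (hK : (K : Set ℝ) ⊆ Ω₁) {f : ℝ → ℝ}
    (hf : EqOn f 0 (K : Set ℝ)ᶜ) : EqOn (W.pull f) 0 (W.image K hK : Set ℝ)ᶜ := by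
  intro x hx
  by_cases hxΩ : x ∈ (Ω₂ : Set ℝ)
  · have : W.map x ∉ (K : Set ℝ) := fun h => hx ⟨W.map x, h, W.leftInvOn hxΩ⟩
    simp [pull, indicator_of_mem hxΩ, hf this]
  · simp [pull, indicator_of_notMem hxΩ]

theorem contDiff_pull (K : Compacts ℝ) (hK : (K : Set ℝ) ⊆ Ω₁) {f : ℝ → ℝ}
    (hf : ContDiff ℝ ∞ f) (hf0 : EqOn f 0 (K : Set ℝ)ᶜ) : ContDiff ℝ ∞ (W.pull f) := by
  rw [contDiff_iff_contDiffAt]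
  intro x
  by_cases hx : x ∈ (Ω₂ : Set ℝ)
  · have h1 : ContDiffOn ℝ ∞ (fun x => W.weight x * f (W.map x)) Ω₂ :=
      W.contDiffOn_weight.mul (hf.comp_contDiffOn W.contDiffOn_map)
    refine (h1.contDiffAt (Ω₂.isOpen.mem_nhds hx)).congr_of_eventuallyEq ?_
    filter_upwards [Ω₂.isOpen.mem_nhds hx] with y hy
    exact indicator_of_mem hy _
  · have hx' : x ∈ (W.image K hK : Set ℝ)ᶜ := fun h => hx (W.image_subset K hK h)
    refine (contDiffAt_const (c := (0 : ℝ))).congr_of_eventuallyEq ?_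
    filter_upwards [(W.image K hK).isCompact.isClosed.isOpen_compl.mem_nhds hx'] with y hy
    exact W.pull_eq_zero K hK hf0 hy

theorem pull_bound (K : Compacts ℝ) (hK : (K : Set ℝ) ⊆ Ω₁) (i : ℕ) :
    ∃ (s : Finset ℕ) (C : ℝ), 0 ≤ C ∧ ∀ f : 𝓓^{⊤}_{K}(ℝ, ℝ), ∀ x ∈ W.image K hK,
      ‖iteratedFDeriv ℝ i (W.pull f) x‖ ≤
        C * (s.sup fun j => ContDiffMapSupportedIn.seminorm ℝ ℝ ℝ ⊤ K j) f := by
  have hO : UniqueDiffOn ℝ (Ω₂ : Set ℝ) := Ω₂.isOpen.uniqueDiffOn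
  have bdd : ∀ h : ℝ → ℝ, ContDiffOn ℝ ∞ h Ω₂ → ∃ C : ℝ, 1 ≤ C ∧ ∀ j ≤ i,
      ∀ x ∈ W.image K hK, ‖iteratedFDerivWithin ℝ j h Ω₂ x‖ ≤ C := by
    intro h hh
    have : ∀ j, ∃ C : ℝ, ∀ x ∈ W.image K hK, ‖iteratedFDerivWithin ℝ j h Ω₂ x‖ ≤ C := fun j =>
      (W.image K hK).isCompact.exists_bound_of_continuousOn
        ((hh.continuousOn_iteratedFDerivWithin (mod_cast le_top) hO).mono (W.image_subset K hK))
    choose C hC using this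
    refine ⟨1 + ∑ j ∈ Finset.range (i + 1), |C j|, ?_, fun j hj x hx => ?_⟩
    · have : 0 ≤ ∑ j ∈ Finset.range (i + 1), |C j| := Finset.sum_nonneg fun _ _ => abs_nonneg _
      linarith
    · have := Finset.single_le_sum (f := fun j => |C j|) (s := Finset.range (i + 1))
        (fun _ _ => abs_nonneg _) (Finset.mem_range_succ_iff.2 hj)
      have h2 := hC j x hx
      have h3 := le_abs_self (C j)
      linarith
  obtain ⟨A, hA1, hA⟩ := bdd _ W.contDiffOn_weight
  obtain ⟨D, hD1, hD⟩ := bdd _ W.contDiffOn_map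
  refine ⟨Finset.Iic i, ∑ j ∈ Finset.range (i + 1),
    (i.choose j : ℝ) * A * ((i - j).factorial * D ^ (i - j)), by positivity, fun f x hx => ?_⟩
  set N := ((Finset.Iic i).sup fun j => ContDiffMapSupportedIn.seminorm ℝ ℝ ℝ ⊤ K j) f with hN
  have hxΩ := W.image_subset K hK hx
  have hfs : ContDiff ℝ ∞ f := f.contDiff
  have e1 : iteratedFDeriv ℝ i (W.pull f) x =
      iteratedFDerivWithin ℝ i (fun y => W.weight y * f (W.map y)) Ω₂ x := by
    rw [← iteratedFDerivWithin_of_isOpen i Ω₂.isOpen hxΩ]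
    exact iteratedFDerivWithin_congr (fun y hy => indicator_of_mem hy _) hxΩ i
  rw [e1]
  refine (norm_iteratedFDerivWithin_mul_le W.contDiffOn_weight
    (hfs.comp_contDiffOn W.contDiffOn_map) hO hxΩ (n := i) (mod_cast le_top)).trans ?_
  rw [Finset.sum_mul]
  refine Finset.sum_le_sum fun j hj => ?_
  have hji : j ≤ i := Finset.mem_range_succ_iff.1 hj
  have h2 : ‖iteratedFDerivWithin ℝ (i - j) (fun y => f (W.map y)) Ω₂ x‖ ≤
      (i - j).factorial * N * D ^ (i - j) := by
    refine norm_iteratedFDerivWithin_comp_le (g := f) (t := univ) hfs.contDiffOn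
      W.contDiffOn_map (n := i - j) (WithTop.coe_le_coe.2 le_top) uniqueDiffOn_univ hO (mapsTo_univ _ _) hxΩ
      (fun k hk => ?_) (fun k hk1 hk => ?_)
    · rw [iteratedFDerivWithin_univ]
      exact (ContDiffMapSupportedIn.norm_iteratedFDeriv_apply_le_seminorm_top ℝ).trans
        (Seminorm.le_finset_sup_apply (Finset.mem_Iic.2 (hk.trans (Nat.sub_le _ _))))
    · exact (hD k (hk.trans (Nat.sub_le _ _)) x hx).trans (le_self_pow₀ hD1 (by omega))
  have hN0 : 0 ≤ N := apply_nonneg _ _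
  calc _ ≤ (i.choose j : ℝ) * A * ((i - j).factorial * N * D ^ (i - j)) := by
        gcongr
        · exact hA j hji x hx
        · exact h2
    _ = _ := by ring

/-- The continuous linear map `φ ↦ weight · (φ ∘ map)` on test functions. -/
def testMap : 𝓓(Ω₁, ℝ) →L[ℝ] 𝓓(Ω₂, ℝ) :=
  TestFunction.limitCLM ℝ
    (fun φ =>
      let K : Compacts ℝ := ⟨tsupport φ, φ.hasCompactSupport⟩
      have hK : (K : Set ℝ) ⊆ Ω₁ := φ.tsupport_subset
      have h0 : EqOn φ 0 (K : Set ℝ)ᶜ := fun _ hx => image_eq_zero_of_notMem_tsupport hx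
      have hz := W.pull_eq_zero K hK h0
      have hs : tsupport (W.pull φ) ⊆ W.image K hK :=
        closure_minimal (fun x hx => by_contra fun h => hx (hz h))
          (W.image K hK).isCompact.isClosed
      { toFun := W.pull φ
        contDiff' := W.contDiff_pull K hK φ.contDiff h0
        hasCompactSupport' := (W.image K hK).isCompact.of_isClosed_subset (isClosed_tsupport _) hs
        tsupport_subset' := hs.trans (W.image_subset K hK) })
    (fun K hK => (TestFunction.ofSupportedInCLM ℝ (W.image_subset K hK)).comp
      (ContDiffMapSupportedIn.mkCLM ℝ (fun f => W.pull f)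
        (fun f g x => by by_cases hx : x ∈ (Ω₂ : Set ℝ) <;> simp [pull, hx, mul_add])
        (fun c f x => by
          by_cases hx : x ∈ (Ω₂ : Set ℝ) <;> simp [pull, hx]
          ring)
        (fun f => W.contDiff_pull K hK f.contDiff f.zero_on_compl)
        (fun f => W.pull_eq_zero K hK f.zero_on_compl)
        (fun i _ => W.pull_bound K hK i)))
    (fun K hK f => rfl)

theorem testMap_apply (φ : 𝓓(Ω₁, ℝ)) (x : ℝ) :
    W.testMap φ x = (Ω₂ : Set ℝ).indicator (fun x => W.weight x * φ (W.map x)) x := rfl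

/-- The transposed operator on distributions, `⟨distMap T, φ⟩ = ⟨T, weight · (φ ∘ map)⟩`. -/
def distMap : 𝓓'(Ω₂, ℂ) →ₗ[ℂ] 𝓓'(Ω₁, ℂ) where
  toFun T := ContinuousLinearMap.precompCompactConvergenceCLM ℂ W.testMap T
  map_add' _ _ := rfl
  map_smul' _ _ := rfl

theorem distMap_apply (T : 𝓓'(Ω₂, ℂ)) (φ : 𝓓(Ω₁, ℝ)) : W.distMap T φ = T (W.testMap φ) := rfl

end WeightedMap

/-- A test function viewed as a complex-valued Schwartz function. -/
def testToSchwartz (Ω : Opens ℝ) : 𝓓(Ω, ℝ) →L[ℝ] 𝓢(ℝ, ℂ) :=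
  TestFunction.mkCLM ℝ
    (fun φ => HasCompactSupport.toSchwartzMap (f := fun x => (φ x : ℂ))
      (φ.hasCompactSupport.comp_left Complex.ofReal_zero)
      (Complex.ofRealCLM.contDiff.comp φ.contDiff))
    (fun f g => SchwartzMap.ext fun x => Complex.ofReal_add (f x) (g x))
    (fun c f => SchwartzMap.ext fun x => Complex.ofReal_mul c (f x))
    (fun K hK => by
      let L : 𝓓^{⊤}_{K}(ℝ, ℝ) →ₗ[ℝ] 𝓢(ℝ, ℂ) :=
        { toFun := fun φ => HasCompactSupport.toSchwartzMap (f := fun x => (φ x : ℂ))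
            (φ.hasCompactSupport.comp_left Complex.ofReal_zero)
            (Complex.ofRealCLM.contDiff.comp φ.contDiff)
          map_add' := fun f g => SchwartzMap.ext fun x => Complex.ofReal_add (f x) (g x)
          map_smul' := fun c f => SchwartzMap.ext fun x => Complex.ofReal_mul c (f x) }
      change Continuous L
      obtain ⟨R, hR⟩ := K.isCompact.isBounded.exists_norm_le
      refine WithSeminorms.continuous_of_isBounded
        (ContDiffMapSupportedIn.withSeminorms ℝ ℝ ℝ ⊤ K)
        (schwartz_withSeminorms ℝ ℝ ℂ) L (.of_real fun n => ⟨{n.2}, |R| ^ n.1, fun f => ?_⟩)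
      refine SchwartzMap.seminorm_le_bound ℝ n.1 n.2 _
        (mul_nonneg (by positivity) (apply_nonneg _ _)) fun x => ?_
      have h1 : ‖iteratedFDeriv ℝ n.2 (L f) x‖ = ‖iteratedFDeriv ℝ n.2 f x‖ :=
        Complex.ofRealLI.norm_iteratedFDeriv_comp_left (f := f)
          (n := (⊤ : ℕ∞)) f.contDiff.contDiffAt (WithTop.coe_le_coe.2 le_top)
      rw [h1]
      by_cases hx : x ∈ K
      · have h2 := hR x hx
        have h3 := le_abs_self R
        gcongr
        · linarith
        · simpa using ContDiffMapSupportedIn.norm_iteratedFDeriv_apply_le_seminorm_top ℝ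
            (f := f) (x := x) (i := n.2)
      · rw [f.iteratedFDeriv_zero_on_compl hx]
        simp only [Pi.zero_apply, norm_zero, mul_zero]
        exact mul_nonneg (by positivity) (apply_nonneg _ _))

theorem testToSchwartz_apply (Ω : Opens ℝ) (φ : 𝓓(Ω, ℝ)) (x : ℝ) :
    testToSchwartz Ω φ x = (φ x : ℂ) := rfl

/-- Restriction of tempered distributions on `ℝ` to an open set `Ω`. -/
def restrictTempered (Ω : Opens ℝ) : 𝓢'(ℝ, ℂ) →ₗ[ℂ] 𝓓'(Ω, ℂ) where
  toFun u := ((u : 𝓢(ℝ, ℂ) →L[ℂ] ℂ).restrictScalars ℝ).comp (testToSchwartz Ω)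
  map_add' _ _ := rfl
  map_smul' _ _ := rfl

theorem restrictTempered_apply (Ω : Opens ℝ) (u : 𝓢'(ℝ, ℂ)) (φ : 𝓓(Ω, ℝ)) :
    restrictTempered Ω u φ = u (testToSchwartz Ω φ) := rfl

/-- The open half-axis `ℝ₊ = (0, ∞)`. -/
def halfLine : Opens ℝ := ⟨Ioi 0, isOpen_Ioi⟩

/-- Multiplication of distributions on `ℝ₊` by a function that is smooth on `ℝ₊`. -/
def mulDist (g : ℝ → ℝ) (hg : ContDiffOn ℝ ∞ g (Ioi 0)) :
    𝓓'(halfLine, ℂ) →ₗ[ℂ] 𝓓'(halfLine, ℂ) :=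
  WeightedMap.distMap
    { weight := g
      map := id
      inv := id
      contDiffOn_weight := hg
      contDiffOn_map := contDiffOn_id
      mapsTo := fun _ h => h
      continuousOn_inv := continuousOn_id
      mapsTo_inv := fun _ h => h
      leftInvOn := fun _ _ => rfl }

/-- The standard group action `(κ_λ u)(t) = λ^{1/2} u(λ t)`, extended to distributions by
`⟨κ_λ T, φ⟩ = ⟨T, κ_λ⁻¹ φ⟩` with `(κ_λ⁻¹ φ)(t) = λ^{-1/2} φ(t / λ)`. -/
def kappa (lam : {x : ℝ // 0 < x}) : 𝓓'(halfLine, ℂ) →ₗ[ℂ] 𝓓'(halfLine, ℂ) :=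
  WeightedMap.distMap
    { weight := fun _ => (lam : ℝ) ^ (-(1 / 2) : ℝ)
      map := fun t => t / lam
      inv := fun t => lam * t
      contDiffOn_weight := contDiffOn_const
      contDiffOn_map := contDiffOn_id.div_const _
      mapsTo := fun _ h => div_pos h lam.2
      continuousOn_inv := by fun_prop
      mapsTo_inv := fun _ h => mul_pos lam.2 h
      leftInvOn := fun _ _ => mul_div_cancel₀ _ lam.2.ne' }

/-- The inverse of the change of variables `(θ u)(x) = u(e^{-x})`; it maps `v` to `v(-ln t)`,
i.e. `⟨θ⁻¹ v, ψ⟩ = ⟨v, ψ(e^{-x}) e^{-x}⟩`. -/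
def thetaInv : 𝓓'((⊤ : Opens ℝ), ℂ) →ₗ[ℂ] 𝓓'(halfLine, ℂ) :=
  WeightedMap.distMap
    { weight := fun x => Real.exp (-x)
      map := fun x => Real.exp (-x)
      inv := fun t => -Real.log t
      contDiffOn_weight := (Real.contDiff_exp.comp contDiff_neg).contDiffOn
      contDiffOn_map := (Real.contDiff_exp.comp contDiff_neg).contDiffOn
      mapsTo := fun _ _ => Real.exp_pos _
      continuousOn_inv := (Real.continuousOn_log.mono fun _ h => ne_of_gt h).neg
      mapsTo_inv := fun _ _ => trivial
      leftInvOn := fun x _ => by simp }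

/-- `L²(ℝ)` with complex values. -/
abbrev L2R : Type := Lp ℂ 2 (volume : Measure ℝ)

/-- The Sobolev space `H^s(ℝ)` of the tempered distributions `u` with
`f := 𝓕⁻¹ ⟨·⟩^s 𝓕 u ∈ L²(ℝ)`, normed by `‖u‖ = ‖f‖_{L²}`, is realised as `L²(ℝ)` through the bijection
`f ↦ u = 𝓕⁻¹ ⟨·⟩^{-s} 𝓕 f`; this is that map into the tempered distributions. (Mathlib's Fourier
transform has `2π` in the exponent, which gives an equivalent norm.) -/
def sobolevEmb (s : ℝ) : L2R →L[ℂ] 𝓢'(ℝ, ℂ) :=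
  (TemperedDistribution.besselPotential ℝ ℂ (-s)).comp
    (Lp.toTemperedDistributionCLM ℂ volume 2)

/-- The range of `sobolevEmb s` is `H^s(ℝ)`. -/
theorem mem_range_sobolevEmb (s : ℝ) (u : 𝓢'(ℝ, ℂ)) :
    u ∈ range (sobolevEmb s) ↔ TemperedDistribution.MemSobolev s 2 u := by
  constructor
  · rintro ⟨f, hf⟩
    exact ⟨f, (TemperedDistribution.besselPotential_neg_apply_eq_iff s _ _).1 hf⟩
  · rintro ⟨f, hf⟩
    exact ⟨f, (TemperedDistribution.besselPotential_neg_apply_eq_iff s _ _).2 hf⟩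

/-- The elements of `H^s(ℝ)` that vanish on `ℝ₊`. -/
def vanishing (s : ℝ) : Submodule ℂ L2R :=
  LinearMap.ker (restrictTempered halfLine ∘ₗ (sobolevEmb s).toLinearMap)

instance isClosed_vanishing (s : ℝ) : IsClosed (vanishing s : Set L2R) := by
  have : (vanishing s : Set L2R) =
      ⋂ φ : 𝓓(halfLine, ℝ), {f | sobolevEmb s f (testToSchwartz halfLine φ) = 0} := by
    ext f
    simp only [SetLike.mem_coe, vanishing, LinearMap.mem_ker, mem_iInter, mem_ofPred_eq]
    exact ⟨fun h φ => congrArg (fun T : 𝓓'(halfLine, ℂ) => T φ) h,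
      fun h => DFunLike.ext _ _ h⟩
  rw [this]
  refine isClosed_iInter fun φ => isClosed_eq ?_ continuous_const
  exact (continuous_eval_const (testToSchwartz halfLine φ)).comp (sobolevEmb s).continuous

/-- The space `H^s(ℝ₊)` of restrictions to `ℝ₊` of elements of `H^s(ℝ)`. The quotient norm is
`‖v‖ = inf {‖u‖_{H^s(ℝ)} : u|_{ℝ₊} = v}`. -/
abbrev HalfSobolev (s : ℝ) : Type := L2R ⧸ vanishing s

/-- The inclusion of `H^s(ℝ₊)` into the distributions on `ℝ₊`, `[u] ↦ u|_{ℝ₊}`. -/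
def halfSobolevEmb (s : ℝ) : HalfSobolev s →ₗ[ℂ] 𝓓'(halfLine, ℂ) :=
  (vanishing s).liftQ (restrictTempered halfLine ∘ₗ (sobolevEmb s).toLinearMap) le_rfl

/-- The function `t ↦ ⟨t⟩^r = (1 + t²)^{r/2}`. -/
def bracketPow (r t : ℝ) : ℝ := (1 + t ^ 2) ^ (r / 2)

theorem contDiffOn_bracketPow (r : ℝ) : ContDiffOn ℝ ∞ (bracketPow r) (Ioi 0) :=
  ContDiffOn.rpow_const_of_ne (by fun_prop) fun t _ => (by positivity : (0 : ℝ) < 1 + t ^ 2).ne'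

/-- The inclusion of `H^{s,δ}(ℝ₊) = ⟨t⟩^{-δ} H^s(ℝ₊)` into the distributions on `ℝ₊`. As a normed
space `H^{s,δ}(ℝ₊)` is `H^s(ℝ₊)`, with `v` standing for `⟨t⟩^{-δ} v`. -/
def weightedSobolevEmb (s δ : ℝ) : HalfSobolev s →ₗ[ℂ] 𝓓'(halfLine, ℂ) :=
  mulDist (bracketPow (-δ)) (contDiffOn_bracketPow (-δ)) ∘ₗ halfSobolevEmb s

theorem contDiffOn_rpow_halfLine (r : ℝ) : ContDiffOn ℝ ∞ (fun t : ℝ => t ^ r) (Ioi 0) :=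
  ContDiffOn.rpow_const_of_ne contDiffOn_id fun _ h => ne_of_gt h

/-- The inclusion of `𝓗^{s,γ}(ℝ₊) = t^{γ-1/2} θ⁻¹ H^s(ℝ)` into the distributions on `ℝ₊`. As a
normed space `𝓗^{s,γ}(ℝ₊)` is `H^s(ℝ)`, with `v` standing for `t^{γ-1/2} θ⁻¹ v`. -/
def mellinSobolevEmb (s γ : ℝ) : L2R →ₗ[ℂ] 𝓓'(halfLine, ℂ) :=
  mulDist (fun t => t ^ (γ - 1 / 2)) (contDiffOn_rpow_halfLine (γ - 1 / 2)) ∘ₗ thetaInv ∘ₗ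
    restrictTempered ⊤ ∘ₗ (sobolevEmb s).toLinearMap

/-- A cut-off function on `[0, ∞)`: smooth, compactly supported and equal to `1` near `t = 0`
(only its values on `ℝ₊` matter). -/
structure IsCutoff (χ : ℝ → ℝ) : Prop where
  smooth : ContDiffOn ℝ ∞ χ (Ioi 0)
  eq_one : ∃ ε > 0, ∀ t ∈ Ioo 0 ε, χ t = 1
  eq_zero : ∃ R, ∀ t > R, χ t = 0

/-- The pairs `(a, b) = (χ u, (1 - χ) u) ∈ 𝓗^{s,γ}(ℝ₊) × H^s(ℝ₊)` that come from a distribution `u`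
on `ℝ₊`, with the norm `‖a‖ + ‖b‖`. -/
def coneSubmodule {χ : ℝ → ℝ} (hχ : IsCutoff χ) (s γ : ℝ) :
    Submodule ℂ (WithLp 1 (L2R × HalfSobolev s)) where
  carrier := {x | ∃ u : 𝓓'(halfLine, ℂ),
    mulDist χ hχ.smooth u = mellinSobolevEmb s γ x.fst ∧
    mulDist (fun t => 1 - χ t) (contDiffOn_const.sub hχ.smooth) u = halfSobolevEmb s x.snd}
  add_mem' := by
    rintro x y ⟨u, hu1, hu2⟩ ⟨v, hv1, hv2⟩
    exact ⟨u + v, by simp [hu1, hv1], by simp [hu2, hv2]⟩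
  zero_mem' := ⟨0, by simp, by simp⟩
  smul_mem' := by
    rintro c x ⟨u, hu1, hu2⟩
    exact ⟨c • u, by simp [hu1], by simp [hu2]⟩

/-- The cone Sobolev space `𝓚^{s,γ}(ℝ₊)` of all distributions `u` on `ℝ₊` with
`χ u ∈ 𝓗^{s,γ}(ℝ₊)` and `(1 - χ) u ∈ H^s(ℝ₊)`, normed by
`‖χ u‖_{𝓗^{s,γ}(ℝ₊)} + ‖(1 - χ) u‖_{H^s(ℝ₊)}`; `u` is represented by the pair `(χ u, (1 - χ) u)`. -/
def ConeSobolev {χ : ℝ → ℝ} (hχ : IsCutoff χ) (s γ : ℝ) : Type := coneSubmodule hχ s γ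

instance {χ : ℝ → ℝ} (hχ : IsCutoff χ) (s γ : ℝ) : NormedAddCommGroup (ConeSobolev hχ s γ) :=
  inferInstanceAs (NormedAddCommGroup (coneSubmodule hχ s γ))

instance {χ : ℝ → ℝ} (hχ : IsCutoff χ) (s γ : ℝ) : NormedSpace ℂ (ConeSobolev hχ s γ) :=
  inferInstanceAs (NormedSpace ℂ (coneSubmodule hχ s γ))

/-- The inclusion of `𝓚^{s,γ}(ℝ₊)` into the distributions on `ℝ₊`,
`(χ u, (1 - χ) u) ↦ χ u + (1 - χ) u = u`. -/
def coneSobolevEmb {χ : ℝ → ℝ} (hχ : IsCutoff χ) (s γ : ℝ) :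
    ConeSobolev hχ s γ →ₗ[ℂ] 𝓓'(halfLine, ℂ) where
  toFun x := mellinSobolevEmb s γ x.1.fst + halfSobolevEmb s x.1.snd
  map_add' x y := by
    change mellinSobolevEmb s γ (x.1.fst + y.1.fst) + halfSobolevEmb s (x.1.snd + y.1.snd) = _
    rw [map_add, map_add]
    abel
  map_smul' c x := by
    change mellinSobolevEmb s γ (c • x.1.fst) + halfSobolevEmb s (c • x.1.snd) = _
    rw [map_smul, map_smul, RingHom.id_apply, smul_add]

/-- The inclusion of `𝓚^{s,γ}(ℝ₊)^ρ = ⟨t⟩^{-ρ} 𝓚^{s,γ}(ℝ₊)` into the distributions on `ℝ₊`. As a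
normed space `𝓚^{s,γ}(ℝ₊)^ρ` is `𝓚^{s,γ}(ℝ₊)`, with `v` standing for `⟨t⟩^{-ρ} v`. -/
def weightedConeEmb {χ : ℝ → ℝ} (hχ : IsCutoff χ) (s γ ρ : ℝ) :
    ConeSobolev hχ s γ →ₗ[ℂ] 𝓓'(halfLine, ℂ) :=
  mulDist (bracketPow (-ρ)) (contDiffOn_bracketPow (-ρ)) ∘ₗ coneSobolevEmb hχ s γ

/-- The points `(x', ξ', μ)`; here `m = n - 1` is the dimension of the boundary. -/
abbrev PhaseSpace (m : ℕ) : Type := EuclideanSpace ℝ (Fin m) × EuclideanSpace ℝ (Fin m) × ℝ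

/-- The parameter domain `ℝ^m × ℝ^m × [0, ∞)`. -/
def phaseDomain (m : ℕ) : Set (PhaseSpace m) := {p | 0 ≤ p.2.2}

/-- `⟨ξ'⟩ = (1 + |ξ'|²)^{1/2}`. -/
def japXi {m : ℕ} (p : PhaseSpace m) : {x : ℝ // 0 < x} :=
  ⟨√(1 + ‖p.2.1‖ ^ 2), by positivity⟩

/-- `⟨ξ', μ⟩ = (1 + |ξ'|² + μ²)^{1/2}`. -/
def japXiMu {m : ℕ} (p : PhaseSpace m) : {x : ℝ // 0 < x} :=
  ⟨√(1 + ‖p.2.1‖ ^ 2 + p.2.2 ^ 2), by positivity⟩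

section Derivatives

variable {V F : Type*} [NormedAddCommGroup V] [NormedSpace ℝ V]
  [NormedAddCommGroup F] [NormedSpace ℝ F]

/-- The derivative of `f` in direction `v`, for functions on `S`. -/
def dirDeriv (S : Set V) (v : V) (f : V → F) : V → F := fun p => fderivWithin ℝ f S p v

/-- The derivative `∂^α` with respect to the directions `e 0, …, e (m - 1)`. -/
def multiDeriv (S : Set V) {m : ℕ} (e : Fin m → V) (α : Fin m → ℕ) (f : V → F) : V → F :=
  (List.finRange m).foldr (fun i g => (dirDeriv S (e i))^[α i] g) f

/-- The derivative `∂_{x'}^β ∂_{ξ'}^α ∂_μ^j f` of a function on `S ⊆ V`, where `V` contains the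
variables `(x', ξ', μ)` through the linear map `incl`. It differs from `D_{x'}^β D_{ξ'}^α D_μ^j f`,
`D = -i∂`, by a constant factor of modulus one, which no norm sees. -/
def paramDeriv {m : ℕ} (incl : PhaseSpace m →ₗ[ℝ] V) (S : Set V) (β α : Fin m → ℕ) (j : ℕ)
    (f : V → F) : V → F :=
  multiDeriv S (fun i => incl (EuclideanSpace.single i 1, 0, 0)) β
    (multiDeriv S (fun i => incl (0, EuclideanSpace.single i 1, 0)) α
      ((dirDeriv S (incl (0, 0, 1)))^[j] f))

end Derivatives

/-- Length of a multi-index. -/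
def multiAbs {m : ℕ} (α : Fin m → ℕ) : ℕ := ∑ i, α i

/-- The domain `ℝ^m × ℝ^m × [0, ∞) × (0, ∞)` of symbol-kernels, whose points are
`((x', ξ', μ), x_n)`. -/
def kernelDomain (m : ℕ) : Set (PhaseSpace m × ℝ) := phaseDomain m ×ˢ Ioi 0

/-- `k` is a weakly parameter-dependent Poisson symbol-kernel of order `d + 1/2` and
regularity `ν`. -/
structure IsWeakPoissonKernel {m : ℕ} (d ν : ℝ) (k : PhaseSpace m × ℝ → ℂ) : Prop where
  smooth : ContDiffOn ℝ ∞ k (kernelDomain m)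
  estimate : ∀ (β α : Fin m → ℕ) (j l l' : ℕ), ∃ C : ℝ, ∀ p ∈ phaseDomain m,
    eLpNorm (fun t : ℝ => paramDeriv (LinearMap.inl ℝ (PhaseSpace m) ℝ) (kernelDomain m) β α j
        (fun q => (q.2 : ℂ) ^ l * (dirDeriv (kernelDomain m) (0, 1))^[l'] k q) (p, t))
      2 (volume.restrict (Ioi 0)) ≤
    ENNReal.ofReal (C *
      ((japXi p / japXiMu p : ℝ) ^ (ν - max ((l : ℝ) - l') 0 - multiAbs α) *
        (japXiMu p : ℝ) ^ (d - l + l' - multiAbs α - j)))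

section OperatorValued

variable {m : ℕ} {E : Type*} [NormedAddCommGroup E] [NormedSpace ℂ E]

/-- The operator `K p : ℂ → 𝓓'(ℝ₊)` is `c ↦ c · k(p, ·)` for all `p = (x', ξ', μ)`. -/
def IsKernelOf (k : PhaseSpace m × ℝ → ℂ) (K : PhaseSpace m → ℂ →ₗ[ℂ] 𝓓'(halfLine, ℂ)) : Prop :=
  ∀ p ∈ phaseDomain m, ∀ (c : ℂ) (φ : 𝓓(halfLine, ℝ)),
    K p c φ = ∫ t in Ioi (0 : ℝ), k (p, t) * c * φ t

/-- `A` is a smooth function with values in `𝓛(ℂ, E)` that coincides with `K` under the inclusion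
`emb` of `E` into the distributions on `ℝ₊`. -/
def IsSmoothLift (emb : E →ₗ[ℂ] 𝓓'(halfLine, ℂ)) (K : PhaseSpace m → ℂ →ₗ[ℂ] 𝓓'(halfLine, ℂ))
    (A : PhaseSpace m → ℂ →L[ℂ] E) : Prop :=
  ContDiffOn ℝ ∞ A (phaseDomain m) ∧ ∀ p ∈ phaseDomain m, ∀ c, emb (A p c) = K p c

/-- `K ∈ C^∞(ℝ^m × ℝ^m × [0, ∞), 𝓛(ℂ, E))`, where `E` is a normed space included in the
distributions on `ℝ₊` by `emb`. -/
def SmoothInto (emb : E →ₗ[ℂ] 𝓓'(halfLine, ℂ))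
    (K : PhaseSpace m → ℂ →ₗ[ℂ] 𝓓'(halfLine, ℂ)) : Prop :=
  ∃ A, IsSmoothLift emb K A

/-- `K` is a smooth function with values in `𝓛(ℂ, E)` and satisfies the estimates
`‖κ_{lam}⁻¹ ∂_{x'}^β ∂_{ξ'}^α ∂_μ^j K‖_{𝓛(ℂ, E)} ≤ C ⟨ξ'⟩^{ν-|α|} ⟨ξ', μ⟩^{d-ν-j}` for all orders of
derivatives; `e` is the element `κ_{lam}⁻¹ (∂_{x'}^β ∂_{ξ'}^α ∂_μ^j K) c` of `E`. -/
def IsWeakSymbol (emb : E →ₗ[ℂ] 𝓓'(halfLine, ℂ)) (lam : PhaseSpace m → {x : ℝ // 0 < x})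
    (d ν : ℝ) (K : PhaseSpace m → ℂ →ₗ[ℂ] 𝓓'(halfLine, ℂ)) : Prop :=
  ∃ A, IsSmoothLift emb K A ∧ ∀ (β α : Fin m → ℕ) (j : ℕ), ∃ C : ℝ, ∀ p ∈ phaseDomain m, ∀ c : ℂ,
    ∃ e : E, emb e = kappa (lam p)⁻¹
        (emb (paramDeriv LinearMap.id (phaseDomain m) β α j A p c)) ∧
      ‖e‖ ≤ C * ((japXi p : ℝ) ^ (ν - multiAbs α) * (japXiMu p : ℝ) ^ (d - ν - j)) * ‖c‖

end OperatorValued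

end

/-!
The norms `‖t^l ∂_t^{l'} w‖` in `L²(ℝ₊)` are homogeneous under the group action: `κ_λ⁻¹` multiplies
them by `λ^{l - l'}`. The scaling by `⟨ξ'⟩` therefore turns the estimates of a symbol-kernel with
`l' ≤ l` into bounds by `⟨ξ'⟩^{ν-|α|} ⟨ξ', μ⟩^{d-ν-j}`, and the scaling by `⟨ξ', μ⟩` does the same
for those with `l ≤ l'`. For smooth functions, the norms with `l' ≤ l` determine the spaces
`𝒦^{s,0}(ℝ₊)^ρ`: near `0` the substitution `t = e^{-x}` turns `t^l ∂_t^l` into derivatives in `x`,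
and the remaining powers of `t` account for the behaviour at infinity. The norms with `l = 0`
determine the spaces `H^s(ℝ₊)`: since the operator `1 + ∂` has a causal inverse, a function on `ℝ₊`
extends to an element of `H^N(ℝ)` once its derivatives up to order `N` are square integrable.
Finally, the remaining norms with `0 < l < l'` lie below the sum of those with `l = 0` and `l = l'`.

Conversely, a smooth family in all spaces `H^s(ℝ₊)` has a smooth kernel, because point evaluations
of derivatives are continuous on `H^s(ℝ)` for large `s` and the quotient map onto `H^s(ℝ₊)` has a
continuous linear section.
-/

open FourierTransform Filter Topology
open scoped NNReal

noncomputable section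

/-! ### Powers of the Japanese bracket -/

theorem bracketPow_pos (r t : ℝ) : 0 < bracketPow r t := by unfold bracketPow; positivity

theorem continuous_bracketPow (r : ℝ) : Continuous (bracketPow r) :=
  Continuous.rpow_const (by fun_prop) fun _ => Or.inl (by positivity)

theorem bracketPow_mul_bracketPow (r s t : ℝ) :
    bracketPow r t * bracketPow s t = bracketPow (r + s) t := by
  rw [bracketPow, bracketPow, bracketPow, ← Real.rpow_add (by positivity), add_div]

theorem bracketPow_zero (t : ℝ) : bracketPow 0 t = 1 := by simp [bracketPow]

theorem bracketPow_neg_mul_bracketPow (r t : ℝ) : bracketPow (-r) t * bracketPow r t = 1 := by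
  rw [bracketPow_mul_bracketPow, neg_add_cancel, bracketPow_zero]

theorem bracketPow_natCast (n : ℕ) (t : ℝ) : bracketPow n t = √(1 + t ^ 2) ^ n := by
  rw [bracketPow, Real.sqrt_eq_rpow, ← Real.rpow_mul_natCast (by positivity)]
  ring_nf

theorem bracketPow_le_bracketPow {r s : ℝ} (h : r ≤ s) (t : ℝ) :
    bracketPow r t ≤ bracketPow s t :=
  Real.rpow_le_rpow_of_exponent_le (by nlinarith [sq_nonneg t]) (by linarith)

theorem abs_pow_le_bracketPow (n : ℕ) (t : ℝ) : |t| ^ n ≤ bracketPow n t := by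
  rw [bracketPow_natCast]
  gcongr
  exact Real.abs_le_sqrt (by linarith)

/-! ### Sobolev functions on the Fourier side -/

theorem integral_schwartz_mul_eq_integral_fourier (f : L2R) (ψ : 𝓢(ℝ, ℂ)) :
    ∫ x, ψ x * f x = ∫ ξ, (𝓕⁻ ψ) ξ * (𝓕 f : L2R) ξ := by
  have h := congrArg (fun T : 𝓢'(ℝ, ℂ) => T (𝓕⁻ ψ)) (Lp.fourier_toTemperedDistribution_eq f)
  simpa [Lp.toTemperedDistribution_apply] using h

theorem sobolevEmb_apply (s : ℝ) (f : L2R) (ψ : 𝓢(ℝ, ℂ)) :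
    sobolevEmb s f ψ =
      ∫ ξ, (bracketPow (-s) ξ : ℂ) * (𝓕⁻ ψ) ξ * (𝓕 f : L2R) ξ := by
  have hdef : sobolevEmb s f ψ = (f : 𝓢'(ℝ, ℂ)) (𝓕 (SchwartzMap.smulLeftCLM ℂ
      (fun x : ℝ ↦ (((1 + ‖x‖ ^ 2) ^ (-s / 2) : ℝ) : ℂ)) (𝓕⁻ ψ))) := rfl
  rw [hdef, Lp.toTemperedDistribution_apply]
  simp only [smul_eq_mul]
  rw [integral_schwartz_mul_eq_integral_fourier, fourierInv_fourier_eq]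
  congr 1 with ξ
  rw [SchwartzMap.smulLeftCLM_apply_apply (by fun_prop), smul_eq_mul, Real.norm_eq_abs, sq_abs,
    bracketPow]

theorem exists_fourier_ae_eq_mul {b : ℝ → ℂ} (hb : Continuous b) {C : ℝ≥0} (hC : ∀ ξ, ‖b ξ‖ ≤ C)
    (F : L2R) : ∃ f : L2R, ((𝓕 f : L2R) : ℝ → ℂ) =ᵐ[volume] (fun ξ => b ξ * (𝓕 F : L2R) ξ) ∧
      ‖f‖ₑ ≤ C * ‖F‖ₑ := by
  have hm : MemLp (fun ξ => b ξ * (𝓕 F : L2R) ξ) 2 volume :=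
    MemLp.of_le_mul (c := C) (Lp.memLp (𝓕 F : L2R))
      (hb.aestronglyMeasurable.mul (Lp.aestronglyMeasurable _))
      (ae_of_all _ fun ξ => by rw [norm_mul]; gcongr; exact hC ξ)
  have hpointwise : ∀ ξ, ‖b ξ * (𝓕 F : L2R) ξ‖₊ ≤ C * ‖(𝓕 F : L2R) ξ‖₊ := fun ξ => by
    rw [nnnorm_mul]; gcongr; exact hC ξ
  have plancherel : ∀ G : L2R, ‖G‖ₑ = ‖(𝓕 G : L2R)‖ₑ := fun G => by
    rw [← ofReal_norm, ← ofReal_norm, Lp.norm_fourier_eq]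
  refine ⟨𝓕⁻ (hm.toLp _), ?_, ?_⟩
  · rw [fourier_fourierInv_eq]
    exact hm.coeFn_toLp
  · rw [plancherel, fourier_fourierInv_eq, plancherel F, Lp.enorm_def, Lp.enorm_def,
      eLpNorm_congr_ae hm.coeFn_toLp]
    exact eLpNorm_le_nnreal_smul_eLpNorm_of_ae_le_mul (ae_of_all _ hpointwise) 2

/-- The operator `1 + ∂` on Schwartz functions. Its inverse is convolution with the causal kernel
`e^{-x} 1_{x > 0}`, so that, in contrast to `⟨D⟩`, it can be inverted within the functions
supported in `[a, ∞)`. -/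
def oneAddDeriv : 𝓢(ℝ, ℂ) →L[ℂ] 𝓢(ℝ, ℂ) :=
  ContinuousLinearMap.id ℂ _ + SchwartzMap.derivCLM ℂ ℂ

theorem oneAddDeriv_apply (ψ : 𝓢(ℝ, ℂ)) (x : ℝ) : oneAddDeriv ψ x = ψ x + deriv ψ x := rfl

theorem fourierInv_derivCLM_apply (ψ : 𝓢(ℝ, ℂ)) (ξ : ℝ) :
    (𝓕⁻ (SchwartzMap.derivCLM ℂ ℂ ψ)) ξ = -(2 * Real.pi * Complex.I * ξ) * (𝓕⁻ ψ) ξ := by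
  have h : SchwartzMap.derivCLM ℂ ℂ ψ = LineDeriv.lineDerivOp (1 : ℝ) ψ := by
    ext x
    rw [SchwartzMap.derivCLM_apply, SchwartzMap.lineDerivOp_apply_eq_fderiv,
      fderiv_apply_one_eq_deriv]
  rw [h, SchwartzMap.fourierInv_lineDerivOp_eq, smul_apply,
    SchwartzMap.smulLeftCLM_apply_apply (by fun_prop)]
  simp only [RCLike.inner_apply, Real.ringHom_apply, one_mul, Complex.real_smul, smul_eq_mul,
    neg_mul, neg_inj]
  ring

theorem fourierInv_oneAddDeriv_apply (ψ : 𝓢(ℝ, ℂ)) (ξ : ℝ) :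
    (𝓕⁻ (oneAddDeriv ψ)) ξ = (1 - 2 * Real.pi * Complex.I * ξ) * (𝓕⁻ ψ) ξ := by
  have h : oneAddDeriv ψ = ψ + SchwartzMap.derivCLM ℂ ℂ ψ := rfl
  rw [h, FourierTransform.fourierInv_add, add_apply, fourierInv_derivCLM_apply]
  ring

theorem fourierInv_iterate_oneAddDeriv_apply (N : ℕ) (ψ : 𝓢(ℝ, ℂ)) (ξ : ℝ) :
    (𝓕⁻ (oneAddDeriv^[N] ψ)) ξ = (1 - 2 * Real.pi * Complex.I * ξ) ^ N * (𝓕⁻ ψ) ξ := by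
  induction N with
  | zero => simp
  | succ N ih => rw [Function.iterate_succ_apply', fourierInv_oneAddDeriv_apply, ih]; ring

theorem one_sub_two_pi_I_mul_ne_zero (ξ : ℝ) : (1 - 2 * Real.pi * Complex.I * ξ : ℂ) ≠ 0 := by
  intro h
  simpa using congrArg Complex.re h

theorem hasTemperateGrowth_inv_one_sub_two_pi_I_mul :
    (fun ξ : ℝ => (1 - 2 * Real.pi * Complex.I * ξ : ℂ)⁻¹).HasTemperateGrowth := by
  have hinv : (fun ξ : ℝ => (1 - 2 * Real.pi * Complex.I * ξ : ℂ)⁻¹) =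
      fun ξ : ℝ => (1 + 2 * Real.pi * Complex.I * ξ : ℂ) *
        (((1 + ‖(2 * Real.pi) * ξ‖ ^ 2) ^ (-1 : ℝ) : ℝ) : ℂ) := by
    ext ξ
    have hnormSq : Complex.normSq (1 - 2 * Real.pi * Complex.I * ξ) =
        1 + ‖(2 * Real.pi) * ξ‖ ^ 2 := by
      rw [Real.norm_eq_abs, sq_abs]
      simp [Complex.normSq_apply, sq]
    rw [Complex.inv_def, hnormSq, Real.rpow_neg_one]
    congr 1
    apply Complex.ext <;> simp
  have hnum : (fun ξ : ℝ => (1 + 2 * Real.pi * Complex.I * ξ : ℂ)).HasTemperateGrowth := by fun_prop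
  have hbracket : (fun x : ℝ => (((1 + ‖x‖ ^ 2) ^ (-1 : ℝ) : ℝ) : ℂ)).HasTemperateGrowth := by
    fun_prop
  have hscale : (fun x : ℝ => (2 * Real.pi) * x).HasTemperateGrowth := by fun_prop
  rw [hinv]
  exact hnum.mul (hbracket.comp hscale)

theorem oneAddDeriv_surjective : Function.Surjective oneAddDeriv := by
  intro φ
  set η := SchwartzMap.smulLeftCLM ℂ (fun ξ : ℝ => (1 - 2 * Real.pi * Complex.I * ξ : ℂ)⁻¹) (𝓕⁻ φ)
    with hη
  have h : 𝓕⁻ (oneAddDeriv (𝓕 η)) = 𝓕⁻ φ := by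
    ext ξ
    rw [fourierInv_oneAddDeriv_apply, fourierInv_fourier_eq, hη,
      SchwartzMap.smulLeftCLM_apply_apply hasTemperateGrowth_inv_one_sub_two_pi_I_mul, smul_eq_mul,
      mul_inv_cancel_left₀ (one_sub_two_pi_I_mul_ne_zero ξ)]
  have hfourier := congrArg (fun f : 𝓢(ℝ, ℂ) => (𝓕 f : 𝓢(ℝ, ℂ))) h
  exact ⟨𝓕 η, by simpa only [fourier_fourierInv_eq] using hfourier⟩

theorem eq_zero_of_oneAddDeriv_eq_zero {ψ : 𝓢(ℝ, ℂ)} {a : ℝ}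
    (h : ∀ x < a, oneAddDeriv ψ x = 0) : ∀ x < a, ψ x = 0 := by
  set g : ℝ → ℂ := fun x => (Real.exp x : ℂ) * ψ x with hg
  have hderiv : ∀ x < a, HasDerivAt g 0 x := by
    intro x hx
    refine ((Real.hasDerivAt_exp x).ofReal_comp.mul ψ.differentiableAt.hasDerivAt).congr_deriv ?_
    rw [← mul_add, ← oneAddDeriv_apply, h x hx, mul_zero]
  have hconst : ∀ x < a, ∀ y < a, g x = g y := fun x hx y hy =>
    isOpen_Iio.is_const_of_deriv_eq_zero isPreconnected_Iio
      (fun z hz => (hderiv z hz).differentiableAt.differentiableWithinAt)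
      (fun z hz => (hderiv z hz).deriv) hx hy
  have hlim : Tendsto g atBot (𝓝 0) := by
    obtain ⟨C, -, hC⟩ := ψ.decay 0 0
    refine squeeze_zero_norm (a := fun x => Real.exp x * C) (fun x => ?_) ?_
    · rw [hg, norm_mul, Complex.norm_real, Real.norm_eq_abs, Real.abs_exp]
      gcongr
      simpa using hC x
    · simpa using Real.tendsto_exp_atBot.mul_const C
  intro x hx
  have hgx : Tendsto g atBot (𝓝 (g x)) :=
    tendsto_const_nhds.congr' <| by
      filter_upwards [Iio_mem_atBot a] with y hy using hconst x hx y hy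
  have hexp : (Real.exp x : ℂ) ≠ 0 := mod_cast (Real.exp_pos x).ne'
  exact (mul_eq_zero.1 (tendsto_nhds_unique hgx hlim)).resolve_left hexp

theorem exists_iterate_oneAddDeriv_eq (N : ℕ) {φ : 𝓢(ℝ, ℂ)} {a : ℝ} (h : ∀ x < a, φ x = 0) :
    ∃ ψ : 𝓢(ℝ, ℂ), oneAddDeriv^[N] ψ = φ ∧ ∀ x < a, ψ x = 0 := by
  induction N generalizing φ with
  | zero => exact ⟨φ, rfl, h⟩
  | succ N ih =>
    obtain ⟨ψ₁, rfl⟩ := oneAddDeriv_surjective φ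
    obtain ⟨ψ, rfl, hψ⟩ := ih (eq_zero_of_oneAddDeriv_eq_zero h)
    exact ⟨ψ, Function.iterate_succ_apply' _ _ _, hψ⟩

theorem tsupport_oneAddDeriv_subset (ψ : 𝓢(ℝ, ℂ)) : tsupport (oneAddDeriv ψ) ⊆ tsupport ψ := by
  refine closure_minimal (fun x hx => ?_) (isClosed_tsupport _)
  by_contra h
  refine hx ?_
  rw [oneAddDeriv_apply, image_eq_zero_of_notMem_tsupport h,
    image_eq_zero_of_notMem_tsupport (fun h' => h (tsupport_deriv_subset h')), add_zero]

theorem tsupport_iterate_oneAddDeriv_subset (N : ℕ) (ψ : 𝓢(ℝ, ℂ)) :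
    tsupport (oneAddDeriv^[N] ψ) ⊆ tsupport ψ := by
  induction N with
  | zero => rfl
  | succ N ih =>
    rw [Function.iterate_succ_apply']
    exact (tsupport_oneAddDeriv_subset _).trans ih

/-! ### Integration by parts on open subsets of the line -/

section OpenSet

variable {S : Set ℝ}

theorem setIntegral_deriv_mul_eq_neg (hS : IsOpen S) {w ψ : ℝ → ℂ}
    (hw : DifferentiableOn ℝ w S) (hψ : Differentiable ℝ ψ) (hψS : tsupport ψ ⊆ S)
    (hint : IntegrableOn (fun x => w x * ψ x) S)
    (hint_left : IntegrableOn (fun x => deriv w x * ψ x) S)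
    (hint_right : IntegrableOn (fun x => w x * deriv ψ x) S) :
    ∫ x in S, deriv w x * ψ x = -∫ x in S, w x * deriv ψ x := by
  have hderiv : ∀ x, HasDerivAt (S.indicator fun x => w x * ψ x)
      (S.indicator (fun x => deriv w x * ψ x + w x * deriv ψ x) x) x := by
    intro x
    by_cases hx : x ∈ S
    · rw [indicator_of_mem hx]
      refine ((hw.differentiableAt (hS.mem_nhds hx)).hasDerivAt.mul
        (hψ x).hasDerivAt).congr_of_eventuallyEq ?_
      filter_upwards [hS.mem_nhds hx] with y hy using indicator_of_mem hy _
    · rw [indicator_of_notMem hx]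
      refine (hasDerivAt_const x (0 : ℂ)).congr_of_eventuallyEq ?_
      filter_upwards [(isClosed_tsupport ψ).isOpen_compl.mem_nhds fun h => hx (hψS h)] with y hy
      exact indicator_apply_eq_zero.2 fun _ => by rw [image_eq_zero_of_notMem_tsupport hy, mul_zero]
  have hzero := integral_eq_zero_of_hasDerivAt_of_integrable hderiv
    ((hint_left.add hint_right).integrable_indicator hS.measurableSet)
    (hint.integrable_indicator hS.measurableSet)
  rw [integral_indicator hS.measurableSet, integral_add hint_left hint_right] at hzero
  exact eq_neg_of_add_eq_zero_left hzero

theorem contDiffOn_deriv_of_isOpen {F : Type*} [NormedAddCommGroup F] [NormedSpace ℝ F]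
    (hS : IsOpen S) {w : ℝ → F} (hw : ContDiffOn ℝ ∞ w S) : ContDiffOn ℝ ∞ (deriv w) S :=
  ((contDiffOn_infty_iff_deriv_of_isOpen hS).1 hw).2

theorem contDiffOn_iteratedDeriv_of_isOpen {F : Type*} [NormedAddCommGroup F] [NormedSpace ℝ F]
    (hS : IsOpen S) {w : ℝ → F} (hw : ContDiffOn ℝ ∞ w S) (i : ℕ) :
    ContDiffOn ℝ ∞ (iteratedDeriv i w) S := by
  induction i with
  | zero => simpa using hw
  | succ i ih => rw [iteratedDeriv_succ]; exact contDiffOn_deriv_of_isOpen hS ih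

theorem aestronglyMeasurable_iteratedDeriv_of_isOpen (hS : IsOpen S) {w : ℝ → ℂ}
    (hw : ContDiffOn ℝ ∞ w S) (i : ℕ) :
    AEStronglyMeasurable (iteratedDeriv i w) (volume.restrict S) :=
  (contDiffOn_iteratedDeriv_of_isOpen hS hw i).continuousOn.aestronglyMeasurable hS.measurableSet

/-- The operator `1 - ∂`, the formal transpose of `oneAddDeriv`. -/
def oneSubDeriv (w : ℝ → ℂ) : ℝ → ℂ := w - deriv w

theorem contDiffOn_oneSubDeriv (hS : IsOpen S) {w : ℝ → ℂ} (hw : ContDiffOn ℝ ∞ w S) :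
    ContDiffOn ℝ ∞ (oneSubDeriv w) S :=
  hw.sub (contDiffOn_deriv_of_isOpen hS hw)

theorem iteratedDeriv_oneSubDeriv_ae_eq (hS : IsOpen S) {w : ℝ → ℂ} (hw : ContDiffOn ℝ ∞ w S)
    (i : ℕ) : iteratedDeriv i (oneSubDeriv w) =ᵐ[volume.restrict S]
      iteratedDeriv i w - iteratedDeriv (i + 1) w := by
  filter_upwards [ae_restrict_mem hS.measurableSet] with x hx
  rw [oneSubDeriv, iteratedDeriv_sub ((hw.contDiffAt (hS.mem_nhds hx)).of_le (mod_cast le_top))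
    (((contDiffOn_deriv_of_isOpen hS hw).contDiffAt (hS.mem_nhds hx)).of_le (mod_cast le_top)),
    Pi.sub_apply, iteratedDeriv_succ']

theorem memLp_iteratedDeriv_oneSubDeriv (hS : IsOpen S) {w : ℝ → ℂ} (hw : ContDiffOn ℝ ∞ w S)
    (hL : ∀ i, MemLp (iteratedDeriv i w) 2 (volume.restrict S)) (i : ℕ) :
    MemLp (iteratedDeriv i (oneSubDeriv w)) 2 (volume.restrict S) :=
  ((hL i).sub (hL (i + 1))).ae_eq (iteratedDeriv_oneSubDeriv_ae_eq hS hw i).symm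

theorem memLp_iterate_oneSubDeriv (hS : IsOpen S) (N : ℕ) {w : ℝ → ℂ} (hw : ContDiffOn ℝ ∞ w S)
    (hL : ∀ i, MemLp (iteratedDeriv i w) 2 (volume.restrict S)) :
    MemLp (oneSubDeriv^[N] w) 2 (volume.restrict S) := by
  induction N generalizing w with
  | zero => simpa using hL 0
  | succ _ ih =>
    exact ih (contDiffOn_oneSubDeriv hS hw) (memLp_iteratedDeriv_oneSubDeriv hS hw hL)

theorem eLpNorm_iterate_oneSubDeriv_le (hS : IsOpen S) (N : ℕ) {w : ℝ → ℂ}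
    (hw : ContDiffOn ℝ ∞ w S) : eLpNorm (oneSubDeriv^[N] w) 2 (volume.restrict S) ≤
      2 ^ N * ∑ i ∈ Finset.range (N + 1), eLpNorm (iteratedDeriv i w) 2 (volume.restrict S) := by
  set n : (ℝ → ℂ) → ℕ → ℝ≥0∞ := fun w i => eLpNorm (iteratedDeriv i w) 2 (volume.restrict S)
  change _ ≤ 2 ^ N * ∑ i ∈ Finset.range (N + 1), n w i
  induction N generalizing w with
  | zero => simp [n]
  | succ N ih =>
    have hstep : ∀ i, n (oneSubDeriv w) i ≤ n w i + n w (i + 1) := fun i => by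
      change eLpNorm _ 2 _ ≤ _
      rw [eLpNorm_congr_ae (iteratedDeriv_oneSubDeriv_ae_eq hS hw i)]
      exact eLpNorm_sub_le (aestronglyMeasurable_iteratedDeriv_of_isOpen hS hw i)
        (aestronglyMeasurable_iteratedDeriv_of_isOpen hS hw (i + 1)) (by norm_num)
    calc eLpNorm (oneSubDeriv^[N] (oneSubDeriv w)) 2 (volume.restrict S)
      _ ≤ 2 ^ N * ∑ i ∈ Finset.range (N + 1), n (oneSubDeriv w) i :=
        ih (contDiffOn_oneSubDeriv hS hw)
      _ ≤ 2 ^ N * ∑ i ∈ Finset.range (N + 1), (n w i + n w (i + 1)) := by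
        gcongr with i; exact hstep i
      _ ≤ 2 ^ N * (∑ i ∈ Finset.range (N + 2), n w i + ∑ i ∈ Finset.range (N + 2), n w i) := by
        rw [Finset.sum_add_distrib]
        refine mul_le_mul_right (add_le_add ?_ ?_) _
        · rw [Finset.sum_range_succ _ (N + 1)]; exact le_self_add
        · rw [Finset.sum_range_succ' _ (N + 1)]; exact le_self_add
      _ = 2 ^ (N + 1) * ∑ i ∈ Finset.range (N + 2), n w i := by rw [← two_mul]; ring

theorem setIntegral_mul_oneAddDeriv (hS : IsOpen S) {w : ℝ → ℂ} (hw : DifferentiableOn ℝ w S)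
    (hLw : MemLp w 2 (volume.restrict S)) (hLw' : MemLp (deriv w) 2 (volume.restrict S))
    {ψ : 𝓢(ℝ, ℂ)} (hψ : tsupport ψ ⊆ S) :
    ∫ x in S, w x * oneAddDeriv ψ x = ∫ x in S, oneSubDeriv w x * ψ x := by
  have hLψ : MemLp ψ 2 (volume.restrict S) := (ψ.memLp 2).restrict S
  have hLψ' : MemLp (deriv ψ) 2 (volume.restrict S) :=
    ((SchwartzMap.derivCLM ℂ ℂ ψ).memLp 2 volume).restrict S
  have hint : IntegrableOn (fun x => w x * ψ x) S := hLw.integrable_mul hLψ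
  have hint_left : IntegrableOn (fun x => deriv w x * ψ x) S := hLw'.integrable_mul hLψ
  have hint_right : IntegrableOn (fun x => w x * deriv ψ x) S := hLw.integrable_mul hLψ'
  simp only [oneAddDeriv_apply, oneSubDeriv, Pi.sub_apply, mul_add, sub_mul]
  rw [integral_add hint hint_right, integral_sub hint hint_left,
    setIntegral_deriv_mul_eq_neg hS hw ψ.differentiable hψ hint hint_left hint_right,
    sub_neg_eq_add]

theorem setIntegral_mul_iterate_oneAddDeriv (hS : IsOpen S) (N : ℕ) {w : ℝ → ℂ}
    (hw : ContDiffOn ℝ ∞ w S) (hL : ∀ i, MemLp (iteratedDeriv i w) 2 (volume.restrict S))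
    {ψ : 𝓢(ℝ, ℂ)} (hψ : tsupport ψ ⊆ S) :
    ∫ x in S, w x * (oneAddDeriv^[N] ψ) x = ∫ x in S, (oneSubDeriv^[N] w) x * ψ x := by
  induction N generalizing w with
  | zero => rfl
  | succ N ih =>
    rw [Function.iterate_succ_apply', setIntegral_mul_oneAddDeriv hS (hw.differentiableOn (by simp))
      (by simpa using hL 0) (by simpa using hL 1)
      ((tsupport_iterate_oneAddDeriv_subset N ψ).trans hψ)]
    exact ih (contDiffOn_oneSubDeriv hS hw) (memLp_iteratedDeriv_oneSubDeriv hS hw hL)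

theorem exists_L2_integral_iterate_oneAddDeriv (hS : IsOpen S) (N : ℕ) {w : ℝ → ℂ}
    (hw : ContDiffOn ℝ ∞ w S) (hL : ∀ i, MemLp (iteratedDeriv i w) 2 (volume.restrict S)) :
    ∃ F : L2R, ‖F‖ₑ ≤ 2 ^ N * ∑ i ∈ Finset.range (N + 1),
        eLpNorm (iteratedDeriv i w) 2 (volume.restrict S) ∧
      ∀ ψ : 𝓢(ℝ, ℂ), tsupport ψ ⊆ S →
        ∫ x in S, w x * (oneAddDeriv^[N] ψ) x = ∫ x, ψ x * F x := by
  have hF : MemLp (S.indicator (oneSubDeriv^[N] w)) 2 volume :=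
    (memLp_indicator_iff_restrict hS.measurableSet).2 (memLp_iterate_oneSubDeriv hS N hw hL)
  refine ⟨hF.toLp _, ?_, fun ψ hψ => ?_⟩
  · rw [Lp.enorm_def, eLpNorm_congr_ae hF.coeFn_toLp,
      eLpNorm_indicator_eq_eLpNorm_restrict hS.measurableSet]
    exact eLpNorm_iterate_oneSubDeriv_le hS N hw
  · rw [setIntegral_mul_iterate_oneAddDeriv hS N hw hL hψ, ← integral_indicator hS.measurableSet]
    refine integral_congr_ae ?_
    filter_upwards [hF.coeFn_toLp] with x hx
    rw [hx, mul_comm, indicator_mul_left]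

end OpenSet

/-! ### Distributions represented by functions -/

section Represents

variable {Ω : Opens ℝ}

/-- The distribution `T` on `Ω` is given by integration against `w`. -/
def Represents (T : 𝓓'(Ω, ℂ)) (w : ℝ → ℂ) : Prop :=
  ∀ φ : 𝓓(Ω, ℝ), T φ = ∫ t in (Ω : Set ℝ), w t * φ t

theorem Represents.ext {T S : 𝓓'(Ω, ℂ)} {w : ℝ → ℂ} (hT : Represents T w)
    (hS : Represents S w) : T = S := DFunLike.ext _ _ fun φ => (hT φ).trans (hS φ).symm

theorem Represents.congr {T : 𝓓'(Ω, ℂ)} {w v : ℝ → ℂ} (hT : Represents T w)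
    (h : EqOn w v Ω) : Represents T v := fun φ =>
  (hT φ).trans (setIntegral_congr_fun Ω.isOpen.measurableSet fun t ht => by simp only [h ht])

theorem ofReal_test_eq_zero_of_notMem (φ : 𝓓(Ω, ℝ)) {t : ℝ} (ht : t ∉ (Ω : Set ℝ)) :
    (φ t : ℂ) = 0 := by
  rw [image_eq_zero_of_notMem_tsupport fun h => ht (φ.tsupport_subset h), Complex.ofReal_zero]

theorem setIntegral_mul_test_eq_integral (w : ℝ → ℂ) (φ : 𝓓(Ω, ℝ)) :
    ∫ t in (Ω : Set ℝ), w t * φ t = ∫ t, w t * φ t :=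
  setIntegral_eq_integral_of_forall_compl_eq_zero fun _ ht => by
    rw [ofReal_test_eq_zero_of_notMem φ ht, mul_zero]

theorem tsupport_ofReal_test (φ : 𝓓(Ω, ℝ)) : tsupport (fun t => (φ t : ℂ)) = tsupport φ := by
  simp only [tsupport]
  congr 1
  ext t
  simp

theorem integrable_mul_test {w : ℝ → ℂ} (hw : LocallyIntegrableOn w Ω) (φ : 𝓓(Ω, ℝ)) :
    Integrable fun t => w t * φ t := by
  have hsupp : IntegrableOn (fun t => w t * φ t) (tsupport φ) :=
    (hw.integrableOn_compact_subset φ.tsupport_subset φ.hasCompactSupport).mul_continuousOn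
      (Complex.continuous_ofReal.comp φ.continuous).continuousOn φ.hasCompactSupport
  refine integrableOn_univ.1 (hsupp.of_forall_sdiff_eq_zero MeasurableSet.univ fun t ht => ?_)
  rw [image_eq_zero_of_notMem_tsupport ht.2, Complex.ofReal_zero, mul_zero]

theorem integrableOn_mul_test {w : ℝ → ℂ} (hw : ContinuousOn w Ω) (φ : 𝓓(Ω, ℝ)) :
    IntegrableOn (fun t => w t * φ t) Ω :=
  (integrable_mul_test (hw.locallyIntegrableOn Ω.isOpen.measurableSet) φ).integrableOn

theorem ae_eq_of_setIntegral_mul_test_eq {w v : ℝ → ℂ} (hw : LocallyIntegrableOn w Ω)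
    (hv : LocallyIntegrableOn v Ω)
    (h : ∀ φ : 𝓓(Ω, ℝ), ∫ t in (Ω : Set ℝ), w t * φ t = ∫ t in (Ω : Set ℝ), v t * φ t) :
    w =ᵐ[volume.restrict Ω] v := by
  have hzero := Ω.isOpen.ae_eq_zero_of_integral_contDiff_smul_eq_zero (μ := volume) (hw.sub hv)
    fun g hg hg_compact hgΩ => by
      let φ : 𝓓(Ω, ℝ) := ⟨g, hg, hg_compact, hgΩ⟩
      have hφ := h φ
      rw [setIntegral_mul_test_eq_integral, setIntegral_mul_test_eq_integral] at hφ
      calc ∫ t, g t • (w - v) t = ∫ t, w t * φ t - v t * φ t := by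
            congr 1 with t
            rw [Pi.sub_apply, Complex.real_smul, mul_comm, sub_mul]
            rfl
        _ = 0 := by
          rw [integral_sub (integrable_mul_test hw φ) (integrable_mul_test hv φ), hφ, sub_self]
  refine (ae_restrict_iff' Ω.isOpen.measurableSet).2 ?_
  filter_upwards [hzero] with t ht htΩ
  exact sub_eq_zero.1 (ht htΩ)

theorem Represents.eqOn {T : 𝓓'(Ω, ℂ)} {w v : ℝ → ℂ} (hw : Represents T w)
    (hv : Represents T v) (hwc : ContinuousOn w Ω) (hvc : ContinuousOn v Ω) : EqOn w v Ω :=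
  Measure.eqOn_open_of_ae_eq
    (ae_eq_of_setIntegral_mul_test_eq (hwc.locallyIntegrableOn Ω.isOpen.measurableSet)
      (hvc.locallyIntegrableOn Ω.isOpen.measurableSet) fun φ => (hw φ).symm.trans (hv φ))
    Ω.isOpen hwc hvc

/-- The derivative of a test function, again as a test function. -/
def testDeriv (φ : 𝓓(Ω, ℝ)) : 𝓓(Ω, ℝ) where
  toFun := deriv φ
  contDiff' := (contDiff_infty_iff_deriv.1 φ.contDiff).2
  hasCompactSupport' := φ.hasCompactSupport.deriv
  tsupport_subset' := (tsupport_deriv_subset).trans φ.tsupport_subset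

theorem hasDerivAt_ofReal_test (φ : 𝓓(Ω, ℝ)) (t : ℝ) :
    HasDerivAt (fun t => (φ t : ℂ)) (testDeriv φ t) t :=
  (φ.contDiff.differentiable (by simp)).differentiableAt.hasDerivAt.ofReal_comp

theorem testToSchwartz_testDeriv (φ : 𝓓(Ω, ℝ)) :
    testToSchwartz Ω (testDeriv φ) = SchwartzMap.derivCLM ℂ ℂ (testToSchwartz Ω φ) := by
  ext t
  exact (hasDerivAt_ofReal_test φ t).deriv.symm

theorem fourierInv_iterate_testDeriv (i : ℕ) (φ : 𝓓(Ω, ℝ)) (ξ : ℝ) :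
    (𝓕⁻ (testToSchwartz Ω (testDeriv^[i] φ))) ξ =
      (-(2 * Real.pi * Complex.I * ξ)) ^ i * (𝓕⁻ (testToSchwartz Ω φ)) ξ := by
  induction i with
  | zero => simp
  | succ i ih =>
    rw [Function.iterate_succ_apply', testToSchwartz_testDeriv, fourierInv_derivCLM_apply, ih]
    ring

theorem setIntegral_deriv_mul_test {w : ℝ → ℂ} (hw : ContDiffOn ℝ ∞ w Ω) (φ : 𝓓(Ω, ℝ)) :
    ∫ t in (Ω : Set ℝ), deriv w t * φ t = -∫ t in (Ω : Set ℝ), w t * testDeriv φ t := by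
  have hderiv : deriv (fun t => (φ t : ℂ)) = fun t => (testDeriv φ t : ℂ) :=
    funext fun t => (hasDerivAt_ofReal_test φ t).deriv
  rw [setIntegral_deriv_mul_eq_neg Ω.isOpen (hw.differentiableOn (by simp))
    (fun t => (hasDerivAt_ofReal_test φ t).differentiableAt)
    ((tsupport_ofReal_test φ).trans_subset φ.tsupport_subset)
    (integrableOn_mul_test hw.continuousOn φ)
    (integrableOn_mul_test (contDiffOn_deriv_of_isOpen Ω.isOpen hw).continuousOn φ)
    (by rw [hderiv]; exact integrableOn_mul_test hw.continuousOn _), hderiv]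

theorem setIntegral_iteratedDeriv_mul_test {w : ℝ → ℂ} (hw : ContDiffOn ℝ ∞ w Ω) (i : ℕ)
    (φ : 𝓓(Ω, ℝ)) : ∫ t in (Ω : Set ℝ), iteratedDeriv i w t * φ t =
      (-1) ^ i * ∫ t in (Ω : Set ℝ), w t * (testDeriv^[i] φ) t := by
  induction i generalizing φ with
  | zero => simp
  | succ i ih =>
    rw [iteratedDeriv_succ,
      setIntegral_deriv_mul_test (contDiffOn_iteratedDeriv_of_isOpen Ω.isOpen hw i), ih,
      Function.iterate_succ_apply]
    ring

end Represents

/-! ### Sobolev norms and derivatives -/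

theorem sqrt_one_add_sq_le_norm_one_sub_two_pi_I_mul (ξ : ℝ) :
    √(1 + ξ ^ 2) ≤ ‖(1 - 2 * Real.pi * Complex.I * ξ : ℂ)‖ := by
  have hnormSq : Complex.normSq (1 - 2 * Real.pi * Complex.I * ξ) =
      1 + (2 * Real.pi) ^ 2 * ξ ^ 2 := by
    rw [Complex.normSq_apply]
    simp only [Complex.sub_re, Complex.one_re, Complex.mul_re, Complex.re_ofNat,
      Complex.ofReal_re, Complex.im_ofNat, Complex.ofReal_im, Complex.I_re, Complex.mul_im,
      Complex.I_im, Complex.sub_im, Complex.one_im]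
    ring
  have hpi : 1 ≤ (2 * Real.pi) ^ 2 := by nlinarith [Real.pi_gt_three]
  rw [Complex.norm_def, hnormSq]
  exact Real.sqrt_le_sqrt (by nlinarith [sq_nonneg ξ])

theorem continuous_bracketPow_mul_inv_pow (s : ℝ) (N : ℕ) : Continuous fun ξ : ℝ =>
    (bracketPow s ξ : ℂ) * ((1 - 2 * Real.pi * Complex.I * ξ) ^ N)⁻¹ :=
  (Complex.continuous_ofReal.comp (continuous_bracketPow s)).mul <|
    Continuous.inv₀ (by fun_prop) fun ξ => pow_ne_zero _ (one_sub_two_pi_I_mul_ne_zero ξ)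

theorem norm_bracketPow_mul_inv_pow_le_one {s : ℝ} {N : ℕ} (h : s ≤ N) (ξ : ℝ) :
    ‖(bracketPow s ξ : ℂ) * ((1 - 2 * Real.pi * Complex.I * ξ) ^ N)⁻¹‖ ≤ 1 := by
  rw [norm_mul, norm_inv, norm_pow, Complex.norm_real, Real.norm_of_nonneg (bracketPow_pos s ξ).le]
  refine mul_inv_le_one_of_le₀ ?_ (by positivity)
  calc bracketPow s ξ ≤ bracketPow N ξ := bracketPow_le_bracketPow h ξ
    _ = √(1 + ξ ^ 2) ^ N := bracketPow_natCast N ξ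
    _ ≤ _ := by gcongr; exact sqrt_one_add_sq_le_norm_one_sub_two_pi_I_mul ξ

theorem exists_iterate_oneAddDeriv_eq_testToSchwartz {Ω : Opens ℝ} (hne : (Ω : Set ℝ).Nonempty)
    (hup : IsUpperSet (Ω : Set ℝ)) (N : ℕ) (φ : 𝓓(Ω, ℝ)) :
    ∃ ψ : 𝓢(ℝ, ℂ), oneAddDeriv^[N] ψ = testToSchwartz Ω φ ∧ tsupport ψ ⊆ Ω := by
  obtain ⟨a, haΩ, ha⟩ : ∃ a ∈ Ω, ∀ x < a, φ x = 0 := by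
    rcases (tsupport φ).eq_empty_or_nonempty with hempty | hnonempty
    · obtain ⟨a, ha⟩ := hne
      exact ⟨a, ha, fun x _ => image_eq_zero_of_notMem_tsupport (by simp [hempty])⟩
    · obtain ⟨a, ha, hleast⟩ := φ.hasCompactSupport.exists_isLeast hnonempty
      exact ⟨a, φ.tsupport_subset ha,
        fun x hx => image_eq_zero_of_notMem_tsupport fun hx' => (hleast hx').not_gt hx⟩
  obtain ⟨ψ, hψ, hψ_zero⟩ := exists_iterate_oneAddDeriv_eq N (φ := testToSchwartz Ω φ) (a := a)
    fun x hx => by rw [testToSchwartz_apply, ha x hx, Complex.ofReal_zero]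
  have hψa : tsupport ψ ⊆ Ici a :=
    closure_minimal (fun x hx => le_of_not_gt fun hxa => hx (hψ_zero x hxa)) isClosed_Ici
  exact ⟨ψ, hψ, hψa.trans fun x hx => hup hx haΩ⟩

theorem exists_sobolevEmb_represents {Ω : Opens ℝ} (hne : (Ω : Set ℝ).Nonempty)
    (hup : IsUpperSet (Ω : Set ℝ)) {s : ℝ} {N : ℕ} (hN : s ≤ N) {w : ℝ → ℂ}
    (hw : ContDiffOn ℝ ∞ w Ω) (hL : ∀ i, MemLp (iteratedDeriv i w) 2 (volume.restrict Ω)) :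
    ∃ f : L2R, Represents (restrictTempered Ω (sobolevEmb s f)) w ∧
      ‖f‖ₑ ≤ 2 ^ N * ∑ i ∈ Finset.range (N + 1),
        eLpNorm (iteratedDeriv i w) 2 (volume.restrict Ω) := by
  obtain ⟨F, hF, hFw⟩ := exists_L2_integral_iterate_oneAddDeriv Ω.isOpen N hw hL
  obtain ⟨f, hf, hfF⟩ := exists_fourier_ae_eq_mul (C := 1) (continuous_bracketPow_mul_inv_pow s N)
    (norm_bracketPow_mul_inv_pow_le_one hN) F
  refine ⟨f, fun φ => ?_, hfF.trans (by simpa using hF)⟩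
  obtain ⟨ψ, hψφ, hψΩ⟩ := exists_iterate_oneAddDeriv_eq_testToSchwartz hne hup N φ
  have hwF : ∫ x in (Ω : Set ℝ), w x * φ x = ∫ x, ψ x * F x := by
    rw [← hFw ψ hψΩ, hψφ]; rfl
  rw [hwF, integral_schwartz_mul_eq_integral_fourier, restrictTempered_apply, sobolevEmb_apply]
  refine integral_congr_ae ?_
  filter_upwards [hf] with ξ hξ
  rw [hξ, ← hψφ, fourierInv_iterate_oneAddDeriv_apply]
  have hbracket : (bracketPow (-s) ξ : ℂ) * bracketPow s ξ = 1 :=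
    mod_cast bracketPow_neg_mul_bracketPow s ξ
  have hpow := mul_inv_cancel₀ (pow_ne_zero N (one_sub_two_pi_I_mul_ne_zero ξ))
  linear_combination (𝓕⁻ ψ) ξ * (𝓕 F : L2R) ξ * hbracket +
    (bracketPow (-s) ξ : ℂ) * bracketPow s ξ * (𝓕⁻ ψ) ξ * (𝓕 F : L2R) ξ * hpow

/-- The symbol `(2πiξ)^b ⟨ξ⟩^{-s}` of the operator that takes an element `f` of `L²`, standing for
`⟨D⟩^{-s} f` in `H^s(ℝ)`, to the derivative of order `b` of `⟨D⟩^{-s} f`. -/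
def derivSymbol (s : ℝ) (b : ℕ) (ξ : ℝ) : ℂ :=
  (2 * Real.pi * Complex.I * ξ) ^ b * bracketPow (-s) ξ

theorem derivSymbol_succ (s : ℝ) (b : ℕ) :
    derivSymbol s (b + 1) = fun ξ : ℝ => (2 * Real.pi * Complex.I * ξ) * derivSymbol s b ξ := by
  ext ξ; simp only [derivSymbol]; ring

theorem continuous_derivSymbol (s : ℝ) (b : ℕ) : Continuous (derivSymbol s b) :=
  Continuous.mul (by fun_prop) (Complex.continuous_ofReal.comp (continuous_bracketPow _))

theorem norm_derivSymbol_le (s : ℝ) (b : ℕ) (ξ : ℝ) :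
    ‖derivSymbol s b ξ‖ ≤ (2 * Real.pi) ^ b * bracketPow (b - s) ξ := by
  have hnorm : ‖derivSymbol s b ξ‖ = (2 * Real.pi) ^ b * (|ξ| ^ b * bracketPow (-s) ξ) := by
    simp [derivSymbol, mul_pow, abs_of_pos Real.pi_pos, abs_of_pos (bracketPow_pos _ _), mul_assoc]
  rw [hnorm, sub_eq_add_neg, ← bracketPow_mul_bracketPow]
  have := bracketPow_pos (-s) ξ
  gcongr
  exact abs_pow_le_bracketPow b ξ

theorem exists_eLpNorm_iteratedDeriv_le_of_represents (Ω : Opens ℝ) {i : ℕ} {s : ℝ} (hi : i ≤ s) :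
    ∃ C : ℝ≥0, ∀ (f : L2R) (w : ℝ → ℂ), ContDiffOn ℝ ∞ w Ω →
      Represents (restrictTempered Ω (sobolevEmb s f)) w →
      eLpNorm (iteratedDeriv i w) 2 (volume.restrict Ω) ≤ C * ‖f‖ₑ := by
  let C : ℝ≥0 := ⟨(2 * Real.pi) ^ i, by positivity⟩
  have hbound : ∀ ξ, ‖derivSymbol s i ξ‖ ≤ C := fun ξ =>
    (norm_derivSymbol_le s i ξ).trans <| mul_le_of_le_one_right (by positivity) <|
      (bracketPow_le_bracketPow (sub_nonpos.2 hi) ξ).trans_eq (bracketPow_zero ξ)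
  refine ⟨C, fun f w hw hr => ?_⟩
  obtain ⟨g, hg, hgf⟩ := exists_fourier_ae_eq_mul (continuous_derivSymbol s i) hbound f
  have hae : iteratedDeriv i w =ᵐ[volume.restrict Ω] g := by
    refine ae_eq_of_setIntegral_mul_test_eq
      ((contDiffOn_iteratedDeriv_of_isOpen Ω.isOpen hw i).continuousOn.locallyIntegrableOn
        Ω.isOpen.measurableSet)
      (((Lp.memLp g).locallyIntegrable (by norm_num)).locallyIntegrableOn _) fun φ => ?_
    have hgφ : ∫ t in (Ω : Set ℝ), g t * φ t = ∫ t, testToSchwartz Ω φ t * g t := by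
      simp_rw [setIntegral_mul_test_eq_integral, testToSchwartz_apply, mul_comm]
    rw [setIntegral_iteratedDeriv_mul_test hw, ← hr, restrictTempered_apply, sobolevEmb_apply, hgφ,
      integral_schwartz_mul_eq_integral_fourier, ← integral_const_mul]
    refine integral_congr_ae ?_
    filter_upwards [hg] with ξ hξ
    have hsign : (-1 : ℂ) ^ i * (-(2 * Real.pi * Complex.I * ξ)) ^ i =
        (2 * Real.pi * Complex.I * ξ) ^ i := by
      rw [← mul_pow, neg_one_mul, neg_neg]
    rw [hξ, fourierInv_iterate_testDeriv, derivSymbol]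
    linear_combination (bracketPow (-s) ξ : ℂ) * (𝓕⁻ (testToSchwartz Ω φ)) ξ *
      (𝓕 f : L2R) ξ * hsign
  calc eLpNorm (iteratedDeriv i w) 2 (volume.restrict Ω)
    _ = eLpNorm g 2 (volume.restrict Ω) := eLpNorm_congr_ae hae
    _ ≤ ‖g‖ₑ := (eLpNorm_mono_measure _ Measure.restrict_le_self).trans_eq (Lp.enorm_def g).symm
    _ ≤ C * ‖f‖ₑ := hgf

/-! ### Point evaluation on Sobolev spaces -/

section WeakDerivative

variable {E : Type*} [NormedAddCommGroup E] [NormedSpace ℂ E]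

theorem norm_sub_le_of_hasDerivAt_apply {G₀ G₁ : ℝ → E →L[ℂ] ℂ}
    (h : ∀ t e, HasDerivAt (fun τ => G₀ τ e) (G₁ t e) t) {C : ℝ} (hC : ∀ t, ‖G₁ t‖ ≤ C) (a b : ℝ) :
    ‖G₀ b - G₀ a‖ ≤ C * |b - a| := by
  have hC_nonneg : 0 ≤ C := (norm_nonneg _).trans (hC 0)
  refine ContinuousLinearMap.opNorm_le_bound _ (by positivity) fun e => ?_
  calc ‖G₀ b e - G₀ a e‖ ≤ C * ‖e‖ * ‖b - a‖ :=
        convex_univ.norm_image_sub_le_of_norm_hasDerivWithin_le (𝕜 := ℝ) (f := fun τ => G₀ τ e)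
          (fun x _ => (h x e).hasDerivWithinAt) (fun x _ => (G₁ x).le_of_opNorm_le (hC x) e)
          (mem_univ a) (mem_univ b)
    _ = C * |b - a| * ‖e‖ := by rw [Real.norm_eq_abs]; ring

theorem norm_sub_sub_smul_le_of_hasDerivAt_apply {G₀ G₁ G₂ : ℝ → E →L[ℂ] ℂ}
    (h₀ : ∀ t e, HasDerivAt (fun τ => G₀ τ e) (G₁ t e) t)
    (h₁ : ∀ t e, HasDerivAt (fun τ => G₁ τ e) (G₂ t e) t) {C : ℝ} (hC : ∀ t, ‖G₂ t‖ ≤ C)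
    (t τ : ℝ) : ‖G₀ τ - G₀ t - (τ - t) • G₁ t‖ ≤ C * |τ - t| ^ 2 := by
  have hC_nonneg : 0 ≤ C := (norm_nonneg _).trans (hC 0)
  refine ContinuousLinearMap.opNorm_le_bound _ (by positivity) fun e => ?_
  set r : ℝ → ℂ := fun x => G₀ x e - (x - t) • G₁ t e with hr
  have hr_deriv : ∀ x, HasDerivAt r (G₁ x e - G₁ t e) x := fun x =>
    ((h₀ x e).sub (((hasDerivAt_id x).sub_const t).smul_const (G₁ t e))).congr_deriv
      (by rw [one_smul])
  have hr_bound : ∀ x ∈ uIcc t τ, ‖G₁ x e - G₁ t e‖ ≤ C * |τ - t| * ‖e‖ := fun x hx =>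
    calc ‖(G₁ x - G₁ t) e‖ ≤ C * |x - t| * ‖e‖ :=
          (G₁ x - G₁ t).le_of_opNorm_le (norm_sub_le_of_hasDerivAt_apply h₁ hC t x) e
      _ ≤ C * |τ - t| * ‖e‖ := by
        have := abs_sub_left_of_mem_uIcc hx
        gcongr ?_ * _
        gcongr
  calc ‖(G₀ τ - G₀ t - (τ - t) • G₁ t) e‖ = ‖r τ - r t‖ := by
        simp only [hr, sub_apply, smul_apply, sub_self, zero_smul, sub_zero]
        rw [sub_right_comm]
    _ ≤ C * |τ - t| * ‖e‖ * ‖τ - t‖ :=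
      (convex_uIcc t τ).norm_image_sub_le_of_norm_hasDerivWithin_le (𝕜 := ℝ)
        (fun x _ => (hr_deriv x).hasDerivWithinAt) hr_bound left_mem_uIcc right_mem_uIcc
    _ = C * |τ - t| ^ 2 * ‖e‖ := by rw [Real.norm_eq_abs]; ring

theorem hasDerivAt_of_hasDerivAt_apply {G₀ G₁ G₂ : ℝ → E →L[ℂ] ℂ}
    (h₀ : ∀ t e, HasDerivAt (fun τ => G₀ τ e) (G₁ t e) t)
    (h₁ : ∀ t e, HasDerivAt (fun τ => G₁ τ e) (G₂ t e) t) {C : ℝ} (hC : ∀ t, ‖G₂ t‖ ≤ C) (t : ℝ) :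
    HasDerivAt G₀ (G₁ t) t := by
  rw [hasDerivAt_iff_isLittleO]
  refine (Asymptotics.IsBigO.of_bound C (Eventually.of_forall fun τ => ?_)).trans_isLittleO
    (Asymptotics.isLittleO_pow_sub_sub t one_lt_two)
  rw [norm_pow, norm_norm, Real.norm_eq_abs]
  exact norm_sub_sub_smul_le_of_hasDerivAt_apply h₀ h₁ hC t τ

end WeakDerivative

section FourierEval

variable {m : ℝ → ℂ}

theorem integrable_mul_fourier (hm : MemLp m 2) (f : L2R) :
    Integrable (fun ξ => m ξ * (𝓕 f : L2R) ξ) :=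
  hm.integrable_mul (Lp.memLp (𝓕 f : L2R))

theorem eLpNorm_mul_fourier_le (hm : MemLp m 2) (f : L2R) :
    eLpNorm (fun ξ => m ξ * (𝓕 f : L2R) ξ) 1 volume ≤ eLpNorm m 2 volume * ‖f‖ₑ := by
  have plancherel : ‖f‖ₑ = ‖(𝓕 f : L2R)‖ₑ := by
    rw [← ofReal_norm, ← ofReal_norm, Lp.norm_fourier_eq]
  rw [plancherel, Lp.enorm_def]
  exact eLpNorm_smul_le_mul_eLpNorm (φ := m) (Lp.aestronglyMeasurable (𝓕 f : L2R)) hm.1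

theorem integrable_fourierChar_smul {h : ℝ → ℂ} (hh : Integrable h) (t : ℝ) :
    Integrable fun v : ℝ => Real.fourierChar (inner ℝ v t) • h v := by
  simpa only [inner_neg_right, neg_neg] using
    (Real.fourierIntegral_convergent_iff (μ := volume) (f := h) (-t)).2 hh

theorem norm_fourierInv_mul_fourier_le (hm : MemLp m 2) (f : L2R) (t : ℝ) :
    ‖𝓕⁻ (fun ξ => m ξ * (𝓕 f : L2R) ξ) t‖ ≤ (eLpNorm m 2 volume).toReal * ‖f‖ := by
  rw [Real.fourierInv_eq]
  refine (norm_integral_le_integral_norm _).trans ?_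
  simp only [Circle.norm_smul]
  rw [integral_norm_eq_lintegral_enorm (integrable_mul_fourier hm f).1,
    ← eLpNorm_one_eq_lintegral_enorm, ← toReal_enorm f, ← ENNReal.toReal_mul]
  exact ENNReal.toReal_mono (ENNReal.mul_ne_top hm.2.ne enorm_ne_top) (eLpNorm_mul_fourier_le hm f)

open Classical in
/-- The functional `f ↦ 𝓕⁻¹(m · 𝓕 f)(t)` on `L²`, for `m ∈ L²`; it is `0` if `m ∉ L²`. -/
def fourierEval (m : ℝ → ℂ) (t : ℝ) : L2R →L[ℂ] ℂ :=
  if hm : MemLp m 2 then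
    LinearMap.mkContinuous
      { toFun := fun f => 𝓕⁻ (fun ξ => m ξ * (𝓕 f : L2R) ξ) t
        map_add' := fun f g => by
          simp only [Real.fourierInv_eq]
          rw [← integral_add (integrable_fourierChar_smul (integrable_mul_fourier hm f) t)
            (integrable_fourierChar_smul (integrable_mul_fourier hm g) t)]
          refine integral_congr_ae ?_
          rw [FourierTransform.fourier_add]
          filter_upwards [Lp.coeFn_add (𝓕 f : L2R) (𝓕 g)] with ξ hξ
          rw [hξ, Pi.add_apply, mul_add, smul_add]
        map_smul' := fun c f => by
          simp only [Real.fourierInv_eq, RingHom.id_apply]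
          rw [← integral_smul, FourierTransform.fourier_smul]
          refine integral_congr_ae ?_
          filter_upwards [Lp.coeFn_smul c (𝓕 f : L2R)] with ξ hξ
          rw [hξ, Pi.smul_apply, smul_comm c, smul_eq_mul, smul_eq_mul, mul_left_comm] }
      (eLpNorm m 2 volume).toReal (fun f => norm_fourierInv_mul_fourier_le hm f t)
  else 0

theorem fourierEval_apply (hm : MemLp m 2) (t : ℝ) (f : L2R) :
    fourierEval m t f = 𝓕⁻ (fun ξ => m ξ * (𝓕 f : L2R) ξ) t := by
  rw [fourierEval, dif_pos hm]; rfl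

theorem norm_fourierEval_le (hm : MemLp m 2) (t : ℝ) :
    ‖fourierEval m t‖ ≤ (eLpNorm m 2 volume).toReal := by
  rw [fourierEval, dif_pos hm]
  exact LinearMap.mkContinuous_norm_le _ ENNReal.toReal_nonneg _

theorem hasDerivAt_fourierEval_apply (hm : MemLp m 2)
    (hm' : MemLp (fun ξ => (2 * Real.pi * Complex.I * ξ) * m ξ) 2) (f : L2R) (t : ℝ) :
    HasDerivAt (fun τ => fourierEval m τ f)
      (fourierEval (fun ξ => (2 * Real.pi * Complex.I * ξ) * m ξ) t f) t := by
  simp_rw [fourierEval_apply hm, fourierEval_apply hm', Real.fourierInv_eq_fourier_neg]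
  have hint : Integrable (fun ξ : ℝ => ξ • (m ξ * (𝓕 f : L2R) ξ)) := by
    have : (2 * Real.pi * Complex.I : ℂ) ≠ 0 := by simp [Real.pi_ne_zero]
    refine ((integrable_mul_fourier hm' f).const_mul (2 * Real.pi * Complex.I)⁻¹).congr
      (ae_of_all _ fun ξ => ?_)
    simp only [Complex.real_smul]
    field_simp
  refine ((Real.hasDerivAt_fourier (integrable_mul_fourier hm f) hint (-t)).scomp t
    (hasDerivAt_neg t)).congr_deriv ?_
  rw [neg_one_smul, Real.fourier_eq, Real.fourier_eq, ← integral_neg]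
  congr 1 with ξ
  rw [← smul_neg]
  congr 1
  simp only [smul_eq_mul]
  ring

theorem integral_fourierInv_mul_schwartz {h : ℝ → ℂ} (hh : Integrable h) (ψ : 𝓢(ℝ, ℂ)) :
    ∫ t, 𝓕⁻ h t * ψ t = ∫ ξ, h ξ * (𝓕⁻ ψ : 𝓢(ℝ, ℂ)) ξ := by
  have hψ : 𝓕 (fun t => ψ (-t)) = (𝓕⁻ ψ : 𝓢(ℝ, ℂ)) := by
    rw [SchwartzMap.fourierInv_coe, Real.fourierInv_eq_fourier_comp_neg]
  calc ∫ t, 𝓕⁻ h t * ψ t = ∫ t, 𝓕 h t * ψ (-t) := by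
        rw [← integral_neg_eq_self]
        simp_rw [Real.fourierInv_eq_fourier_neg, neg_neg]
    _ = ∫ ξ, h ξ * 𝓕 (fun t => ψ (-t)) ξ := by
      have hflip := VectorFourier.integral_fourierIntegral_smul_eq_flip (L := innerₗ ℝ)
        Real.continuous_fourierChar continuous_inner hh (ψ.integrable.comp_neg (μ := volume))
      rwa [flip_innerₗ] at hflip
    _ = ∫ ξ, h ξ * (𝓕⁻ ψ : 𝓢(ℝ, ℂ)) ξ := by rw [hψ]

end FourierEval

theorem memLp_bracketPow_neg_one : MemLp (bracketPow (-1)) 2 := by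
  rw [memLp_two_iff_integrable_sq (continuous_bracketPow _).aestronglyMeasurable]
  refine integrable_inv_one_add_sq.congr (ae_of_all _ fun ξ => ?_)
  simp only
  rw [sq (bracketPow _ _), bracketPow_mul_bracketPow, bracketPow, ← Real.rpow_neg_one]
  norm_num

theorem memLp_derivSymbol {s : ℝ} {b : ℕ} (h : b + 1 ≤ s) : MemLp (derivSymbol s b) 2 := by
  refine memLp_bracketPow_neg_one.of_le_mul (c := (2 * Real.pi) ^ b)
    (continuous_derivSymbol s b).aestronglyMeasurable (ae_of_all _ fun ξ => ?_)
  rw [Real.norm_of_nonneg (bracketPow_pos _ _).le]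
  refine (norm_derivSymbol_le s b ξ).trans ?_
  gcongr
  exact bracketPow_le_bracketPow (by linarith) ξ

theorem hasDerivAt_fourierEval_derivSymbol {s : ℝ} {b : ℕ} (h : b + 3 ≤ s) (t : ℝ) :
    HasDerivAt (fourierEval (derivSymbol s b)) (fourierEval (derivSymbol s (b + 1)) t) t := by
  have hderiv : ∀ c : ℕ, c + 2 ≤ s → ∀ (t : ℝ) (e : L2R),
      HasDerivAt (fun τ => fourierEval (derivSymbol s c) τ e)
        (fourierEval (derivSymbol s (c + 1)) t e) t := fun c hc t e => by
    have hc' : MemLp (derivSymbol s (c + 1)) 2 := memLp_derivSymbol (by push_cast; linarith)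
    rw [derivSymbol_succ] at hc' ⊢
    exact hasDerivAt_fourierEval_apply (memLp_derivSymbol (by linarith)) hc' e t
  exact hasDerivAt_of_hasDerivAt_apply (hderiv b (by linarith))
    (hderiv (b + 1) (by push_cast; linarith))
    (norm_fourierEval_le (memLp_derivSymbol (by push_cast; linarith))) t

theorem contDiff_fourierEval_derivSymbol (n : ℕ) {s : ℝ} {b : ℕ} (h : b + n + 3 ≤ s) :
    ContDiff ℝ n (fourierEval (derivSymbol s b)) := by
  have hderiv : ∀ t, HasDerivAt (fourierEval (derivSymbol s b))
      (fourierEval (derivSymbol s (b + 1)) t) t :=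
    hasDerivAt_fourierEval_derivSymbol (by linarith [(n.cast_nonneg : (0 : ℝ) ≤ n)])
  have hdiff : Differentiable ℝ (fourierEval (derivSymbol s b)) := fun t =>
    (hderiv t).differentiableAt
  induction n generalizing b with
  | zero => exact contDiff_zero.2 hdiff.continuous
  | succ n ih =>
    push_cast at h ⊢
    rw [contDiff_succ_iff_deriv, funext fun t => (hderiv t).deriv]
    have hderiv' : ∀ t, HasDerivAt (fourierEval (derivSymbol s (b + 1)))
        (fourierEval (derivSymbol s (b + 1 + 1)) t) t :=
      hasDerivAt_fourierEval_derivSymbol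
        (by push_cast; linarith [(n.cast_nonneg : (0 : ℝ) ≤ n)])
    exact ⟨hdiff, by simp, ih (by push_cast; linarith) hderiv' fun t =>
      (hderiv' t).differentiableAt⟩

theorem represents_fourierEval (Ω : Opens ℝ) {s : ℝ} (hs : 1 ≤ s) (f : L2R) :
    Represents (restrictTempered Ω (sobolevEmb s f))
      fun t => fourierEval (derivSymbol s 0) t f := by
  intro φ
  have hm : MemLp (derivSymbol s 0) 2 := memLp_derivSymbol (by simpa using hs)
  have hφ : ∀ t, (φ t : ℂ) = testToSchwartz Ω φ t := fun t => (testToSchwartz_apply Ω φ t).symm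
  rw [setIntegral_mul_test_eq_integral, restrictTempered_apply, sobolevEmb_apply]
  simp_rw [fourierEval_apply hm, hφ]
  rw [integral_fourierInv_mul_schwartz (integrable_mul_fourier hm f)]
  congr 1 with ξ
  rw [derivSymbol, pow_zero, one_mul]
  ring

/-! ### A linear section of the quotient map onto `H^s(ℝ₊)` -/

/-- The lift of an element of `H^s(ℝ₊)` to the orthogonal complement of `vanishing s`. It turns a
smooth family of elements of `H^s(ℝ₊)` into a smooth family of elements of `H^s(ℝ)`. -/
def halfSection (s : ℝ) : HalfSobolev s →L[ℂ] L2R :=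
  LinearMap.mkContinuous
    ((vanishing s).liftQ ((vanishing s)ᗮ.starProjection : L2R →L[ℂ] L2R).toLinearMap
      fun f hf => by
        rw [LinearMap.mem_ker]
        exact (Submodule.starProjection_apply_eq_zero_iff _).2
          ((vanishing s).le_orthogonal_orthogonal hf)) 1
    (fun e => by
      rw [one_mul]
      refine le_of_forall_pos_le_add fun ε hε => ?_
      obtain ⟨f, rfl, hf⟩ := Submodule.Quotient.norm_mk_lt e hε
      exact ((vanishing s)ᗮ.norm_starProjection_apply_le f).trans hf.le)

theorem halfSobolevEmb_eq_restrictTempered (s : ℝ) (e : HalfSobolev s) :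
    halfSobolevEmb s e = restrictTempered halfLine (sobolevEmb s (halfSection s e)) := by
  have : CompleteSpace (vanishing s) := (isClosed_vanishing s).completeSpace_coe
  obtain ⟨f, rfl⟩ := Submodule.Quotient.mk_surjective _ e
  have hmem : f - (vanishing s)ᗮ.starProjection f ∈ vanishing s := by
    rw [Submodule.starProjection_orthogonal_val, sub_sub_cancel]
    exact Submodule.starProjection_apply_mem _ _
  have hrestrict :
      restrictTempered halfLine (sobolevEmb s (f - (vanishing s)ᗮ.starProjection f)) = 0 := hmem
  rw [map_sub, map_sub, sub_eq_zero] at hrestrict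
  exact hrestrict

/-! ### Iterated directional derivatives -/

section DirectionalDerivatives

variable {V F G : Type*} [NormedAddCommGroup V] [NormedSpace ℝ V]
  [NormedAddCommGroup F] [NormedSpace ℝ F] [NormedAddCommGroup G] [NormedSpace ℝ G]

/-- The iterated derivative in the directions of a list, the last of which is applied first. -/
def dirDerivs (S : Set V) (L : List V) (f : V → F) : V → F := L.foldr (dirDeriv S) f

theorem dirDerivs_cons (S : Set V) (v : V) (L : List V) (f : V → F) :
    dirDerivs S (v :: L) f = dirDeriv S v (dirDerivs S L f) := rfl

theorem dirDerivs_append (S : Set V) (L M : List V) (f : V → F) :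
    dirDerivs S (L ++ M) f = dirDerivs S L (dirDerivs S M f) := List.foldr_append ..

theorem dirDerivs_replicate (S : Set V) (n : ℕ) (v : V) (f : V → F) :
    dirDerivs S (List.replicate n v) f = (dirDeriv S v)^[n] f := by
  induction n with
  | zero => rfl
  | succ n ih => rw [List.replicate_succ, dirDerivs_cons, ih, Function.iterate_succ_apply']

theorem dirDerivs_flatMap_replicate (S : Set V) {m : ℕ} (e : Fin m → V) (α : Fin m → ℕ)
    (I : List (Fin m)) (f : V → F) :
    dirDerivs S (I.flatMap fun i => List.replicate (α i) (e i)) f =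
      I.foldr (fun i g => (dirDeriv S (e i))^[α i] g) f := by
  induction I with
  | nil => rfl
  | cons i I ih => rw [List.flatMap_cons, dirDerivs_append, ih, dirDerivs_replicate]; rfl

/-- The list of directions of the derivative `∂_{x'}^β ∂_{ξ'}^α ∂_μ^j`. -/
def paramDirs {m : ℕ} (β α : Fin m → ℕ) (j : ℕ) : List (PhaseSpace m) :=
  ((List.finRange m).flatMap fun i =>
      List.replicate (β i) ((EuclideanSpace.single i 1, 0, 0) : PhaseSpace m)) ++
    (((List.finRange m).flatMap fun i =>
      List.replicate (α i) ((0, EuclideanSpace.single i 1, 0) : PhaseSpace m)) ++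
    List.replicate j ((0, 0, 1) : PhaseSpace m))

theorem paramDeriv_eq_dirDerivs {m : ℕ} (incl : PhaseSpace m →ₗ[ℝ] V) (S : Set V)
    (β α : Fin m → ℕ) (j : ℕ) (f : V → F) :
    paramDeriv incl S β α j f = dirDerivs S ((paramDirs β α j).map incl) f := by
  simp only [paramDirs, List.map_append, List.map_flatMap, List.map_replicate]
  rw [dirDerivs_append, dirDerivs_append, dirDerivs_replicate, dirDerivs_flatMap_replicate,
    dirDerivs_flatMap_replicate]
  rfl

variable {S : Set V}

theorem dirDeriv_congr {f g : V → F} (h : EqOn f g S) (v : V) :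
    EqOn (dirDeriv S v f) (dirDeriv S v g) S := fun p hp => by
  simp only [dirDeriv]
  rw [fderivWithin_congr h (h hp)]

theorem dirDerivs_congr {f g : V → F} (h : EqOn f g S) (L : List V) :
    EqOn (dirDerivs S L f) (dirDerivs S L g) S := by
  induction L with
  | nil => exact h
  | cons v L ih => exact dirDeriv_congr ih v

theorem contDiffOn_dirDeriv (hS : UniqueDiffOn ℝ S) {f : V → F}
    (hf : ContDiffOn ℝ ∞ f S) (v : V) : ContDiffOn ℝ ∞ (dirDeriv S v f) S :=
  (hf.fderivWithin hS (m := ∞) (by simp)).clm_apply contDiffOn_const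

theorem contDiffOn_dirDerivs (hS : UniqueDiffOn ℝ S) {f : V → F}
    (hf : ContDiffOn ℝ ∞ f S) (L : List V) : ContDiffOn ℝ ∞ (dirDerivs S L f) S := by
  induction L with
  | nil => exact hf
  | cons v L ih => exact contDiffOn_dirDeriv hS ih v

theorem dirDeriv_clm_comp (hS : UniqueDiffOn ℝ S) {f : V → F}
    (hf : DifferentiableOn ℝ f S) (ℓ : F →L[ℝ] G) (v : V) :
    EqOn (dirDeriv S v fun p => ℓ (f p)) (fun p => ℓ (dirDeriv S v f p)) S := fun p hp => by
  have hcomp : HasFDerivWithinAt (fun p => ℓ (f p)) (ℓ.comp (fderivWithin ℝ f S p)) S p :=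
    ℓ.hasFDerivAt.comp_hasFDerivWithinAt p (hf p hp).hasFDerivWithinAt
  simp only [dirDeriv, hcomp.fderivWithin (hS p hp), ContinuousLinearMap.comp_apply]

theorem dirDerivs_clm_comp (hS : UniqueDiffOn ℝ S) {f : V → F}
    (hf : ContDiffOn ℝ ∞ f S) (ℓ : F →L[ℝ] G) (L : List V) :
    EqOn (dirDerivs S L fun p => ℓ (f p)) (fun p => ℓ (dirDerivs S L f p)) S := by
  induction L with
  | nil => exact fun p _ => rfl
  | cons v L ih =>
    exact (dirDeriv_congr ih v).trans (dirDeriv_clm_comp hS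
      ((contDiffOn_dirDerivs hS hf L).differentiableOn (by simp)) ℓ v)

theorem dirDeriv_dirDeriv_eq_fderivWithin (hS : UniqueDiffOn ℝ S) {f : V → F}
    (hf : ContDiffOn ℝ ∞ f S) (v w : V) :
    EqOn (dirDeriv S v (dirDeriv S w f))
      (fun p => fderivWithin ℝ (fderivWithin ℝ f S) S p v w) S := fun p hp => by
  have hdiff : DifferentiableOn ℝ (fderivWithin ℝ f S) S :=
    (hf.fderivWithin hS (m := ∞) (by simp)).differentiableOn (by simp)
  exact dirDeriv_clm_comp hS hdiff (ContinuousLinearMap.apply ℝ F w) v hp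

theorem dirDeriv_comm (hS : UniqueDiffOn ℝ S) (hS' : S ⊆ closure (interior S)) {f : V → F}
    (hf : ContDiffOn ℝ ∞ f S) (v w : V) :
    EqOn (dirDeriv S v (dirDeriv S w f)) (dirDeriv S w (dirDeriv S v f)) S := fun p hp => by
  have hsymm : IsSymmSndFDerivWithinAt ℝ f S p :=
    (hf p hp).isSymmSndFDerivWithinAt
      (by rw [minSmoothness_of_isRCLikeNormedField]; exact WithTop.coe_le_coe.2 le_top)
      hS (hS' hp) hp
  rw [dirDeriv_dirDeriv_eq_fderivWithin hS hf v w hp,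
    dirDeriv_dirDeriv_eq_fderivWithin hS hf w v hp]
  exact hsymm v w

theorem dirDerivs_dirDeriv_comm (hS : UniqueDiffOn ℝ S)
    (hS' : S ⊆ closure (interior S)) {f : V → F} (hf : ContDiffOn ℝ ∞ f S) (L : List V) (w : V) :
    EqOn (dirDerivs S L (dirDeriv S w f)) (dirDeriv S w (dirDerivs S L f)) S := by
  induction L with
  | nil => exact fun p _ => rfl
  | cons v L ih =>
    exact (dirDeriv_congr ih v).trans (dirDeriv_comm hS hS' (contDiffOn_dirDerivs hS hf L) v w)

theorem contDiffOn_iterate_dirDeriv (hS : UniqueDiffOn ℝ S) {f : V → F}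
    (hf : ContDiffOn ℝ ∞ f S) (w : V) (n : ℕ) : ContDiffOn ℝ ∞ ((dirDeriv S w)^[n] f) S := by
  rw [← dirDerivs_replicate]
  exact contDiffOn_dirDerivs hS hf _

theorem dirDerivs_iterate_dirDeriv_comm (hS : UniqueDiffOn ℝ S)
    (hS' : S ⊆ closure (interior S)) {f : V → F} (hf : ContDiffOn ℝ ∞ f S) (L : List V) (w : V)
    (n : ℕ) :
    EqOn (dirDerivs S L ((dirDeriv S w)^[n] f)) ((dirDeriv S w)^[n] (dirDerivs S L f)) S := by
  induction n with
  | zero => exact fun p _ => rfl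
  | succ n ih =>
    simp only [Function.iterate_succ_apply']
    exact (dirDerivs_dirDeriv_comm hS hS' (contDiffOn_iterate_dirDeriv hS hf w n) L w).trans
      (dirDeriv_congr ih w)

section Slices

variable {T : Set ℝ} {k : V × ℝ → F}

theorem dirDeriv_inl_slice (hS : UniqueDiffOn ℝ S) (hk : DifferentiableOn ℝ k (S ×ˢ T)) (v : V)
    {t : ℝ} (ht : t ∈ T) :
    EqOn (fun p => dirDeriv (S ×ˢ T) (v, 0) k (p, t)) (dirDeriv S v fun p => k (p, t)) S := by
  intro p hp
  have hincl : HasFDerivWithinAt (fun q : V => (q, t)) (ContinuousLinearMap.inl ℝ V ℝ) S p :=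
    (hasFDerivAt_prodMk_left p t).hasFDerivWithinAt
  have hmaps : MapsTo (fun q : V => (q, t)) S (S ×ˢ T) := fun q hq => ⟨hq, ht⟩
  have hslice : fderivWithin ℝ (fun p => k (p, t)) S p = _ :=
    ((hk (p, t) ⟨hp, ht⟩).hasFDerivWithinAt.comp p hincl hmaps).fderivWithin (hS p hp)
  simp only [dirDeriv, hslice]
  rfl

theorem dirDerivs_inl_slice (hS : UniqueDiffOn ℝ S) (hT : IsOpen T)
    (hk : ContDiffOn ℝ ∞ k (S ×ˢ T)) (L : List V) {t : ℝ} (ht : t ∈ T) :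
    EqOn (fun p => dirDerivs (S ×ˢ T) (L.map (LinearMap.inl ℝ V ℝ)) k (p, t))
      (dirDerivs S L fun p => k (p, t)) S := by
  induction L with
  | nil => exact fun p _ => rfl
  | cons v L ih =>
    have hderivs := contDiffOn_dirDerivs (hS.prod hT.uniqueDiffOn) hk
      (L.map (LinearMap.inl ℝ V ℝ))
    exact (dirDeriv_inl_slice hS (hderivs.differentiableOn (by simp)) v ht).trans
      (dirDeriv_congr ih v)

theorem dirDeriv_inr_slice (hT : IsOpen T) (hk : DifferentiableOn ℝ k (S ×ˢ T)) {p : V}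
    (hp : p ∈ S) :
    EqOn (fun t => dirDeriv (S ×ˢ T) (0, 1) k (p, t)) (deriv fun t => k (p, t)) T := by
  intro t ht
  have hincl : HasFDerivWithinAt (fun τ : ℝ => (p, τ)) (ContinuousLinearMap.inr ℝ V ℝ) T t :=
    (hasFDerivAt_prodMk_right p t).hasFDerivWithinAt
  have hslice : HasDerivAt (fun t => k (p, t)) _ t :=
    (((hk (p, t) ⟨hp, ht⟩).hasFDerivWithinAt.comp t hincl
      fun τ hτ => ⟨hp, hτ⟩).hasFDerivAt (hT.mem_nhds ht)).hasDerivAt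
  rw [hslice.deriv]
  rfl

theorem iterate_dirDeriv_inr_slice (hS : UniqueDiffOn ℝ S) (hT : IsOpen T)
    (hk : ContDiffOn ℝ ∞ k (S ×ˢ T)) {p : V} (hp : p ∈ S) (n : ℕ) :
    EqOn (fun t => (dirDeriv (S ×ˢ T) (0, 1))^[n] k (p, t))
      (iteratedDeriv n fun t => k (p, t)) T := by
  induction n with
  | zero => exact fun t _ => by simp
  | succ n ih =>
    intro t ht
    have hiterate := contDiffOn_iterate_dirDeriv (hS.prod hT.uniqueDiffOn) hk (0, 1) n
    simp only [Function.iterate_succ_apply', iteratedDeriv_succ]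
    refine (dirDeriv_inr_slice hT (hiterate.differentiableOn (by simp)) hp ht).trans ?_
    exact (ih.eventuallyEq_of_mem (hT.mem_nhds ht)).deriv_eq

end Slices

end DirectionalDerivatives

theorem phaseDomain_eq (m : ℕ) : phaseDomain m = univ ×ˢ univ ×ˢ Ici 0 := by
  ext p; simp [phaseDomain]

theorem uniqueDiffOn_phaseDomain (m : ℕ) : UniqueDiffOn ℝ (phaseDomain m) := by
  rw [phaseDomain_eq]
  exact uniqueDiffOn_univ.prod (uniqueDiffOn_univ.prod (uniqueDiffOn_Ici 0))

theorem uniqueDiffOn_kernelDomain (m : ℕ) : UniqueDiffOn ℝ (kernelDomain m) :=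
  (uniqueDiffOn_phaseDomain m).prod isOpen_Ioi.uniqueDiffOn

theorem kernelDomain_subset_closure_interior (m : ℕ) :
    kernelDomain m ⊆ closure (interior (kernelDomain m)) := by
  rw [kernelDomain, phaseDomain_eq]
  simp only [interior_prod_eq, closure_prod_eq, interior_univ, closure_univ, interior_Ici,
    interior_Ioi, closure_Ioi]
  exact prod_mono subset_rfl Ioi_subset_Ici_self

/-! ### Kernels and their lifts to function spaces -/

section Kernels

variable {m : ℕ}

/-- `∂_{x'}^β ∂_{ξ'}^α ∂_μ^j k (p, t)`, as a function of `t`. -/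
def kernelDeriv (β α : Fin m → ℕ) (j : ℕ) (k : PhaseSpace m × ℝ → ℂ) (p : PhaseSpace m) (t : ℝ) :
    ℂ :=
  paramDeriv (LinearMap.inl ℝ (PhaseSpace m) ℝ) (kernelDomain m) β α j k (p, t)

theorem kernelDeriv_eq_dirDerivs (β α : Fin m → ℕ) (j : ℕ) (k : PhaseSpace m × ℝ → ℂ)
    (p : PhaseSpace m) (t : ℝ) :
    kernelDeriv β α j k p t = dirDerivs (kernelDomain m)
      ((paramDirs β α j).map (LinearMap.inl ℝ (PhaseSpace m) ℝ)) k (p, t) := by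
  rw [kernelDeriv, paramDeriv_eq_dirDerivs]

theorem paramDeriv_id_eq_dirDerivs {F : Type*} [NormedAddCommGroup F] [NormedSpace ℝ F]
    (β α : Fin m → ℕ) (j : ℕ) (f : PhaseSpace m → F) :
    paramDeriv LinearMap.id (phaseDomain m) β α j f =
      dirDerivs (phaseDomain m) (paramDirs β α j) f := by
  rw [paramDeriv_eq_dirDerivs, LinearMap.id_coe, List.map_id]

section KernelDerivatives

variable {k : PhaseSpace m × ℝ → ℂ} (hk : ContDiffOn ℝ ∞ k (kernelDomain m)) (β α : Fin m → ℕ)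
  (j : ℕ) {p : PhaseSpace m} (hp : p ∈ phaseDomain m)

include hk hp

theorem contDiffOn_kernelDeriv : ContDiffOn ℝ ∞ (kernelDeriv β α j k p) (Ioi 0) := by
  have hderivs := contDiffOn_dirDerivs (uniqueDiffOn_kernelDomain m) hk
    ((paramDirs β α j).map (LinearMap.inl ℝ (PhaseSpace m) ℝ))
  rw [funext (kernelDeriv_eq_dirDerivs β α j k p)]
  exact hderivs.comp (contDiffOn_const.prodMk contDiffOn_id) fun t ht => ⟨hp, ht⟩

variable {t : ℝ} (ht : 0 < t)

include ht

theorem kernelDeriv_eq_dirDerivs_slice :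
    kernelDeriv β α j k p t =
      dirDerivs (phaseDomain m) (paramDirs β α j) (fun q => k (q, t)) p := by
  rw [kernelDeriv_eq_dirDerivs]
  exact dirDerivs_inl_slice (uniqueDiffOn_phaseDomain m) isOpen_Ioi hk (paramDirs β α j) ht hp

theorem kernelDeriv_iterate_dirDeriv (n : ℕ) :
    kernelDeriv β α j ((dirDeriv (kernelDomain m) (0, 1))^[n] k) p t =
      iteratedDeriv n (kernelDeriv β α j k p) t := by
  have hU := uniqueDiffOn_kernelDomain m
  rw [kernelDeriv_eq_dirDerivs, funext (kernelDeriv_eq_dirDerivs β α j k p)]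
  exact (dirDerivs_iterate_dirDeriv_comm hU (kernelDomain_subset_closure_interior m) hk _
    (0, 1) n (show (p, t) ∈ kernelDomain m from ⟨hp, ht⟩)).trans
      (iterate_dirDeriv_inr_slice (uniqueDiffOn_phaseDomain m) isOpen_Ioi
        (contDiffOn_dirDerivs hU hk _) hp n ht)

theorem kernelDeriv_pow_mul (l : ℕ) :
    kernelDeriv β α j (fun q => (q.2 : ℂ) ^ l * k q) p t =
      (t : ℂ) ^ l * kernelDeriv β α j k p t := by
  have hmul : ContDiffOn ℝ ∞ (fun q : PhaseSpace m × ℝ => (q.2 : ℂ) ^ l * k q)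
      (kernelDomain m) :=
    ((Complex.ofRealCLM.contDiff.comp contDiff_snd).pow l).contDiffOn.mul hk
  have hslice : ContDiffOn ℝ ∞ (fun p => k (p, t)) (phaseDomain m) :=
    hk.comp (contDiffOn_id.prodMk contDiffOn_const) fun q hq => ⟨hq, ht⟩
  rw [kernelDeriv_eq_dirDerivs_slice hmul β α j hp ht,
    kernelDeriv_eq_dirDerivs_slice hk β α j hp ht]
  exact dirDerivs_clm_comp (uniqueDiffOn_phaseDomain m) hslice
    (ContinuousLinearMap.mul ℝ ℂ ((t : ℂ) ^ l)) (paramDirs β α j) hp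

theorem kernelDeriv_pow_mul_iterate_dirDeriv (l l' : ℕ) :
    kernelDeriv β α j (fun q => (q.2 : ℂ) ^ l * (dirDeriv (kernelDomain m) (0, 1))^[l'] k q) p t =
      (t : ℂ) ^ l * iteratedDeriv l' (kernelDeriv β α j k p) t := by
  have hiterate := contDiffOn_iterate_dirDeriv (uniqueDiffOn_kernelDomain m) hk (0, 1) l'
  rw [kernelDeriv_pow_mul hiterate β α j hp ht, kernelDeriv_iterate_dirDeriv hk β α j hp ht]

theorem kernelDeriv_fourierEval {M : ℝ → ℂ} {B : PhaseSpace m → L2R}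
    (hB : ContDiffOn ℝ ∞ B (phaseDomain m))
    (hkB : ∀ p ∈ phaseDomain m, ∀ t > 0, k (p, t) = fourierEval M t (B p)) :
    kernelDeriv β α j k p t =
      fourierEval M t (paramDeriv LinearMap.id (phaseDomain m) β α j B p) := by
  rw [kernelDeriv_eq_dirDerivs_slice hk β α j hp ht, paramDeriv_id_eq_dirDerivs]
  exact (dirDerivs_congr (fun q hq => hkB q hq t ht) (paramDirs β α j) hp).trans
    (dirDerivs_clm_comp (uniqueDiffOn_phaseDomain m) hB
      ((fourierEval M t).restrictScalars ℝ) (paramDirs β α j) hp)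

end KernelDerivatives

section Lifts

variable {E : Type*} [NormedAddCommGroup E] [NormedSpace ℂ E]

theorem clm_apply_eq_smul (T : ℂ →L[ℂ] E) (c : ℂ) : T c = c • T 1 := by
  rw [← map_smul, smul_eq_mul, mul_one]

theorem paramDeriv_clm_comp_apply {G : Type*} [NormedAddCommGroup G] [NormedSpace ℂ G]
    {A : PhaseSpace m → ℂ →L[ℂ] E} (hA : ContDiffOn ℝ ∞ A (phaseDomain m)) (ℓ : E →L[ℂ] G)
    (β α : Fin m → ℕ) (j : ℕ) {p : PhaseSpace m} (hp : p ∈ phaseDomain m) (c : ℂ) :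
    paramDeriv LinearMap.id (phaseDomain m) β α j (fun q => ℓ (A q c)) p =
      ℓ (paramDeriv LinearMap.id (phaseDomain m) β α j A p c) := by
  rw [paramDeriv_id_eq_dirDerivs, paramDeriv_id_eq_dirDerivs]
  exact dirDerivs_clm_comp (uniqueDiffOn_phaseDomain m) hA
    ((ℓ.comp (ContinuousLinearMap.apply ℂ _ c)).restrictScalars ℝ) (paramDirs β α j) hp

theorem contDiffOn_clm_comp_apply {G : Type*} [NormedAddCommGroup G] [NormedSpace ℂ G]
    {A : PhaseSpace m → ℂ →L[ℂ] E} (hA : ContDiffOn ℝ ∞ A (phaseDomain m)) (ℓ : E →L[ℂ] G)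
    (c : ℂ) : ContDiffOn ℝ ∞ (fun q => ℓ (A q c)) (phaseDomain m) :=
  ((ℓ.comp (ContinuousLinearMap.apply ℂ E c)).restrictScalars ℝ).contDiff.comp_contDiffOn hA

theorem emb_paramDeriv_apply {emb : E →ₗ[ℂ] 𝓓'(halfLine, ℂ)}
    (hemb : ∀ φ : 𝓓(halfLine, ℝ), Continuous fun e => emb e φ)
    {K : PhaseSpace m → ℂ →ₗ[ℂ] 𝓓'(halfLine, ℂ)} {A : PhaseSpace m → ℂ →L[ℂ] E}
    (hA : IsSmoothLift emb K A) (β α : Fin m → ℕ) (j : ℕ) {p : PhaseSpace m}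
    (hp : p ∈ phaseDomain m) (c : ℂ) (φ : 𝓓(halfLine, ℝ)) :
    emb (paramDeriv LinearMap.id (phaseDomain m) β α j A p c) φ =
      paramDeriv LinearMap.id (phaseDomain m) β α j (fun q => K q c φ) p := by
  let pairing : E →L[ℂ] ℂ :=
    { toFun := fun e => emb e φ
      map_add' := fun e e' => by rw [map_add]; rfl
      map_smul' := fun a e => by rw [map_smul]; rfl
      cont := hemb φ }
  have hlift : EqOn (fun q => pairing (A q c)) (fun q => K q c φ) (phaseDomain m) :=
    fun q hq => by
      change emb (A q c) φ = K q c φ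
      rw [hA.2 q hq]
  have hcomp := paramDeriv_clm_comp_apply hA.1 pairing β α j hp c
  rw [paramDeriv_id_eq_dirDerivs (f := fun q => pairing (A q c)),
    dirDerivs_congr hlift (paramDirs β α j) hp] at hcomp
  rw [paramDeriv_id_eq_dirDerivs (f := fun q => K q c φ), hcomp]
  rfl

theorem continuous_halfSobolevEmb_apply (s : ℝ) (φ : 𝓓(halfLine, ℝ)) :
    Continuous fun e => halfSobolevEmb s e φ := by
  simp_rw [halfSobolevEmb_eq_restrictTempered, restrictTempered_apply]
  exact (continuous_eval_const (testToSchwartz halfLine φ)).comp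
    ((sobolevEmb s).continuous.comp (halfSection s).continuous)

theorem continuous_fourierEval_derivSymbol {s : ℝ} (hs : 3 ≤ s) :
    Continuous (fourierEval (derivSymbol s 0)) :=
  (contDiff_fourierEval_derivSymbol 0 (by simpa using hs)).continuous

variable {K : PhaseSpace m → ℂ →ₗ[ℂ] 𝓓'(halfLine, ℂ)}

theorem represents_fourierEval_halfSection {s : ℝ} (hs : 1 ≤ s)
    {A : PhaseSpace m → ℂ →L[ℂ] HalfSobolev s} (hA : IsSmoothLift (halfSobolevEmb s) K A)
    {p : PhaseSpace m} (hp : p ∈ phaseDomain m) :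
    Represents (K p 1) fun t => fourierEval (derivSymbol s 0) t (halfSection s (A p 1)) := by
  rw [← hA.2 p hp, halfSobolevEmb_eq_restrictTempered]
  exact represents_fourierEval halfLine hs _

theorem kernel_eq_fourierEval {k : PhaseSpace m × ℝ → ℂ} (hk : ContDiffOn ℝ ∞ k (kernelDomain m))
    (hkK : IsKernelOf k K) {s : ℝ} (hs : 3 ≤ s) {A : PhaseSpace m → ℂ →L[ℂ] HalfSobolev s}
    (hA : IsSmoothLift (halfSobolevEmb s) K A) {p : PhaseSpace m} (hp : p ∈ phaseDomain m)
    {t : ℝ} (ht : 0 < t) :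
    k (p, t) = fourierEval (derivSymbol s 0) t (halfSection s (A p 1)) := by
  have hk_rep : Represents (K p 1) fun t => k (p, t) := fun φ => by
    rw [hkK p hp]
    simp only [mul_one]
    rfl
  have hk_cont : ContinuousOn (fun t => k (p, t)) (Ioi 0) :=
    (hk.comp (contDiffOn_const.prodMk contDiffOn_id) fun t ht => ⟨hp, ht⟩).continuousOn
  exact hk_rep.eqOn (represents_fourierEval_halfSection (by linarith) hA hp) hk_cont
    ((continuous_fourierEval_derivSymbol hs).clm_apply continuous_const).continuousOn ht

theorem represents_paramDeriv {k : PhaseSpace m × ℝ → ℂ} (hk : ContDiffOn ℝ ∞ k (kernelDomain m))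
    (hkK : IsKernelOf k K) (hH : SmoothInto (halfSobolevEmb 3) K)
    {emb : E →ₗ[ℂ] 𝓓'(halfLine, ℂ)} (hemb : ∀ φ : 𝓓(halfLine, ℝ), Continuous fun e => emb e φ)
    {A : PhaseSpace m → ℂ →L[ℂ] E} (hA : IsSmoothLift emb K A) (β α : Fin m → ℕ) (j : ℕ)
    {p : PhaseSpace m} (hp : p ∈ phaseDomain m) (c : ℂ) :
    Represents (emb (paramDeriv LinearMap.id (phaseDomain m) β α j A p c))
      fun t => c * kernelDeriv β α j k p t := by
  obtain ⟨A', hA'⟩ := hH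
  intro φ
  rw [emb_paramDeriv_apply hemb hA β α j hp c φ,
    ← emb_paramDeriv_apply (continuous_halfSobolevEmb_apply 3) hA' β α j hp c φ,
    halfSobolevEmb_eq_restrictTempered,
    represents_fourierEval halfLine (by norm_num : (1 : ℝ) ≤ 3) _ φ]
  refine setIntegral_congr_fun halfLine.isOpen.measurableSet fun t ht => ?_
  have hderiv := (kernelDeriv_fourierEval hk β α j hp ht
    (contDiffOn_clm_comp_apply hA'.1 (halfSection 3) 1)
    fun p hp t ht => kernel_eq_fourierEval hk hkK le_rfl hA' hp ht).trans
      (congrArg (fourierEval (derivSymbol 3 0) t)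
        (paramDeriv_clm_comp_apply hA'.1 (halfSection 3) β α j hp 1))
  simp only [hderiv]
  rw [clm_apply_eq_smul _ c, map_smul, map_smul, smul_eq_mul]

theorem contDiffOn_fourierEval_halfSection (n : ℕ) {s : ℝ} (hs : n + 3 ≤ s)
    {A : PhaseSpace m → ℂ →L[ℂ] HalfSobolev s} (hA : ContDiffOn ℝ ∞ A (phaseDomain m)) :
    ContDiffOn ℝ n (fun q : PhaseSpace m × ℝ =>
      fourierEval (derivSymbol s 0) q.2 (halfSection s (A q.1 1))) (kernelDomain m) := by
  have heval : ContDiff ℝ n fun q : PhaseSpace m × ℝ => fourierEval (derivSymbol s 0) q.2 :=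
    (contDiff_fourierEval_derivSymbol n (by simpa using hs)).comp contDiff_snd
  have hsection : ContDiffOn ℝ n (fun q : PhaseSpace m × ℝ => halfSection s (A q.1 1))
      (kernelDomain m) :=
    ((contDiffOn_clm_comp_apply hA (halfSection s) 1).of_le (mod_cast le_top)).comp
      contDiffOn_fst fun q hq => hq.1
  exact ((ContinuousLinearMap.restrictScalarsL ℂ L2R ℂ ℝ ℝ).contDiff.comp
    heval).contDiffOn.clm_apply hsection

theorem exists_smooth_kernel (hH : ∀ s : ℝ, SmoothInto (halfSobolevEmb s) K) :
    ∃ k : PhaseSpace m × ℝ → ℂ, ContDiffOn ℝ ∞ k (kernelDomain m) ∧ IsKernelOf k K := by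
  choose A hA using hH
  let k (s : ℝ) (q : PhaseSpace m × ℝ) : ℂ :=
    fourierEval (derivSymbol s 0) q.2 (halfSection s (A s q.1 1))
  have hrep : ∀ s ≥ 3, ∀ p ∈ phaseDomain m, Represents (K p 1) fun t => k s (p, t) :=
    fun s hs p hp => represents_fourierEval_halfSection (by linarith) (hA s) hp
  have hcont : ∀ s ≥ 3, ∀ p, Continuous fun t => k s (p, t) := fun s hs p =>
    (continuous_fourierEval_derivSymbol hs).clm_apply
      (continuous_const (y := halfSection s (A s p 1)))
  have heq : ∀ s ≥ 3, EqOn (k 3) (k s) (kernelDomain m) := fun s hs q hq =>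
    (hrep 3 le_rfl q.1 hq.1).eqOn (hrep s hs q.1 hq.1) (hcont 3 le_rfl _).continuousOn
      (hcont s hs _).continuousOn hq.2
  refine ⟨k 3, contDiffOn_infty.2 fun n => ?_, fun p hp c φ => ?_⟩
  · exact (contDiffOn_fourierEval_halfSection n le_rfl (hA (n + 3)).1).congr
      (heq (n + 3) (by simp))
  · have hc : K p c = c • K p 1 := by rw [← map_smul, smul_eq_mul, mul_one]
    rw [hc]
    change c * K p 1 φ = _
    rw [hrep 3 le_rfl p hp φ, ← integral_const_mul]
    refine setIntegral_congr_fun halfLine.isOpen.measurableSet fun t _ => ?_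
    simp only
    ring

end Lifts

end Kernels

/-! ### Operations on represented distributions -/

theorem Represents.add {Ω : Opens ℝ} {T S : 𝓓'(Ω, ℂ)} {w v : ℝ → ℂ} (hT : Represents T w)
    (hS : Represents S v) (hw : ContinuousOn w Ω) (hv : ContinuousOn v Ω) :
    Represents (T + S) fun t => w t + v t := fun φ => by
  change T φ + S φ = _
  rw [hT φ, hS φ, ← integral_add (integrableOn_mul_test hw φ) (integrableOn_mul_test hv φ)]
  simp only [add_mul]

theorem test_eq_zero_of_notMem {Ω : Opens ℝ} (φ : 𝓓(Ω, ℝ)) {t : ℝ} (ht : t ∉ (Ω : Set ℝ)) :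
    φ t = 0 := image_eq_zero_of_notMem_tsupport fun h => ht (φ.tsupport_subset h)

section MulDist

variable {g h : ℝ → ℝ} (hg : ContDiffOn ℝ ∞ g (Ioi 0)) (hh : ContDiffOn ℝ ∞ h (Ioi 0))

theorem Represents.mulDist {T : 𝓓'(halfLine, ℂ)} {w : ℝ → ℂ} (hT : Represents T w) :
    Represents (mulDist g hg T) fun t => (g t : ℂ) * w t := by
  intro φ
  rw [_root_.mulDist, WeightedMap.distMap_apply, hT]
  refine setIntegral_congr_fun halfLine.isOpen.measurableSet fun t ht => ?_
  simp only [WeightedMap.testMap_apply, indicator_of_mem ht, id]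
  push_cast
  ring

theorem mulDist_apply_eq (T : 𝓓'(halfLine, ℂ)) {φ ψ : 𝓓(halfLine, ℝ)}
    (hψ : ∀ t > 0, g t * φ t = ψ t) : mulDist g hg T φ = T ψ := by
  rw [mulDist, WeightedMap.distMap_apply]
  refine congrArg T (TestFunction.ext fun t => ?_)
  simp only [WeightedMap.testMap_apply]
  by_cases ht : t ∈ (halfLine : Set ℝ)
  · simpa only [indicator_of_mem ht, id] using hψ t ht
  · rw [indicator_of_notMem ht, test_eq_zero_of_notMem ψ ht]

theorem mulDist_eq_self (hg1 : ∀ t > 0, g t = 1) (T : 𝓓'(halfLine, ℂ)) : mulDist g hg T = T :=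
  DFunLike.ext _ _ fun φ => mulDist_apply_eq hg T fun t ht => by rw [hg1 t ht, one_mul]

theorem mulDist_mulDist_of_mul_eq_one (hgh : ∀ t > 0, g t * h t = 1) (T : 𝓓'(halfLine, ℂ)) :
    mulDist h hh (mulDist g hg T) = T := by
  refine DFunLike.ext _ _ fun φ => ?_
  rw [mulDist, WeightedMap.distMap_apply]
  refine mulDist_apply_eq hg T fun t ht => ?_
  rw [WeightedMap.testMap_apply, indicator_of_mem (show t ∈ (halfLine : Set ℝ) from ht)]
  change g t * (h t * φ t) = φ t
  rw [← mul_assoc, hgh t ht, one_mul]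

theorem mulDist_add_mulDist_one_sub (hg' : ContDiffOn ℝ ∞ (fun t => 1 - g t) (Ioi 0))
    (T : 𝓓'(halfLine, ℂ)) : mulDist g hg T + mulDist (fun t => 1 - g t) hg' T = T := by
  refine DFunLike.ext _ _ fun φ => ?_
  change mulDist g hg T φ + mulDist (fun t => 1 - g t) hg' T φ = T φ
  rw [mulDist_apply_eq hg' T (ψ := φ - WeightedMap.testMap _ φ) fun t ht => ?_, map_sub]
  · exact add_sub_cancel ..
  · change (1 - g t) * φ t = φ t - WeightedMap.testMap _ φ t
    rw [WeightedMap.testMap_apply, indicator_of_mem (show t ∈ (halfLine : Set ℝ) from ht),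
      sub_mul, one_mul]
    rfl

theorem continuous_mulDist_apply {E : Type*} [TopologicalSpace E] {F : E → 𝓓'(halfLine, ℂ)}
    (hF : ∀ φ : 𝓓(halfLine, ℝ), Continuous fun e => F e φ) (φ : 𝓓(halfLine, ℝ)) :
    Continuous fun e => mulDist g hg (F e) φ := hF _

end MulDist

theorem continuous_mellinSobolevEmb_apply (s γ : ℝ) (φ : 𝓓(halfLine, ℝ)) :
    Continuous fun f => mellinSobolevEmb s γ f φ :=
  (continuous_eval_const (testToSchwartz ⊤ _)).comp (sobolevEmb s).continuous

theorem continuous_weightedConeEmb_apply {χ : ℝ → ℝ} (hχ : IsCutoff χ) (s γ ρ : ℝ)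
    (φ : 𝓓(halfLine, ℝ)) : Continuous fun e => weightedConeEmb hχ s γ ρ e φ := by
  refine continuous_mulDist_apply _ (fun φ => ?_) φ
  change Continuous fun e : coneSubmodule hχ s γ =>
    mellinSobolevEmb s γ e.1.fst φ + halfSobolevEmb s e.1.snd φ
  have hofLp := WithLp.prod_continuous_ofLp 1 L2R (HalfSobolev s)
  exact ((continuous_mellinSobolevEmb_apply s γ φ).comp
    (hofLp.fst.comp continuous_subtype_val)).add
      ((continuous_halfSobolevEmb_apply s φ).comp (hofLp.snd.comp continuous_subtype_val))

theorem weightedSobolevEmb_zero (s : ℝ) : weightedSobolevEmb s 0 = halfSobolevEmb s :=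
  LinearMap.ext fun _ => mulDist_eq_self _ (fun t _ => by rw [neg_zero, bracketPow_zero]) _

/-! ### Changes of variables -/

/-- The group action `κ_c` on functions, `t ↦ c^{1/2} w(c t)`. -/
def dilate (c : ℝ) (w : ℝ → ℂ) (t : ℝ) : ℂ := (c ^ (1 / 2 : ℝ) : ℝ) * w (c * t)

theorem Represents.kappa {T : 𝓓'(halfLine, ℂ)} {w : ℝ → ℂ} (hT : Represents T w)
    (c : {x : ℝ // 0 < x}) : Represents (kappa c T) (dilate c w) := by
  intro φ
  have hc := c.2
  rw [_root_.kappa, WeightedMap.distMap_apply, hT]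
  let G : ℝ → ℂ := fun t => w t * (((c : ℝ) ^ (-(1 / 2) : ℝ) : ℝ) * (φ (t / c) : ℂ))
  have hsqrt : (c : ℝ) ^ (1 / 2 : ℝ) = c * (c : ℝ) ^ (-(1 / 2) : ℝ) := by
    nth_rewrite 2 [← Real.rpow_one (c : ℝ)]
    rw [← Real.rpow_add hc]
    norm_num
  have hdilate : ∀ t : ℝ, dilate c w t * φ t = ((c : ℝ) : ℂ) * G (c * t) := fun t => by
    simp only [dilate, G]
    rw [mul_div_cancel_left₀ t hc.ne', hsqrt]
    push_cast
    ring
  simp_rw [hdilate]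
  rw [integral_const_mul]
  change _ = _ * ∫ t in Ioi 0, G (c * t)
  rw [integral_comp_mul_left_Ioi G 0 hc, mul_zero, Complex.real_smul, ← mul_assoc,
    ← Complex.ofReal_mul, mul_inv_cancel₀ hc.ne', Complex.ofReal_one, one_mul]
  refine setIntegral_congr_fun halfLine.isOpen.measurableSet fun t ht => ?_
  simp only [WeightedMap.testMap_apply, indicator_of_mem ht, G]
  push_cast
  ring

theorem eLpNorm_two_comp_eq {s : Set ℝ} (hs : MeasurableSet s) {f f' : ℝ → ℝ}
    (hf : ∀ x ∈ s, HasDerivWithinAt f (f' x) s x) (hinj : InjOn f s) (h : ℝ → ℂ) :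
    eLpNorm (fun x => (√|f' x| : ℂ) * h (f x)) 2 (volume.restrict s) =
      eLpNorm h 2 (volume.restrict (f '' s)) := by
  rw [eLpNorm_eq_lintegral_rpow_enorm_toReal (by norm_num) (by norm_num),
    eLpNorm_eq_lintegral_rpow_enorm_toReal (by norm_num) (by norm_num),
    lintegral_image_eq_lintegral_abs_deriv_mul hs hf hinj]
  congr 1
  refine lintegral_congr fun x => ?_
  rw [enorm_mul, ENNReal.mul_rpow_of_nonneg _ _ (by norm_num)]
  congr 1
  rw [← ofReal_norm, Complex.norm_real, Real.norm_eq_abs, abs_of_nonneg (Real.sqrt_nonneg _),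
    ENNReal.ofReal_rpow_of_nonneg (Real.sqrt_nonneg _) (by norm_num)]
  congr 1
  simp [Real.sq_sqrt]

theorem iteratedDeriv_comp_mul_left (n : ℕ) (c : ℝ) (f : ℝ → ℂ) :
    iteratedDeriv n (fun x => f (c * x)) = fun x => (c : ℂ) ^ n * iteratedDeriv n f (c * x) := by
  induction n with
  | zero => simp
  | succ n ih =>
    rw [iteratedDeriv_succ, ih]
    ext x
    rw [deriv_const_mul_field, deriv_comp_mul_left, iteratedDeriv_succ, Complex.real_smul]
    ring

theorem iteratedDeriv_dilate (n : ℕ) (c : ℝ) (w : ℝ → ℂ) (t : ℝ) :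
    iteratedDeriv n (dilate c w) t =
      (c ^ (1 / 2 : ℝ) : ℝ) * ((c : ℂ) ^ n * iteratedDeriv n w (c * t)) := by
  have hdilate : dilate c w = fun t => ((c ^ (1 / 2 : ℝ) : ℝ) : ℂ) * (fun x => w (c * x)) t := rfl
  rw [hdilate, iteratedDeriv_const_mul_field, iteratedDeriv_comp_mul_left]

theorem contDiffOn_dilate {c : ℝ} (hc : 0 < c) {w : ℝ → ℂ} (hw : ContDiffOn ℝ ∞ w (Ioi 0)) :
    ContDiffOn ℝ ∞ (dilate c w) (Ioi 0) :=
  contDiffOn_const.mul (hw.comp (contDiffOn_const.mul contDiffOn_id) fun _ ht => mul_pos hc ht)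

/-- The norm `‖t^l ∂_t^{l'} w‖` in `L²(ℝ₊)` by which symbol-kernels are measured. -/
def weightNorm (l l' : ℕ) (w : ℝ → ℂ) : ℝ≥0∞ :=
  eLpNorm (fun t : ℝ => (t : ℂ) ^ l * iteratedDeriv l' w t) 2 (volume.restrict (Ioi 0))

theorem weightNorm_dilate {c : ℝ} (hc : 0 < c) (l l' : ℕ) (w : ℝ → ℂ) :
    weightNorm l l' (dilate c w) = ENNReal.ofReal (c ^ ((l' : ℝ) - l)) * weightNorm l l' w := by
  have hsubst := eLpNorm_two_comp_eq (s := Ioi 0) measurableSet_Ioi (f := fun x => c * x)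
    (f' := fun _ => c) (fun x _ => by simpa using ((hasDerivAt_id x).const_mul c).hasDerivWithinAt)
    (fun x _ y _ h => mul_left_cancel₀ hc.ne' h)
    (fun t => (t : ℂ) ^ l * iteratedDeriv l' w t)
  rw [image_const_mul_Ioi_zero hc] at hsubst
  have hscale : (fun t : ℝ => (t : ℂ) ^ l * iteratedDeriv l' (dilate c w) t) =
      ((c ^ ((l' : ℝ) - l) : ℝ) : ℂ) •
        fun t : ℝ => (√|c| : ℂ) * (((c * t : ℝ) : ℂ) ^ l * iteratedDeriv l' w (c * t)) := by
    ext t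
    rw [iteratedDeriv_dilate, Pi.smul_apply, smul_eq_mul, abs_of_pos hc, Real.sqrt_eq_rpow,
      Real.rpow_sub hc, Real.rpow_natCast, Real.rpow_natCast]
    have : (c : ℂ) ≠ 0 := by exact_mod_cast hc.ne'
    push_cast
    field_simp
    rw [mul_pow]
    ring
  rw [weightNorm, weightNorm, hscale, eLpNorm_const_smul, ← hsubst]
  congr 1
  rw [← ofReal_norm, Complex.norm_real, Real.norm_eq_abs, abs_of_nonneg (by positivity)]

theorem image_exp_neg_univ : (fun x => Real.exp (-x)) '' univ = Ioi 0 := by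
  rw [image_univ, ← Real.range_exp]
  exact neg_surjective.range_comp Real.exp

theorem hasDerivAt_exp_neg (x : ℝ) :
    HasDerivAt (fun x => Real.exp (-x)) (-Real.exp (-x)) x := by
  simpa using (hasDerivAt_neg x).exp

theorem injective_exp_neg : Function.Injective fun x => Real.exp (-x) :=
  Real.exp_injective.comp neg_injective

theorem integral_Ioi_eq_integral_exp_neg (g : ℝ → ℂ) :
    ∫ t in Ioi 0, g t = ∫ x, (Real.exp (-x) : ℂ) * g (Real.exp (-x)) := by
  have hsubst := integral_image_eq_integral_abs_deriv_smul MeasurableSet.univ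
    (fun x _ => (hasDerivAt_exp_neg x).hasDerivWithinAt) injective_exp_neg.injOn g
  rw [image_exp_neg_univ, setIntegral_univ] at hsubst
  rw [hsubst]
  congr 1 with x
  rw [abs_neg, Real.abs_exp, Complex.real_smul]

theorem eLpNorm_exp_neg_eq (h : ℝ → ℂ) :
    eLpNorm (fun x => (Real.exp (-x / 2) : ℂ) * h (Real.exp (-x))) 2 volume =
      eLpNorm h 2 (volume.restrict (Ioi 0)) := by
  have hsubst := eLpNorm_two_comp_eq MeasurableSet.univ
    (fun x _ => (hasDerivAt_exp_neg x).hasDerivWithinAt) injective_exp_neg.injOn h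
  rw [image_exp_neg_univ, Measure.restrict_univ] at hsubst
  rw [← hsubst]
  congr 1 with x
  rw [abs_neg, Real.abs_exp, Real.exp_half]

/-- The function `x ↦ e^{-x/2} g(e^{-x})`, that is `θ(t^{1/2} g)`. It carries `L²(ℝ₊)`
isometrically onto `L²(ℝ)` and represents in `H^s(ℝ)` the elements `g` of `𝓗^{s,0}(ℝ₊)`. -/
def logPull (g : ℝ → ℂ) (x : ℝ) : ℂ := (Real.exp (-x / 2) : ℂ) * g (Real.exp (-x))

theorem represents_mellinSobolevEmb {s : ℝ} {f : L2R} {g : ℝ → ℂ}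
    (h : Represents (restrictTempered ⊤ (sobolevEmb s f)) (logPull g)) :
    Represents (mellinSobolevEmb s 0 f) g := by
  have hthetaInv : Represents (thetaInv (restrictTempered ⊤ (sobolevEmb s f)))
      fun t => ((t ^ (1 / 2 : ℝ) : ℝ) : ℂ) * g t := by
    intro φ
    rw [thetaInv, WeightedMap.distMap_apply, h]
    change ∫ x in univ, _ = ∫ t in Ioi 0, _
    rw [integral_Ioi_eq_integral_exp_neg, setIntegral_univ]
    congr 1 with x
    have hx : x ∈ ((⊤ : Opens ℝ) : Set ℝ) := trivial
    rw [WeightedMap.testMap_apply, indicator_of_mem hx]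
    simp only [logPull]
    rw [← Real.exp_mul]
    push_cast
    ring_nf
  refine (hthetaInv.mulDist (contDiffOn_rpow_halfLine (0 - 1 / 2))).congr fun t ht => ?_
  simp only
  rw [← mul_assoc, ← Complex.ofReal_mul, ← Real.rpow_add (show (0 : ℝ) < t from ht)]
  norm_num

/-- The operator `φ ↦ t^{-1/2} φ(-ln t)` on test functions, whose transpose inverts
`mellinSobolevEmb s 0` on `H^s(ℝ)`. -/
def logTest : WeightedMap (⊤ : Opens ℝ) halfLine where
  weight := fun t => t ^ (-(1 / 2) : ℝ)
  map := fun t => -Real.log t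
  inv := fun x => Real.exp (-x)
  contDiffOn_weight := contDiffOn_rpow_halfLine _
  contDiffOn_map := (Real.contDiffOn_log.mono fun _ h => ne_of_gt h).neg
  mapsTo := fun _ _ => trivial
  continuousOn_inv := by fun_prop
  mapsTo_inv := fun _ _ => Real.exp_pos _
  leftInvOn := fun t ht => by
    have : (0 : ℝ) < t := ht
    simp [Real.exp_log this]

theorem logTest_testMap_exp_neg (φ : 𝓓((⊤ : Opens ℝ), ℝ)) (x : ℝ) :
    logTest.testMap φ (Real.exp (-x)) = Real.exp (x / 2) * φ x := by
  rw [WeightedMap.testMap_apply,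
    indicator_of_mem (show Real.exp (-x) ∈ (halfLine : Set ℝ) from Real.exp_pos _)]
  simp only [logTest, Real.log_exp, neg_neg]
  rw [← Real.exp_mul]
  ring_nf

theorem mellinSobolevEmb_logTest (s : ℝ) (f : L2R) (φ : 𝓓((⊤ : Opens ℝ), ℝ)) :
    mellinSobolevEmb s 0 f (logTest.testMap φ) = restrictTempered ⊤ (sobolevEmb s f) φ := by
  simp only [mellinSobolevEmb, LinearMap.comp_apply]
  rw [mulDist, WeightedMap.distMap_apply, thetaInv, WeightedMap.distMap_apply]
  refine congrArg (restrictTempered ⊤ (sobolevEmb s f)) (TestFunction.ext fun x => ?_)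
  rw [WeightedMap.testMap_apply, indicator_of_mem (show x ∈ ((⊤ : Opens ℝ) : Set ℝ) from trivial),
    WeightedMap.testMap_apply,
    indicator_of_mem (show Real.exp (-x) ∈ (halfLine : Set ℝ) from Real.exp_pos _)]
  change Real.exp (-x) * (Real.exp (-x) ^ (0 - 1 / 2 : ℝ) * logTest.testMap φ (Real.exp (-x))) = φ x
  rw [logTest_testMap_exp_neg, ← mul_assoc, ← mul_assoc, ← Real.exp_mul, ← Real.exp_add,
    ← Real.exp_add]
  ring_nf
  simp

theorem represents_logPull {s : ℝ} {f : L2R} {g : ℝ → ℂ}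
    (h : Represents (mellinSobolevEmb s 0 f) g) :
    Represents (restrictTempered ⊤ (sobolevEmb s f)) (logPull g) := by
  intro φ
  rw [← mellinSobolevEmb_logTest, h]
  change ∫ t in Ioi 0, _ = ∫ t in univ, _
  rw [integral_Ioi_eq_integral_exp_neg, setIntegral_univ]
  congr 1 with x
  have hexp : Real.exp (-x) * Real.exp (x / 2) = Real.exp (-x / 2) := by
    rw [← Real.exp_add]
    ring_nf
  rw [logTest_testMap_exp_neg, logPull, ← hexp]
  push_cast
  ring

/-! ### Domination up to a constant -/

/-- Domination of `F` by `G` on `S` up to a finite constant. -/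
def IsControlledOn {X : Type*} (S : Set X) (F G : X → ℝ≥0∞) : Prop :=
  ∃ C : ℝ≥0, ∀ x ∈ S, F x ≤ C * G x

namespace IsControlledOn

variable {X : Type*} {S : Set X} {F G H K : X → ℝ≥0∞}

theorem of_le (h : ∀ x ∈ S, F x ≤ G x) : IsControlledOn S F G :=
  ⟨1, fun x hx => by simpa only [ENNReal.coe_one, one_mul] using h x hx⟩

theorem trans (hFG : IsControlledOn S F G) (hGH : IsControlledOn S G H) :
    IsControlledOn S F H := by
  obtain ⟨C, hC⟩ := hFG
  obtain ⟨D, hD⟩ := hGH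
  refine ⟨C * D, fun x hx => (hC x hx).trans ?_⟩
  rw [ENNReal.coe_mul, mul_assoc]
  gcongr
  exact hD x hx

theorem of_le_mul_add {c : ℝ≥0} (h : ∀ x ∈ S, F x ≤ c * G x + H x) (hG : IsControlledOn S G K)
    (hH : IsControlledOn S H K) : IsControlledOn S F K := by
  obtain ⟨C, hC⟩ := hG
  obtain ⟨D, hD⟩ := hH
  refine ⟨c * C + D, fun x hx => (h x hx).trans ?_⟩
  rw [ENNReal.coe_add, ENNReal.coe_mul, add_mul, mul_assoc]
  gcongr
  exacts [hC x hx, hD x hx]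

theorem sum {ι : Type*} {I : Finset ι} {F : ι → X → ℝ≥0∞}
    (h : ∀ i ∈ I, IsControlledOn S (F i) G) :
    IsControlledOn S (fun x => ∑ i ∈ I, F i x) G := by
  choose! C hC using h
  refine ⟨∑ i ∈ I, C i, fun x hx => ?_⟩
  push_cast
  rw [Finset.sum_mul]
  exact Finset.sum_le_sum fun i hi => hC i hi x hx

theorem comp (h : IsControlledOn S F G) {Y : Type*} {T : Set Y} {f : Y → X} (hf : MapsTo f T S) :
    IsControlledOn T (F ∘ f) (G ∘ f) :=
  h.imp fun _ hC _ hy => hC _ (hf hy)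

theorem lt_top (h : IsControlledOn S F G) {x : X} (hx : x ∈ S) (hG : G x < ⊤) : F x < ⊤ := by
  obtain ⟨C, hC⟩ := h
  exact (hC x hx).trans_lt (ENNReal.mul_lt_top ENNReal.coe_lt_top hG)

end IsControlledOn

/-! ### Pointwise bounds of derivatives -/

theorem norm_iteratedDeriv_smul_le {F : Type*} [NormedAddCommGroup F] [NormedSpace ℝ F]
    {h : ℝ → ℝ} {w : ℝ → F} (hh : ContDiffOn ℝ ∞ h (Ioi 0)) (hw : ContDiffOn ℝ ∞ w (Ioi 0))
    {t : ℝ} (ht : 0 < t) (n : ℕ) {B : ℝ} (hB : ∀ i ≤ n, |iteratedDeriv i h t| ≤ B) :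
    ‖iteratedDeriv n (fun t => h t • w t) t‖ ≤
      2 ^ n * B * ∑ j ∈ Finset.range (n + 1), ‖iteratedDeriv j w t‖ := by
  have leibniz := norm_iteratedFDerivWithin_smul_le hh hw isOpen_Ioi.uniqueDiffOn
    (show t ∈ Ioi (0 : ℝ) from ht) (n := n) (mod_cast le_top)
  simp only [norm_iteratedFDerivWithin_eq_norm_iteratedDerivWithin,
    iteratedDerivWithin_of_isOpen isOpen_Ioi (show t ∈ Ioi (0 : ℝ) from ht)] at leibniz
  refine leibniz.trans ?_
  rw [← Finset.sum_range_reflect (fun j => ‖iteratedDeriv j w t‖), Finset.mul_sum]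
  refine Finset.sum_le_sum fun i hi => ?_
  have hchoose : (n.choose i : ℝ) ≤ 2 ^ n := by exact_mod_cast Nat.choose_le_two_pow n i
  have hBi := hB i (Finset.mem_range_succ_iff.1 hi)
  have := (abs_nonneg _).trans hBi
  rw [Nat.add_sub_cancel, Real.norm_eq_abs]
  gcongr

/-- The bounds `|h^{(i)}(t)| ≤ C b(t)`, `t > 0`, of the derivatives of order `i ≤ n`; with
`b = ⟨t⟩^r` these are symbol estimates without gain of decay under differentiation. -/
def HasDerivBound (n : ℕ) (b h : ℝ → ℝ) : Prop :=
  ∃ C : ℝ≥0, ∀ i ≤ n, ∀ t > 0, |iteratedDeriv i h t| ≤ C * b t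

namespace HasDerivBound

variable {n : ℕ} {b c h k : ℝ → ℝ}

theorem mono_bound (hh : HasDerivBound n b h) (D : ℝ≥0) (hbc : ∀ t > 0, b t ≤ D * c t) :
    HasDerivBound n c h := by
  obtain ⟨C, hC⟩ := hh
  refine ⟨C * D, fun i hi t ht => (hC i hi t ht).trans ?_⟩
  rw [NNReal.coe_mul, mul_assoc]
  gcongr
  exact hbc t ht

theorem zero_iff : HasDerivBound 0 b h ↔ ∃ C : ℝ≥0, ∀ t > 0, |h t| ≤ C * b t := by
  simp only [HasDerivBound, Nat.le_zero, forall_eq, iteratedDeriv_zero]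

theorem const_mul (hh : HasDerivBound n b h) (a : ℝ) : HasDerivBound n b fun t => a * h t := by
  obtain ⟨C, hC⟩ := hh
  refine ⟨‖a‖₊ * C, fun i hi t ht => ?_⟩
  rw [iteratedDeriv_const_mul_field, abs_mul, NNReal.coe_mul, coe_nnnorm, Real.norm_eq_abs,
    mul_assoc]
  gcongr
  exact hC i hi t ht

theorem succ (h₀ : HasDerivBound 0 b h) (h₁ : HasDerivBound n b (deriv h)) :
    HasDerivBound (n + 1) b h := by
  obtain ⟨C, hC⟩ := h₀
  obtain ⟨D, hD⟩ := h₁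
  refine ⟨C + D, fun i hi t ht => ?_⟩
  have hC0 := hC 0 le_rfl t ht
  have hD0 := (abs_nonneg _).trans (hD 0 n.zero_le t ht)
  rw [NNReal.coe_add, add_mul]
  rcases i with _ | i
  · linarith
  · rw [iteratedDeriv_succ']
    linarith [hD i (by omega) t ht, (abs_nonneg _).trans hC0]

theorem mul (hh : HasDerivBound n b h) (hk : HasDerivBound n c k)
    (hh' : ContDiffOn ℝ ∞ h (Ioi 0)) (hk' : ContDiffOn ℝ ∞ k (Ioi 0)) :
    HasDerivBound n (fun t => b t * c t) fun t => h t * k t := by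
  obtain ⟨C, hC⟩ := hh
  obtain ⟨D, hD⟩ := hk
  refine ⟨2 ^ n * C * ((n + 1 : ℕ) * D), fun i hi t ht => ?_⟩
  have hCb : 0 ≤ C * b t := (abs_nonneg _).trans (hC 0 n.zero_le t ht)
  have hDc : 0 ≤ D * c t := (abs_nonneg _).trans (hD 0 n.zero_le t ht)
  have hsum : ∑ j ∈ Finset.range (i + 1), ‖iteratedDeriv j k t‖ ≤ (i + 1 : ℕ) * (D * c t) := by
    simpa only [Finset.card_range, nsmul_eq_mul] using Finset.sum_le_card_nsmul
      (Finset.range (i + 1)) (fun j => ‖iteratedDeriv j k t‖) (D * c t)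
      fun j hj => hD j ((Finset.mem_range_succ_iff.1 hj).trans hi) t ht
  calc |iteratedDeriv i (fun t => h t * k t) t|
      ≤ 2 ^ i * (C * b t) * ∑ j ∈ Finset.range (i + 1), ‖iteratedDeriv j k t‖ :=
        norm_iteratedDeriv_smul_le hh' hk' ht i fun j hj => hC j (hj.trans hi) t ht
    _ ≤ 2 ^ i * (C * b t) * ((i + 1 : ℕ) * (D * c t)) := by gcongr
    _ ≤ 2 ^ n * (C * b t) * ((n + 1 : ℕ) * (D * c t)) := by
      gcongr
      exact one_le_two
    _ = _ := by
      push_cast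
      ring

end HasDerivBound

theorem hasDerivBound_const (n : ℕ) (a : ℝ) : HasDerivBound n (fun _ => 1) fun _ => a := by
  refine ⟨‖a‖₊, fun i _ t _ => ?_⟩
  rw [iteratedDeriv_const, mul_one, coe_nnnorm, Real.norm_eq_abs]
  split_ifs
  · exact le_rfl
  · rw [abs_zero]
    exact abs_nonneg a

theorem hasDerivBound_id (n : ℕ) : HasDerivBound n (fun t => 1 + t) fun t => t := by
  have hzero : HasDerivBound 0 (fun t => 1 + t) fun t => t := by
    refine HasDerivBound.zero_iff.2 ⟨1, fun t ht => ?_⟩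
    rw [abs_of_pos ht, NNReal.coe_one]
    linarith
  rcases n with _ | n
  · exact hzero
  · refine hzero.succ ?_
    rw [deriv_id'']
    refine (hasDerivBound_const n 1).mono_bound 1 fun t ht => ?_
    rw [NNReal.coe_one]
    linarith

theorem hasDerivAt_bracketPow (r t : ℝ) :
    HasDerivAt (bracketPow r) (r * (t * bracketPow (r - 2) t)) t := by
  have hsq : HasDerivAt (fun t : ℝ => 1 + t ^ 2) (2 * t) t := by
    simpa using (hasDerivAt_pow 2 t).const_add 1
  refine (hsq.rpow_const (p := r / 2) (Or.inl (by positivity))).congr_deriv ?_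
  simp only [bracketPow, show (r - 2) / 2 = r / 2 - 1 by ring]
  ring

theorem hasDerivBound_bracketPow (n : ℕ) (r : ℝ) :
    HasDerivBound n (bracketPow r) (bracketPow r) := by
  have hzero (r : ℝ) : HasDerivBound 0 (bracketPow r) (bracketPow r) :=
    HasDerivBound.zero_iff.2
      ⟨1, fun t _ => by rw [NNReal.coe_one, one_mul, abs_of_pos (bracketPow_pos r t)]⟩
  induction n generalizing r with
  | zero => exact hzero r
  | succ n ih =>
    refine (hzero r).succ ?_
    rw [funext fun t => (hasDerivAt_bracketPow r t).deriv]
    refine (((hasDerivBound_id n).mul (ih (r - 2)) contDiffOn_id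
      (contDiffOn_bracketPow (r - 2))).const_mul r).mono_bound 2 fun t _ => ?_
    have hsplit : bracketPow r t = (1 + t ^ 2) * bracketPow (r - 2) t := by
      rw [← sub_add_cancel r 2, ← bracketPow_mul_bracketPow, add_sub_cancel_right, mul_comm]
      congr 1
      simp [bracketPow]
    rw [hsplit, ← mul_assoc]
    refine mul_le_mul_of_nonneg_right ?_ (bracketPow_pos _ _).le
    rw [NNReal.coe_ofNat]
    nlinarith [sq_nonneg (t - 1)]

theorem hasDerivBound_zero_of_eqOn_const {η : ℝ → ℝ} (hη : ContinuousOn η (Ioi 0))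
    {ε R a b : ℝ} (hε : 0 < ε) (hnear : ∀ t ∈ Ioo 0 ε, η t = a) (hfar : ∀ t > R, η t = b) :
    HasDerivBound 0 (fun _ => 1) η := by
  obtain ⟨C, hC⟩ := isCompact_Icc.exists_bound_of_continuousOn
    (hη.mono fun t (ht : t ∈ Icc ε R) => hε.trans_le ht.1)
  refine HasDerivBound.zero_iff.2 ⟨‖C‖₊ + ‖a‖₊ + ‖b‖₊, fun t ht => ?_⟩
  push_cast
  simp only [Real.norm_eq_abs, mul_one] at hC ⊢
  have := abs_nonneg a
  have := abs_nonneg b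
  have := abs_nonneg C
  rcases lt_or_ge t ε with htε | htε
  · rw [hnear t ⟨ht, htε⟩]
    linarith
  rcases lt_or_ge R t with htR | htR
  · rw [hfar t htR]
    linarith
  · linarith [hC t ⟨htε, htR⟩, le_abs_self C]

theorem hasDerivBound_of_eqOn_const (n : ℕ) {η : ℝ → ℝ} (hη : ContDiffOn ℝ ∞ η (Ioi 0))
    {ε R a b : ℝ} (hε : 0 < ε) (hnear : ∀ t ∈ Ioo 0 ε, η t = a) (hfar : ∀ t > R, η t = b) :
    HasDerivBound n (fun _ => 1) η := by
  induction n generalizing η a b with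
  | zero => exact hasDerivBound_zero_of_eqOn_const hη.continuousOn hε hnear hfar
  | succ n ih =>
    refine (hasDerivBound_zero_of_eqOn_const hη.continuousOn hε hnear hfar).succ
      (ih (contDiffOn_deriv_of_isOpen isOpen_Ioi hη) (a := 0) (b := 0) (fun t ht => ?_)
        fun t ht => ?_)
    · have hconst : η =ᶠ[𝓝 t] fun _ => a := by
        filter_upwards [Ioo_mem_nhds ht.1 ht.2] with y hy using hnear y hy
      rw [hconst.deriv_eq, deriv_const]
    · have hconst : η =ᶠ[𝓝 t] fun _ => b := by
        filter_upwards [Ioi_mem_nhds ht] with y hy using hfar y hy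
      rw [hconst.deriv_eq, deriv_const]

theorem bracketPow_le_one_add_pow {r t : ℝ} (ht : 0 ≤ t) {M : ℕ} (hM : r ≤ M) :
    bracketPow r t ≤ (1 + t) ^ M := by
  refine (bracketPow_le_bracketPow hM t).trans ?_
  rw [bracketPow_natCast]
  gcongr
  rw [Real.sqrt_le_left (by positivity)]
  nlinarith

theorem pow_mul_bracketPow_neg_le {t : ℝ} (ht : 0 ≤ t) {j l : ℕ} (hj : j ≤ l) :
    t ^ l * bracketPow (-l) t ≤ t ^ j := by
  have hpow : t ^ (l - j) ≤ bracketPow l t :=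
    calc t ^ (l - j) = |t| ^ (l - j) := by rw [abs_of_nonneg ht]
      _ ≤ bracketPow (l - j : ℕ) t := abs_pow_le_bracketPow _ t
      _ ≤ bracketPow l t := bracketPow_le_bracketPow (mod_cast l.sub_le j) t
  calc t ^ l * bracketPow (-l) t = t ^ j * (t ^ (l - j) * bracketPow (-l) t) := by
        rw [← mul_assoc, ← pow_add, Nat.add_sub_cancel' hj]
    _ ≤ t ^ j * (bracketPow l t * bracketPow (-l) t) := by
        gcongr
        exact (bracketPow_pos _ t).le
    _ = t ^ j := by rw [mul_comm (bracketPow l t), bracketPow_neg_mul_bracketPow, mul_one]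

/-! ### Logarithmic change of variables and derivatives -/

/-- Sequences of functions with the differentiation rule of `e^{-x/2} (t^i ∂_t^i g)(e^{-x})`; it
lets one exchange the Fuchs type derivatives `(t^i ∂_t^i)` on the half-line with the ordinary
derivatives on the line. -/
structure IsLogSeq (Z : ℕ → ℝ → ℂ) : Prop where
  smooth : ∀ i, ContDiff ℝ ∞ (Z i)
  deriv_eq : ∀ i, deriv (Z i) = fun x => -(1 / 2 + i : ℂ) * Z i x - Z (i + 1) x

namespace IsLogSeq

variable {Z : ℕ → ℝ → ℂ}

theorem iteratedDeriv_succ (hZ : IsLogSeq Z) (i n : ℕ) : iteratedDeriv (i + 1) (Z n) =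
    fun x => -(1 / 2 + n : ℂ) * iteratedDeriv i (Z n) x - iteratedDeriv i (Z (n + 1)) x := by
  rw [_root_.iteratedDeriv_succ', hZ.deriv_eq]
  ext x
  have hsmooth (k : ℕ) : ContDiffAt ℝ i (Z k) x :=
    ((hZ.smooth k).of_le (mod_cast le_top)).contDiffAt
  change iteratedDeriv i ((fun x => -(1 / 2 + n : ℂ) * Z n x) - Z (n + 1)) x = _
  rw [iteratedDeriv_sub (contDiffAt_const.mul (hsmooth n)) (hsmooth (n + 1)),
    iteratedDeriv_const_mul_field]

theorem aestronglyMeasurable (hZ : IsLogSeq Z) (i n : ℕ) :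
    AEStronglyMeasurable (iteratedDeriv i (Z n)) volume :=
  ((hZ.smooth n).continuous_iteratedDeriv i (mod_cast le_top)).aestronglyMeasurable

end IsLogSeq

theorem eLpNorm_const_mul_sub_le {α : Type*} {mα : MeasurableSpace α} {μ : Measure α}
    {p : ℝ≥0∞} (hp : 1 ≤ p) {g h : α → ℂ} (c : ℂ) (hg : AEStronglyMeasurable g μ)
    (hh : AEStronglyMeasurable h μ) :
    eLpNorm (fun x => c * g x - h x) p μ ≤ ‖c‖₊ * eLpNorm g p μ + eLpNorm h p μ := by
  rw [← enorm_eq_nnnorm, ← eLpNorm_const_smul]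
  exact eLpNorm_sub_le (hg.const_smul c) hh hp

theorem isControlledOn_iteratedDeriv_isLogSeq (i n : ℕ) :
    IsControlledOn {Z | IsLogSeq Z} (fun Z => eLpNorm (iteratedDeriv i (Z n)) 2 volume)
      fun Z => ∑ j ∈ Finset.range (n + i + 1), eLpNorm (Z j) 2 volume := by
  induction i generalizing n with
  | zero =>
    refine .of_le fun Z _ => ?_
    rw [iteratedDeriv_zero]
    exact Finset.single_le_sum (f := fun j => eLpNorm (Z j) 2 volume) (fun _ _ => zero_le)
      (Finset.self_mem_range_succ n)
  | succ i ih =>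
    refine .of_le_mul_add (c := ‖-(1 / 2 + n : ℂ)‖₊) (fun Z hZ => ?_)
      ((ih n).trans <| .of_le fun Z _ => ?_) (add_right_comm n 1 i ▸ ih (n + 1))
    · rw [hZ.iteratedDeriv_succ i n]
      exact eLpNorm_const_mul_sub_le one_le_two _ (hZ.aestronglyMeasurable i n)
        (hZ.aestronglyMeasurable i (n + 1))
    · exact Finset.sum_le_sum_of_subset (Finset.range_mono (by omega))

theorem isControlledOn_isLogSeq (i n : ℕ) :
    IsControlledOn {Z | IsLogSeq Z} (fun Z => eLpNorm (iteratedDeriv i (Z n)) 2 volume)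
      fun Z => ∑ j ∈ Finset.range (n + i + 1), eLpNorm (iteratedDeriv j (Z 0)) 2 volume := by
  induction n generalizing i with
  | zero =>
    exact .of_le fun Z _ =>
      Finset.single_le_sum (f := fun j => eLpNorm (iteratedDeriv j (Z 0)) 2 volume)
        (fun _ _ => zero_le) (Finset.mem_range_succ_iff.2 (Nat.zero_add i).ge)
  | succ n ih =>
    refine .of_le_mul_add (c := ‖-(1 / 2 + n : ℂ)‖₊) (fun Z hZ => ?_)
      ((ih i).trans <| .of_le fun Z _ => ?_) (add_right_comm n 1 i ▸ ih (i + 1))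
    · have hsolve : iteratedDeriv i (Z (n + 1)) = fun x =>
          -(1 / 2 + n : ℂ) * iteratedDeriv i (Z n) x - iteratedDeriv (i + 1) (Z n) x := by
        rw [hZ.iteratedDeriv_succ i n]
        ext x
        ring
      rw [hsolve]
      exact eLpNorm_const_mul_sub_le one_le_two _ (hZ.aestronglyMeasurable i n)
        (hZ.aestronglyMeasurable (i + 1) n)
    · exact Finset.sum_le_sum_of_subset (Finset.range_mono (by omega))

theorem contDiff_logPull {h : ℝ → ℂ} (hh : ContDiffOn ℝ ∞ h (Ioi 0)) :
    ContDiff ℝ ∞ (logPull h) := by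
  have hexp : ContDiff ℝ ∞ fun x : ℝ => Real.exp (-x) := Real.contDiff_exp.comp contDiff_neg
  have hfactor : ContDiff ℝ ∞ fun x : ℝ => (Real.exp (-x / 2) : ℂ) :=
    Complex.ofRealCLM.contDiff.comp (Real.contDiff_exp.comp (contDiff_neg.div_const 2))
  exact hfactor.mul (contDiffOn_univ.1 (hh.comp hexp.contDiffOn fun x _ => Real.exp_pos _))

theorem hasDerivAt_exp_neg_pow (i : ℕ) (x : ℝ) :
    HasDerivAt (fun x : ℝ => ((Real.exp (-x) : ℝ) : ℂ) ^ i)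
      (-(i : ℂ) * ((Real.exp (-x) : ℝ) : ℂ) ^ i) x := by
  refine ((hasDerivAt_exp_neg x).ofReal_comp.pow i).congr_deriv ?_
  rcases i with _ | i
  · simp
  · rw [Nat.add_sub_cancel]
    push_cast
    ring

theorem isLogSeq_logPull {g : ℝ → ℂ} (hg : ContDiffOn ℝ ∞ g (Ioi 0)) :
    IsLogSeq fun i => logPull fun t => (t : ℂ) ^ i * iteratedDeriv i g t := by
  have hderiv (i : ℕ) := contDiffOn_iteratedDeriv_of_isOpen isOpen_Ioi hg i
  refine ⟨fun i => contDiff_logPull ?_, fun i => funext fun x => ?_⟩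
  · exact (Complex.ofRealCLM.contDiff.pow i).contDiffOn.mul (hderiv i)
  have hfactor : HasDerivAt (fun x : ℝ => (Real.exp (-x / 2) : ℂ))
      ((Real.exp (-x / 2) * (-1 / 2) : ℝ) : ℂ) x :=
    (((hasDerivAt_neg x).div_const 2).exp).ofReal_comp
  have hg_deriv : HasDerivAt (iteratedDeriv i g) (iteratedDeriv (i + 1) g (Real.exp (-x)))
      (Real.exp (-x)) := by
    rw [iteratedDeriv_succ]
    exact (((hderiv i).contDiffAt (Ioi_mem_nhds (Real.exp_pos _))).differentiableAt
      (by simp)).hasDerivAt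
  refine ((hfactor.mul ((hasDerivAt_exp_neg_pow i x).mul
    (hg_deriv.scomp x (hasDerivAt_exp_neg x)))).congr_deriv ?_).deriv
  simp only [logPull, Complex.real_smul, Function.comp, Pi.mul_apply]
  push_cast
  ring

/-- The functions on the half-line to which the estimates below apply. -/
def smoothOnHalfLine : Set (ℝ → ℂ) := {w | ContDiffOn ℝ ∞ w (Ioi 0)}

theorem logPull_pow_zero_mul_iteratedDeriv_zero (g : ℝ → ℂ) :
    (logPull fun t => (t : ℂ) ^ 0 * iteratedDeriv 0 g t) = logPull g := by
  simp only [pow_zero, iteratedDeriv_zero, one_mul]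

theorem eLpNorm_logPull_eq_weightNorm (g : ℝ → ℂ) (i : ℕ) :
    eLpNorm (logPull fun t => (t : ℂ) ^ i * iteratedDeriv i g t) 2 volume = weightNorm i i g := by
  rw [weightNorm, ← eLpNorm_exp_neg_eq (fun t => (t : ℂ) ^ i * iteratedDeriv i g t)]
  rfl

theorem isControlledOn_iteratedDeriv_logPull (i : ℕ) :
    IsControlledOn smoothOnHalfLine (fun g => eLpNorm (iteratedDeriv i (logPull g)) 2 volume)
      fun g => ∑ j ∈ Finset.range (i + 1), weightNorm j j g := by
  have h := (isControlledOn_iteratedDeriv_isLogSeq i 0).comp (T := smoothOnHalfLine)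
    fun _ => isLogSeq_logPull
  simpa only [Function.comp_def, eLpNorm_logPull_eq_weightNorm,
    logPull_pow_zero_mul_iteratedDeriv_zero, zero_add] using h

theorem isControlledOn_weightNorm_logPull (i : ℕ) :
    IsControlledOn smoothOnHalfLine (weightNorm i i)
      fun g => ∑ j ∈ Finset.range (i + 1), eLpNorm (iteratedDeriv j (logPull g)) 2 volume := by
  have h := (isControlledOn_isLogSeq 0 i).comp (T := smoothOnHalfLine) fun _ => isLogSeq_logPull
  simpa only [Function.comp_def, iteratedDeriv_zero (f := logPull _), eLpNorm_logPull_eq_weightNorm,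
    logPull_pow_zero_mul_iteratedDeriv_zero, add_zero] using h

/-! ### Weighted norms of products -/

theorem contDiffOn_ofReal_mul {h : ℝ → ℝ} {w : ℝ → ℂ} {S : Set ℝ} (hh : ContDiffOn ℝ ∞ h S)
    (hw : ContDiffOn ℝ ∞ w S) : ContDiffOn ℝ ∞ (fun t => (h t : ℂ) * w t) S :=
  (Complex.ofRealCLM.contDiff.comp_contDiffOn hh).mul hw

theorem aestronglyMeasurable_pow_mul_iteratedDeriv {w : ℝ → ℂ} (hw : ContDiffOn ℝ ∞ w (Ioi 0))
    (l l' : ℕ) : AEStronglyMeasurable (fun t : ℝ => (t : ℂ) ^ l * iteratedDeriv l' w t)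
      (volume.restrict (Ioi 0)) :=
  (Complex.continuous_ofReal.pow l).aestronglyMeasurable.mul
    (aestronglyMeasurable_iteratedDeriv_of_isOpen isOpen_Ioi hw l')

theorem eLpNorm_le_const_mul_sum {α ι E F : Type*} {mα : MeasurableSpace α} {μ : Measure α}
    [NormedAddCommGroup E] [NormedAddCommGroup F] {p : ℝ≥0∞} (hp : 1 ≤ p) (I : Finset ι)
    {f : α → E} {g : ι → α → F} (hg : ∀ i ∈ I, AEStronglyMeasurable (g i) μ) (C : ℝ≥0)
    (h : ∀ᵐ t ∂μ, ‖f t‖ ≤ C * ∑ i ∈ I, ‖g i t‖) :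
    eLpNorm f p μ ≤ C * ∑ i ∈ I, eLpNorm (g i) p μ :=
  calc eLpNorm f p μ ≤ eLpNorm ((C : ℝ) • ∑ i ∈ I, fun t => ‖g i t‖) p μ := by
        refine eLpNorm_mono_ae_real ?_
        filter_upwards [h] with t ht
        simpa only [Pi.smul_apply, Finset.sum_apply, smul_eq_mul] using ht
    _ = C * eLpNorm (∑ i ∈ I, fun t => ‖g i t‖) p μ := by
        rw [eLpNorm_const_smul, Real.enorm_of_nonneg C.coe_nonneg, ENNReal.ofReal_coe_nnreal]
    _ ≤ C * ∑ i ∈ I, eLpNorm (g i) p μ := by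
        gcongr
        refine (eLpNorm_sum_le (fun i hi => (hg i hi).norm) hp).trans ?_
        exact Finset.sum_le_sum fun i _ => (eLpNorm_norm _).le

theorem isControlledOn_weightNorm_ofReal_mul {h b : ℝ → ℝ} {n : ℕ} (hb : HasDerivBound n b h)
    (hh : ContDiffOn ℝ ∞ h (Ioi 0)) (l : ℕ) (D : ℝ≥0) (Q : ℕ → Finset ℕ)
    (hQ : ∀ j ≤ n, ∀ t > 0, t ^ l * b t ≤ D * ∑ q ∈ Q j, t ^ q) :
    IsControlledOn smoothOnHalfLine (fun w => weightNorm l n fun t => (h t : ℂ) * w t)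
      fun w => ∑ j ∈ Finset.range (n + 1), ∑ q ∈ Q j, weightNorm q j w := by
  obtain ⟨B, hB⟩ := hb
  refine ⟨2 ^ n * B * D, fun w hw => ?_⟩
  beta_reduce
  rw [Finset.sum_sigma']
  refine eLpNorm_le_const_mul_sum one_le_two ((Finset.range (n + 1)).sigma Q)
    (g := fun x (t : ℝ) => (t : ℂ) ^ x.2 * iteratedDeriv x.1 w t)
    (fun x _ => aestronglyMeasurable_pow_mul_iteratedDeriv hw x.2 x.1) _ ?_
  filter_upwards [ae_restrict_mem measurableSet_Ioi] with t ht
  have ht0 : (0 : ℝ) < t := ht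
  have leibniz := norm_iteratedDeriv_smul_le hh hw ht0 n (fun i hi => hB i hi t ht0)
  simp only [Complex.real_smul] at leibniz
  rw [Finset.sum_sigma, norm_mul, norm_pow, Complex.norm_real, Real.norm_of_nonneg ht0.le]
  calc t ^ l * _ ≤ t ^ l * _ := mul_le_mul_of_nonneg_left leibniz (by positivity)
    _ = ∑ j ∈ Finset.range (n + 1), 2 ^ n * B * ((t ^ l * b t) * ‖iteratedDeriv j w t‖) := by
      rw [Finset.mul_sum, Finset.mul_sum]
      exact Finset.sum_congr rfl fun j _ => by ring
    _ ≤ ∑ j ∈ Finset.range (n + 1),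
        2 ^ n * B * ((D * ∑ q ∈ Q j, t ^ q) * ‖iteratedDeriv j w t‖) := by
      refine Finset.sum_le_sum fun j hj => ?_
      have := hQ j (Finset.mem_range_succ_iff.1 hj) t ht0
      gcongr
    _ = _ := by
      rw [Finset.mul_sum]
      refine Finset.sum_congr rfl fun j _ => ?_
      simp only [norm_mul, norm_pow, Complex.norm_real, Real.norm_of_nonneg ht0.le]
      rw [← Finset.sum_mul]
      push_cast
      ring

/-- The index pairs `(l, l')` with `l' ≤ l ≤ M`; the norms `‖t^l ∂^{l'} w‖` with these indices are
those which a cone Sobolev space of weight `γ = 0` controls. -/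
def triangle (M : ℕ) : Finset (ℕ × ℕ) :=
  (Finset.range (M + 1) ×ˢ Finset.range (M + 1)).filter fun i => i.2 ≤ i.1

theorem mem_triangle {M l l' : ℕ} : (l, l') ∈ triangle M ↔ l' ≤ l ∧ l ≤ M := by
  simp only [triangle, Finset.mem_filter, Finset.mem_product, Finset.mem_range]
  omega

theorem triangle_mono : Monotone triangle := fun _ _ h ⟨_, _⟩ hi =>
  mem_triangle.2 ((mem_triangle.1 hi).imp_right h.trans')

/-- The sum of the norms `‖t^l ∂^{l'} w‖` over the index pairs `(l, l')` in `I`. -/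
def weightSum (I : Finset (ℕ × ℕ)) (w : ℝ → ℂ) : ℝ≥0∞ := ∑ i ∈ I, weightNorm i.1 i.2 w

theorem weightSum_mono {I J : Finset (ℕ × ℕ)} (h : I ⊆ J) (w : ℝ → ℂ) :
    weightSum I w ≤ weightSum J w :=
  Finset.sum_le_sum_of_subset h

theorem weightNorm_le_weightSum {l l' : ℕ} {I : Finset (ℕ × ℕ)} (h : (l, l') ∈ I) (w : ℝ → ℂ) :
    weightNorm l l' w ≤ weightSum I w :=
  Finset.single_le_sum (f := fun i : ℕ × ℕ => weightNorm i.1 i.2 w) (a := (l, l'))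
    (fun _ _ => zero_le) h

theorem isControlledOn_weightSum_triangle (S : Set (ℝ → ℂ)) {n M : ℕ} {Q : ℕ → Finset ℕ}
    (hQ : ∀ j ≤ n, ∀ q ∈ Q j, j ≤ q ∧ q ≤ M) :
    IsControlledOn S (fun w => ∑ j ∈ Finset.range (n + 1), ∑ q ∈ Q j, weightNorm q j w)
      (weightSum (triangle M)) :=
  .sum fun j hj => .sum fun q hq => .of_le fun w _ =>
    weightNorm_le_weightSum (mem_triangle.2 (hQ j (Finset.mem_range_succ_iff.1 hj) q hq)) w

theorem pow_mul_one_add_pow_le (n R : ℕ) {t : ℝ} (ht : 0 ≤ t) :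
    t ^ n * (1 + t) ^ R ≤ 2 ^ R * ∑ q ∈ Finset.Icc n (n + R), t ^ q := by
  rw [← Finset.Ico_add_one_right_eq_Icc, Finset.sum_Ico_eq_sum_range, add_assoc,
    Nat.add_sub_cancel_left, add_comm 1 t, add_pow, Finset.mul_sum, Finset.mul_sum]
  refine Finset.sum_le_sum fun q _ => ?_
  rw [one_pow, mul_one, pow_add]
  have hchoose : (R.choose q : ℝ) ≤ 2 ^ R := by exact_mod_cast Nat.choose_le_two_pow R q
  calc t ^ n * (t ^ q * R.choose q) ≤ t ^ n * (t ^ q * 2 ^ R) := by gcongr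
    _ = 2 ^ R * (t ^ n * t ^ q) := by ring

namespace IsCutoff

variable {χ : ℝ → ℝ}

theorem contDiffOn_one_sub (hχ : IsCutoff χ) : ContDiffOn ℝ ∞ (fun t => 1 - χ t) (Ioi 0) :=
  contDiffOn_const.sub hχ.smooth

theorem hasDerivBound (hχ : IsCutoff χ) (n : ℕ) : HasDerivBound n (fun _ => 1) χ := by
  obtain ⟨ε, hε, hnear⟩ := hχ.eq_one
  obtain ⟨R, hfar⟩ := hχ.eq_zero
  exact hasDerivBound_of_eqOn_const n hχ.smooth hε hnear hfar

theorem hasDerivBound_one_sub (hχ : IsCutoff χ) (n : ℕ) :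
    HasDerivBound n (fun _ => 1) fun t => 1 - χ t := by
  obtain ⟨ε, hε, hnear⟩ := hχ.eq_one
  obtain ⟨R, hfar⟩ := hχ.eq_zero
  exact hasDerivBound_of_eqOn_const n hχ.contDiffOn_one_sub hε
    (fun t ht => congrArg (1 - ·) (hnear t ht)) fun t ht => congrArg (1 - ·) (hfar t ht)

theorem isControlledOn_weightNorm_mul_bracketPow (hχ : IsCutoff χ) {r : ℝ} {R : ℕ} (hr : r ≤ R)
    (n : ℕ) : IsControlledOn smoothOnHalfLine
      (fun w => weightNorm n n fun t => ((χ t * bracketPow r t : ℝ) : ℂ) * w t)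
      (weightSum (triangle (n + R))) := by
  refine (isControlledOn_weightNorm_ofReal_mul
    ((hχ.hasDerivBound n).mul (hasDerivBound_bracketPow n r) hχ.smooth (contDiffOn_bracketPow r))
    (hχ.smooth.mul (contDiffOn_bracketPow r)) n (2 ^ R) (fun _ => Finset.Icc n (n + R))
    fun _ _ t ht => ?_).trans (isControlledOn_weightSum_triangle _ fun j hj q hq => ?_)
  · rw [one_mul]
    push_cast
    refine le_trans ?_ (pow_mul_one_add_pow_le n R (le_of_lt ht))
    gcongr
    exact bracketPow_le_one_add_pow (le_of_lt ht) hr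
  · exact ⟨hj.trans (Finset.mem_Icc.1 hq).1, (Finset.mem_Icc.1 hq).2⟩

theorem exists_hasDerivBound_one_sub_mul_bracketPow (hχ : IsCutoff χ) (r : ℝ) (n : ℕ) :
    ∃ ε > 0, HasDerivBound n (fun t => if t < ε then 0 else bracketPow r t)
      fun t => (1 - χ t) * bracketPow r t := by
  obtain ⟨B, hB⟩ := (hχ.hasDerivBound_one_sub n).mul (hasDerivBound_bracketPow n r)
    hχ.contDiffOn_one_sub (contDiffOn_bracketPow r)
  obtain ⟨ε, hε, hnear⟩ := hχ.eq_one
  refine ⟨ε, hε, B, fun i hi t ht => ?_⟩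
  beta_reduce
  split_ifs with htε
  · have hzero : (fun t => (1 - χ t) * bracketPow r t) =ᶠ[𝓝 t] fun _ => 0 := by
      filter_upwards [Ioo_mem_nhds ht htε] with y hy
      rw [hnear y hy, sub_self, zero_mul]
    rw [hzero.iteratedDeriv_eq, iteratedDeriv_const, ite_self, abs_zero, mul_zero]
  · simpa only [one_mul] using hB i hi t ht

theorem isControlledOn_weightNorm_one_sub_mul_bracketPow (hχ : IsCutoff χ) {r : ℝ} {R : ℕ}
    (hr : r ≤ R) (n : ℕ) : IsControlledOn smoothOnHalfLine
      (fun w => weightNorm 0 n fun t => (((1 - χ t) * bracketPow r t : ℝ) : ℂ) * w t)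
      (weightSum (triangle (n + R))) := by
  obtain ⟨ε, hε, hbound⟩ := hχ.exists_hasDerivBound_one_sub_mul_bracketPow r n
  refine (isControlledOn_weightNorm_ofReal_mul hbound
    (hχ.contDiffOn_one_sub.mul (contDiffOn_bracketPow r)) 0 ((1 / ε + 1).toNNReal ^ (n + R))
    (fun _ => {n + R}) fun _ _ t ht => ?_).trans
    (isControlledOn_weightSum_triangle _ fun j hj q hq => ?_)
  · rw [pow_zero, one_mul, Finset.sum_singleton]
    push_cast
    rw [Real.coe_toNNReal _ (by positivity)]
    have ht0 : 0 < t := ht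
    split_ifs with htε
    · positivity
    have hbase : 1 + t ≤ (1 / ε + 1) * t := by
      have : 1 ≤ t / ε := (one_le_div hε).2 (not_lt.1 htε)
      calc 1 + t ≤ t / ε + t := by linarith
        _ = _ := by ring
    calc bracketPow r t ≤ (1 + t) ^ (n + R) :=
          bracketPow_le_one_add_pow ht0.le (hr.trans (mod_cast R.le_add_left n))
      _ ≤ ((1 / ε + 1) * t) ^ (n + R) := by gcongr
      _ = (1 / ε + 1) ^ (n + R) * t ^ (n + R) := mul_pow _ _ _
  · rw [Finset.mem_singleton.1 hq]
    exact ⟨hj.trans (n.le_add_right R), le_rfl⟩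

end IsCutoff

/-! ### Smooth elements of the Sobolev spaces -/

section SmoothElements

variable {E : Type*} [NormedAddCommGroup E] [NormedSpace ℂ E]

/-- The pairs of an element of `E` and a function representing it that is smooth on the half-line;
`emb` is the inclusion of `E` into the distributions on `ℝ₊`. -/
def smoothElements (emb : E →ₗ[ℂ] 𝓓'(halfLine, ℂ)) : Set (E × (ℝ → ℂ)) :=
  {x | x.2 ∈ smoothOnHalfLine ∧ Represents (emb x.1) x.2}

/-- The norm of `E` controls the norm `‖t^l ∂^{l'} w‖` of every smooth element `w` of `E`. -/
def ControlsWeightNorm (emb : E →ₗ[ℂ] 𝓓'(halfLine, ℂ)) (l l' : ℕ) : Prop :=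
  IsControlledOn (smoothElements emb) (fun x => weightNorm l l' x.2) fun x => ‖x.1‖ₑ

/-- A smooth function whose norms `‖t^l ∂^{l'} w‖` with `(l, l') ∈ G` are all finite belongs to `E`,
and finitely many of these norms control its norm in `E`. -/
def ContainsSmooth (emb : E →ₗ[ℂ] 𝓓'(halfLine, ℂ)) (G : Set (ℕ × ℕ)) : Prop :=
  ∃ I : Finset (ℕ × ℕ), ↑I ⊆ G ∧ ∃ C : ℝ≥0, ∀ w ∈ smoothOnHalfLine,
    (∀ i ∈ G, weightNorm i.1 i.2 w < ⊤) →
    ∃ e, Represents (emb e) w ∧ ‖e‖ₑ ≤ C * weightSum I w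

theorem ContainsSmooth.exists_represents_ofReal_mul {emb : E →ₗ[ℂ] 𝓓'(halfLine, ℂ)}
    {G : Set (ℕ × ℕ)} (hE : ContainsSmooth emb G) {g : ℝ → ℝ} (hg : ContDiffOn ℝ ∞ g (Ioi 0))
    (h : ∀ i ∈ G, ∃ M, IsControlledOn smoothOnHalfLine
      (fun w => weightNorm i.1 i.2 fun t => (g t : ℂ) * w t) (weightSum (triangle M))) :
    ∃ M, ∃ C : ℝ≥0, ∀ w ∈ smoothOnHalfLine,
      (∀ i ∈ {i : ℕ × ℕ | i.2 ≤ i.1}, weightNorm i.1 i.2 w < ⊤) →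
      ∃ e, Represents (emb e) (fun t => (g t : ℂ) * w t) ∧ ‖e‖ₑ ≤ C * weightSum (triangle M) w := by
  obtain ⟨I, hI, C, hC⟩ := hE
  choose! M hM using h
  obtain ⟨D, hD⟩ : IsControlledOn smoothOnHalfLine (fun w => weightSum I fun t => (g t : ℂ) * w t)
      (weightSum (triangle (I.sup M))) :=
    .sum fun i hi => (hM i (hI hi)).trans <| .of_le fun w _ =>
      weightSum_mono (triangle_mono (Finset.le_sup hi)) w
  refine ⟨I.sup M, C * D, fun w hw hfin => ?_⟩
  obtain ⟨e, he, hnorm⟩ := hC _ (contDiffOn_ofReal_mul hg hw) fun i hi => (hM i hi).lt_top hw <|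
    ENNReal.sum_lt_top.2 fun j hj => hfin j (mem_triangle.1 hj).1
  refine ⟨e, he, hnorm.trans ?_⟩
  rw [ENNReal.coe_mul, mul_assoc]
  gcongr
  exact hD w hw

theorem isControlledOn_weightNorm_bracketPow_neg_mul {emb : E →ₗ[ℂ] 𝓓'(halfLine, ℂ)} {l l' : ℕ}
    {Q : ℕ → ℕ} (hQ : ∀ j ≤ l', Q j ≤ l) (h : ∀ j ≤ l', ControlsWeightNorm emb (Q j) j) :
    IsControlledOn (smoothElements emb)
      (fun x => weightNorm l l' fun t => (bracketPow (-l) t : ℂ) * x.2 t) fun x => ‖x.1‖ₑ := by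
  have hweight : IsControlledOn smoothOnHalfLine
      (fun w => weightNorm l l' fun t => (bracketPow (-l) t : ℂ) * w t)
      fun w => ∑ j ∈ Finset.range (l' + 1), weightNorm (Q j) j w := by
    simpa only [Finset.sum_singleton] using isControlledOn_weightNorm_ofReal_mul
      (hasDerivBound_bracketPow l' (-l)) (contDiffOn_bracketPow (-l)) l 1 (fun j => {Q j})
      fun j hj t ht => by
        simpa only [NNReal.coe_one, one_mul, Finset.sum_singleton] using
          pow_mul_bracketPow_neg_le (le_of_lt ht) (hQ j hj)
  exact (hweight.comp (f := Prod.snd) fun _ hx => hx.1).trans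
    (.sum fun j hj => h j (Finset.mem_range_succ_iff.1 hj))

end SmoothElements

theorem weightNorm_zero_left (n : ℕ) (w : ℝ → ℂ) :
    weightNorm 0 n w = eLpNorm (iteratedDeriv n w) 2 (volume.restrict (Ioi 0)) := by
  simp only [weightNorm, pow_zero, one_mul]

theorem halfLine_nonempty : (halfLine : Set ℝ).Nonempty := nonempty_Ioi

theorem isUpperSet_halfLine : IsUpperSet (halfLine : Set ℝ) := isUpperSet_Ioi 0

theorem containsSmooth_halfSobolevEmb (s : ℝ) :
    ContainsSmooth (halfSobolevEmb s) {i | i.1 = 0} := by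
  set N := ⌈s⌉₊
  refine ⟨{0} ×ˢ Finset.range (N + 1), fun i hi => ?_, 2 ^ N, fun w hw hfin => ?_⟩
  · exact Finset.mem_singleton.1 (Finset.mem_product.1 hi).1
  obtain ⟨f, hf, hnorm⟩ := exists_sobolevEmb_represents halfLine_nonempty isUpperSet_halfLine
    (Nat.le_ceil s) hw fun i => ⟨aestronglyMeasurable_iteratedDeriv_of_isOpen isOpen_Ioi hw i,
      (weightNorm_zero_left i w).symm.trans_lt (hfin (0, i) rfl)⟩
  refine ⟨Submodule.Quotient.mk f, hf, ?_⟩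
  calc ‖(Submodule.Quotient.mk f : HalfSobolev s)‖ₑ ≤ ‖f‖ₑ :=
        enorm_le_iff_norm_le.2 (Submodule.Quotient.norm_mk_le _ f)
    _ ≤ 2 ^ N * ∑ i ∈ Finset.range (N + 1), weightNorm 0 i w := by
        simp only [weightNorm_zero_left]
        exact hnorm
    _ = _ := by rw [weightSum, Finset.sum_product, Finset.sum_singleton]; push_cast; rfl

theorem controlsWeightNorm_halfSobolevEmb {i : ℕ} {s : ℝ} (hi : i ≤ s) :
    ControlsWeightNorm (halfSobolevEmb s) 0 i := by
  obtain ⟨C, hC⟩ := exists_eLpNorm_iteratedDeriv_le_of_represents halfLine hi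
  refine ⟨C * ‖halfSection s‖₊, fun ⟨e, w⟩ ⟨hw, he⟩ => ?_⟩
  rw [halfSobolevEmb_eq_restrictTempered] at he
  calc weightNorm 0 i w = eLpNorm (iteratedDeriv i w) 2 (volume.restrict (Ioi 0)) :=
        weightNorm_zero_left i w
    _ ≤ C * ‖halfSection s e‖ₑ := hC _ w hw he
    _ ≤ C * (‖halfSection s‖ₑ * ‖e‖ₑ) := by
        gcongr
        exact (halfSection s).le_opENorm e
    _ = _ := by rw [ENNReal.coe_mul, mul_assoc]; rfl

theorem containsSmooth_mellinSobolevEmb (s : ℝ) :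
    ContainsSmooth (mellinSobolevEmb s 0) {i | i.1 = i.2} := by
  set N := ⌈s⌉₊
  obtain ⟨C, hC⟩ : IsControlledOn smoothOnHalfLine
      (fun g => ∑ i ∈ Finset.range (N + 1), eLpNorm (iteratedDeriv i (logPull g)) 2 volume)
      (weightSum (Finset.range (N + 1)).diag) :=
    .sum fun i hi => (isControlledOn_iteratedDeriv_logPull i).trans <| .sum fun j hj =>
      .of_le fun g _ => weightNorm_le_weightSum (Finset.mem_diag.2 ⟨Finset.mem_range.2 (by
        rw [Finset.mem_range] at hi hj; omega), rfl⟩) g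
  refine ⟨(Finset.range (N + 1)).diag, fun i hi => (Finset.mem_diag.1 hi).2, 2 ^ N * C,
    fun g hg hfin => ?_⟩
  have hlog := (contDiff_logPull hg).contDiffOn (s := ((⊤ : Opens ℝ) : Set ℝ))
  obtain ⟨f, hf, hnorm⟩ := exists_sobolevEmb_represents (Ω := ⊤) univ_nonempty isUpperSet_univ
    (Nat.le_ceil s) hlog fun i => by
      refine ⟨aestronglyMeasurable_iteratedDeriv_of_isOpen isOpen_univ hlog i, ?_⟩
      rw [Opens.coe_top, Measure.restrict_univ]
      exact (isControlledOn_iteratedDeriv_logPull i).lt_top hg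
        (ENNReal.sum_lt_top.2 fun j _ => hfin (j, j) rfl)
  refine ⟨f, represents_mellinSobolevEmb hf, hnorm.trans ?_⟩
  rw [Opens.coe_top, Measure.restrict_univ, ENNReal.coe_mul, mul_assoc]
  push_cast
  gcongr
  exact hC g hg

theorem controlsWeightNorm_mellinSobolevEmb {i : ℕ} {s : ℝ} (hi : i ≤ s) :
    ControlsWeightNorm (mellinSobolevEmb s 0) i i := by
  refine ((isControlledOn_weightNorm_logPull i).comp (f := Prod.snd) fun _ hx => hx.1).trans
    (.sum fun j hj => ?_)
  have hjs : (j : ℝ) ≤ s :=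
    (Nat.cast_le.2 (Finset.mem_range_succ_iff.1 hj)).trans hi
  obtain ⟨C, hC⟩ := exists_eLpNorm_iteratedDeriv_le_of_represents ⊤ hjs
  refine ⟨C, fun ⟨f, g⟩ ⟨hg, hf⟩ => ?_⟩
  simpa only [Opens.coe_top, Measure.restrict_univ] using
    hC f (logPull g) (contDiff_logPull hg).contDiffOn (represents_logPull hf)

section Cone

variable {χ : ℝ → ℝ} (hχ : IsCutoff χ) {s γ ρ : ℝ}

theorem enorm_coneSobolev (e : ConeSobolev hχ s γ) : ‖e‖ₑ = ‖e.1.fst‖ₑ + ‖e.1.snd‖ₑ := by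
  have hnorm : ‖e‖ = ‖e.1.fst‖ + ‖e.1.snd‖ := WithLp.prod_norm_eq_of_L1 e.1
  rw [← ofReal_norm, hnorm, ENNReal.ofReal_add (norm_nonneg _) (norm_nonneg _), ofReal_norm,
    ofReal_norm]

theorem bracketPow_neg_mul_bracketPow_mul (ρ : ℝ) (t : ℝ) (z : ℂ) :
    (bracketPow (-ρ) t : ℂ) * (bracketPow ρ t * z) = z := by
  rw [← mul_assoc, ← Complex.ofReal_mul, bracketPow_neg_mul_bracketPow, Complex.ofReal_one, one_mul]

theorem exists_weightedConeEmb_represents {w : ℝ → ℂ} (hw : ContDiffOn ℝ ∞ w (Ioi 0)) {a : L2R}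
    {b : HalfSobolev s}
    (ha : Represents (mellinSobolevEmb s γ a) fun t => ((χ t * bracketPow ρ t : ℝ) : ℂ) * w t)
    (hb : Represents (halfSobolevEmb s b) fun t =>
      (((1 - χ t) * bracketPow ρ t : ℝ) : ℂ) * w t) :
    ∃ e : ConeSobolev hχ s γ, Represents (weightedConeEmb hχ s γ ρ e) w ∧
      ‖e‖ₑ = ‖a‖ₑ + ‖b‖ₑ := by
  have hsum : Represents (mellinSobolevEmb s γ a + halfSobolevEmb s b)
      fun t => bracketPow ρ t * w t := by
    refine (ha.add hb ?_ ?_).congr fun t _ => ?_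
    · exact (contDiffOn_ofReal_mul (hχ.smooth.mul (contDiffOn_bracketPow ρ)) hw).continuousOn
    · exact (contDiffOn_ofReal_mul
        (hχ.contDiffOn_one_sub.mul (contDiffOn_bracketPow ρ)) hw).continuousOn
    · push_cast
      ring
  have hfst := ((hsum.mulDist hχ.smooth).congr fun t _ => by push_cast; ring).ext ha
  have hsnd := ((hsum.mulDist hχ.contDiffOn_one_sub).congr fun t _ => by push_cast; ring).ext hb
  refine ⟨⟨WithLp.toLp 1 (a, b), _, hfst, hsnd⟩, ?_, enorm_coneSobolev hχ _⟩
  exact (hsum.mulDist (contDiffOn_bracketPow (-ρ))).congr fun t _ =>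
    bracketPow_neg_mul_bracketPow_mul ρ t (w t)

theorem mulDist_coneSobolevEmb (e : ConeSobolev hχ s γ) :
    mulDist χ hχ.smooth (coneSobolevEmb hχ s γ e) = mellinSobolevEmb s γ e.1.fst ∧
      mulDist (fun t => 1 - χ t) hχ.contDiffOn_one_sub (coneSobolevEmb hχ s γ e) =
        halfSobolevEmb s e.1.snd := by
  obtain ⟨u, hfst, hsnd⟩ := e.2
  have hu : u = coneSobolevEmb hχ s γ e := by
    rw [← mulDist_add_mulDist_one_sub hχ.smooth hχ.contDiffOn_one_sub u]
    exact congrArg₂ (· + ·) hfst hsnd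
  exact hu ▸ ⟨hfst, hsnd⟩

theorem represents_of_represents_weightedConeEmb {w : ℝ → ℂ} {e : ConeSobolev hχ s γ}
    (h : Represents (weightedConeEmb hχ s γ ρ e) w) :
    (Represents (mellinSobolevEmb s γ e.1.fst) fun t =>
      ((χ t * bracketPow ρ t : ℝ) : ℂ) * w t) ∧
    Represents (halfSobolevEmb s e.1.snd) fun t =>
      (((1 - χ t) * bracketPow ρ t : ℝ) : ℂ) * w t := by
  have hunweighted : Represents (coneSobolevEmb hχ s γ e) fun t => bracketPow ρ t * w t :=
    mulDist_mulDist_of_mul_eq_one (contDiffOn_bracketPow (-ρ)) (contDiffOn_bracketPow ρ)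
      (fun t _ => bracketPow_neg_mul_bracketPow ρ t) (coneSobolevEmb hχ s γ e) ▸
      h.mulDist (contDiffOn_bracketPow ρ)
  obtain ⟨hfst, hsnd⟩ := mulDist_coneSobolevEmb hχ e
  constructor
  · exact hfst ▸ (hunweighted.mulDist hχ.smooth).congr fun t _ => by push_cast; ring
  · exact hsnd ▸ (hunweighted.mulDist hχ.contDiffOn_one_sub).congr fun t _ => by push_cast; ring

theorem containsSmooth_weightedConeEmb (s ρ : ℝ) :
    ContainsSmooth (weightedConeEmb hχ s 0 ρ) {i | i.2 ≤ i.1} := by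
  have hρ : ρ ≤ ⌈ρ⌉₊ := Nat.le_ceil ρ
  obtain ⟨M, A, hA⟩ := (containsSmooth_mellinSobolevEmb s).exists_represents_ofReal_mul
    (hχ.smooth.mul (contDiffOn_bracketPow ρ)) (by
      rintro ⟨n, n'⟩ (rfl : n = n')
      exact ⟨_, hχ.isControlledOn_weightNorm_mul_bracketPow hρ n⟩)
  obtain ⟨N, B, hB⟩ := (containsSmooth_halfSobolevEmb s).exists_represents_ofReal_mul
    (hχ.contDiffOn_one_sub.mul (contDiffOn_bracketPow ρ)) (by
      rintro ⟨l, n⟩ (rfl : l = 0)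
      exact ⟨_, hχ.isControlledOn_weightNorm_one_sub_mul_bracketPow hρ n⟩)
  refine ⟨triangle (max M N), fun i hi => (mem_triangle.1 hi).1, A + B, fun w hw hfin => ?_⟩
  obtain ⟨a, ha, hnorm_a⟩ := hA w hw hfin
  obtain ⟨b, hb, hnorm_b⟩ := hB w hw hfin
  obtain ⟨e, he, hnorm_e⟩ := exists_weightedConeEmb_represents hχ hw ha hb
  refine ⟨e, he, ?_⟩
  calc ‖e‖ₑ = ‖a‖ₑ + ‖b‖ₑ := hnorm_e
    _ ≤ A * weightSum (triangle M) w + B * weightSum (triangle N) w := add_le_add hnorm_a hnorm_b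
    _ ≤ A * weightSum (triangle (max M N)) w + B * weightSum (triangle (max M N)) w := by
        gcongr
        · exact weightSum_mono (triangle_mono (le_max_left M N)) w
        · exact weightSum_mono (triangle_mono (le_max_right M N)) w
    _ = _ := by rw [← add_mul, ENNReal.coe_add]

theorem weightNorm_le_add {w w₁ w₂ : ℝ → ℂ} (hw₁ : ContDiffOn ℝ ∞ w₁ (Ioi 0))
    (hw₂ : ContDiffOn ℝ ∞ w₂ (Ioi 0)) (h : EqOn w (fun t => w₁ t + w₂ t) (Ioi 0)) (l l' : ℕ) :
    weightNorm l l' w ≤ weightNorm l l' w₁ + weightNorm l l' w₂ := by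
  refine (eLpNorm_congr_ae ?_).trans_le (eLpNorm_add_le
    (aestronglyMeasurable_pow_mul_iteratedDeriv hw₁ l l')
    (aestronglyMeasurable_pow_mul_iteratedDeriv hw₂ l l') one_le_two)
  filter_upwards [ae_restrict_mem measurableSet_Ioi] with t ht
  have hsmooth {g : ℝ → ℂ} (hg : ContDiffOn ℝ ∞ g (Ioi 0)) : ContDiffAt ℝ l' g t :=
    (hg.contDiffAt (Ioi_mem_nhds ht)).of_le (mod_cast le_top)
  have hderiv_add : iteratedDeriv l' (fun t => w₁ t + w₂ t) t = _ :=
    iteratedDeriv_add (hsmooth hw₁) (hsmooth hw₂)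
  rw [(h.eventuallyEq_of_mem (Ioi_mem_nhds ht)).iteratedDeriv_eq, hderiv_add, Pi.add_apply, mul_add]

theorem controlsWeightNorm_weightedConeEmb {l l' : ℕ} (hl : l' ≤ l) (hs : l' ≤ s) :
    ControlsWeightNorm (weightedConeEmb hχ s 0 l) l l' := by
  have hjs {j : ℕ} (hj : j ≤ l') : (j : ℝ) ≤ s := (Nat.cast_le.2 hj).trans hs
  obtain ⟨C, hC⟩ := isControlledOn_weightNorm_bracketPow_neg_mul (emb := mellinSobolevEmb s 0)
    (Q := id) (fun j hj => hj.trans hl) fun j hj => controlsWeightNorm_mellinSobolevEmb (hjs hj)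
  obtain ⟨D, hD⟩ := isControlledOn_weightNorm_bracketPow_neg_mul (emb := halfSobolevEmb s)
    (Q := 0) (fun _ _ => l.zero_le) fun j hj => controlsWeightNorm_halfSobolevEmb (hjs hj)
  refine ⟨C + D, fun ⟨e, w⟩ ⟨hw, he⟩ => ?_⟩
  obtain ⟨hfst, hsnd⟩ := represents_of_represents_weightedConeEmb hχ he
  have hw₁ := contDiffOn_ofReal_mul (hχ.smooth.mul (contDiffOn_bracketPow l)) hw
  have hw₂ := contDiffOn_ofReal_mul (hχ.contDiffOn_one_sub.mul (contDiffOn_bracketPow l)) hw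
  have hsplit (t : ℝ) : w t =
      bracketPow (-l) t * (((χ t * bracketPow l t : ℝ) : ℂ) * w t) +
        bracketPow (-l) t * ((((1 - χ t) * bracketPow l t : ℝ) : ℂ) * w t) := by
    refine (bracketPow_neg_mul_bracketPow_mul l t (w t)).symm.trans ?_
    push_cast
    ring
  calc weightNorm l l' w ≤ _ := weightNorm_le_add
        (contDiffOn_ofReal_mul (contDiffOn_bracketPow (-l)) hw₁)
        (contDiffOn_ofReal_mul (contDiffOn_bracketPow (-l)) hw₂) (fun t _ => hsplit t) l l'
    _ ≤ C * ‖e.1.fst‖ₑ + D * ‖e.1.snd‖ₑ :=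
        add_le_add (hC (e.1.fst, _) ⟨hw₁, hfst⟩) (hD (e.1.snd, _) ⟨hw₂, hsnd⟩)
    _ ≤ C * ‖e‖ₑ + D * ‖e‖ₑ := by
        rw [enorm_coneSobolev]
        gcongr
        · exact le_self_add
        · exact le_add_self
    _ = _ := by rw [← add_mul, ENNReal.coe_add]

end Cone

/-! ### Kernel estimates and operator-valued estimates -/

theorem isControlledOn_ofReal_iff {X : Type*} {S : Set X} {F : X → ℝ≥0∞} {g : X → ℝ}
    (hg : ∀ x ∈ S, 0 ≤ g x) : IsControlledOn S F (fun x => ENNReal.ofReal (g x)) ↔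
      ∃ C : ℝ, ∀ x ∈ S, F x ≤ ENNReal.ofReal (C * g x) := by
  constructor
  · rintro ⟨C, hC⟩
    refine ⟨C, fun x hx => (hC x hx).trans_eq ?_⟩
    rw [ENNReal.ofReal_mul C.coe_nonneg, ENNReal.ofReal_coe_nnreal]
  · rintro ⟨C, hC⟩
    refine ⟨C.toNNReal, fun x hx => (hC x hx).trans_eq ?_⟩
    rw [ENNReal.ofReal_mul' (hg x hx)]
    rfl

theorem isControlledOn_weightNorm_dilate_iff {X : Type*} {S : Set X} {lam : X → {x : ℝ // 0 < x}}
    {l l' : ℕ} {w : X → ℝ → ℂ} {g h : X → ℝ}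
    (hgh : ∀ x, ((lam x : ℝ) ^ ((l' : ℝ) - l)) * g x = h x) :
    IsControlledOn S (fun x => weightNorm l l' (dilate (lam x) (w x)))
        (fun x => ENNReal.ofReal (h x)) ↔
      IsControlledOn S (fun x => weightNorm l l' (w x)) fun x => ENNReal.ofReal (g x) := by
  refine exists_congr fun C => forall₂_congr fun x _ => ?_
  have hpos : 0 < (lam x : ℝ) ^ ((l' : ℝ) - l) := Real.rpow_pos_of_pos (lam x).2 _
  simp only [weightNorm_dilate (lam x).2, ← hgh, ENNReal.ofReal_mul hpos.le]
  rw [mul_left_comm]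
  exact ENNReal.mul_le_mul_iff_right (ENNReal.ofReal_pos.2 hpos).ne' ENNReal.ofReal_ne_top

theorem weightNorm_le_weightNorm_zero_add {w : ℝ → ℂ} (hw : ContDiffOn ℝ ∞ w (Ioi 0)) {l l' n : ℕ}
    (h : l ≤ n) : weightNorm l l' w ≤ weightNorm 0 l' w + weightNorm n l' w := by
  refine (eLpNorm_mono_ae_real (g := fun t : ℝ => ‖(t : ℂ) ^ 0 * iteratedDeriv l' w t‖ +
    ‖(t : ℂ) ^ n * iteratedDeriv l' w t‖) ?_).trans ?_
  · filter_upwards [ae_restrict_mem measurableSet_Ioi] with t ht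
    have ht0 : 0 ≤ t := le_of_lt ht
    have hpow : t ^ l ≤ t ^ 0 + t ^ n := by
      rcases le_total t 1 with ht1 | ht1
      · exact (pow_le_pow_of_le_one ht0 ht1 l.zero_le).trans
          (le_add_of_nonneg_right (by positivity))
      · exact (pow_le_pow_right₀ ht1 h).trans (le_add_of_nonneg_left (by positivity))
    simp only [norm_mul, norm_pow, Complex.norm_real, Real.norm_of_nonneg ht0, ← add_mul]
    gcongr
  · refine (eLpNorm_add_le (aestronglyMeasurable_pow_mul_iteratedDeriv hw 0 l').norm
      (aestronglyMeasurable_pow_mul_iteratedDeriv hw n l').norm one_le_two).trans_eq ?_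
    rw [eLpNorm_norm, eLpNorm_norm, weightNorm, weightNorm]

section Estimates

variable {m : ℕ} {d ν : ℝ}

/-- The weight `⟨ξ'⟩^{ν-|α|} ⟨ξ', μ⟩^{d-ν-j}` of the operator-valued estimates. -/
def symbolWeight (d ν : ℝ) (α : Fin m → ℕ) (j : ℕ) (p : PhaseSpace m) : ℝ :=
  (japXi p : ℝ) ^ (ν - multiAbs α) * (japXiMu p : ℝ) ^ (d - ν - j)

/-- The weight in the `L²` estimate of `x_n^l D_{x_n}^{l'} k` for symbol-kernels. -/
def kernelWeight (d ν : ℝ) (α : Fin m → ℕ) (j l l' : ℕ) (p : PhaseSpace m) : ℝ :=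
  (japXi p / japXiMu p : ℝ) ^ (ν - max ((l : ℝ) - l') 0 - multiAbs α) *
    (japXiMu p : ℝ) ^ (d - l + l' - multiAbs α - j)

theorem symbolWeight_nonneg (α : Fin m → ℕ) (j : ℕ) (p : PhaseSpace m) :
    0 ≤ symbolWeight d ν α j p :=
  mul_nonneg (Real.rpow_nonneg (japXi p).2.le _) (Real.rpow_nonneg (japXiMu p).2.le _)

theorem kernelWeight_nonneg (α : Fin m → ℕ) (j l l' : ℕ) (p : PhaseSpace m) :
    0 ≤ kernelWeight d ν α j l l' p :=
  mul_nonneg (Real.rpow_nonneg (div_nonneg (japXi p).2.le (japXiMu p).2.le) _)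
    (Real.rpow_nonneg (japXiMu p).2.le _)

theorem kernelWeight_eq (α : Fin m → ℕ) (j l l' : ℕ) (p : PhaseSpace m) :
    kernelWeight d ν α j l l' p =
      (japXi p : ℝ) ^ (ν - max ((l : ℝ) - l') 0 - multiAbs α) *
        (japXiMu p : ℝ) ^ (d - ν - j + (max ((l : ℝ) - l') 0 - (l - l'))) := by
  rw [kernelWeight, Real.div_rpow (japXi p).2.le (japXiMu p).2.le, div_mul_eq_mul_div,
    mul_div_assoc, ← Real.rpow_sub (japXiMu p).2]
  ring_nf

theorem inv_rpow_mul_rpow (c : {x : ℝ // 0 < x}) (a b : ℝ) :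
    ((c⁻¹ : {x : ℝ // 0 < x}) : ℝ) ^ a * (c : ℝ) ^ b = (c : ℝ) ^ (b - a) := by
  rw [Positive.coe_inv, Real.inv_rpow c.2.le, ← Real.rpow_neg c.2.le, ← Real.rpow_add c.2,
    neg_add_eq_sub]

theorem japXi_inv_rpow_mul_kernelWeight (α : Fin m → ℕ) (j : ℕ) {l l' : ℕ} (h : l' ≤ l)
    (p : PhaseSpace m) : (((japXi p)⁻¹ : {x : ℝ // 0 < x}) : ℝ) ^ ((l' : ℝ) - l) *
      kernelWeight d ν α j l l' p = symbolWeight d ν α j p := by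
  have hmax : max ((l : ℝ) - l') 0 = l - l' := max_eq_left (sub_nonneg.2 (Nat.cast_le.2 h))
  rw [kernelWeight_eq, hmax, ← mul_assoc, inv_rpow_mul_rpow, symbolWeight]
  ring_nf

theorem japXiMu_inv_rpow_mul_kernelWeight (α : Fin m → ℕ) (j : ℕ) {l l' : ℕ} (h : l ≤ l')
    (p : PhaseSpace m) : (((japXiMu p)⁻¹ : {x : ℝ // 0 < x}) : ℝ) ^ ((l' : ℝ) - l) *
      kernelWeight d ν α j l l' p = symbolWeight d ν α j p := by
  have hmax : max ((l : ℝ) - l') 0 = 0 := max_eq_right (sub_nonpos.2 (Nat.cast_le.2 h))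
  rw [kernelWeight_eq, hmax, mul_left_comm, inv_rpow_mul_rpow, symbolWeight]
  ring_nf

/-- Uniform bounds for the norms `‖t^l ∂_t^{l'} κ_{lam}⁻¹ ∂_{x'}^β ∂_{ξ'}^α ∂_μ^j k‖_{L²(ℝ₊)}`. -/
def HasDilatedBound (lam : PhaseSpace m → {x : ℝ // 0 < x}) (d ν : ℝ) (k : PhaseSpace m × ℝ → ℂ)
    (l l' : ℕ) : Prop :=
  ∀ (β α : Fin m → ℕ) (j : ℕ), IsControlledOn (phaseDomain m)
    (fun p => weightNorm l l' (dilate (lam p)⁻¹ (kernelDeriv β α j k p)))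
    fun p => ENNReal.ofReal (symbolWeight d ν α j p)

/-- The estimate of `x_n^l D_{x_n}^{l'} k` and its derivatives in the definition of
symbol-kernels. -/
def HasKernelBound (d ν : ℝ) (k : PhaseSpace m × ℝ → ℂ) (l l' : ℕ) : Prop :=
  ∀ (β α : Fin m → ℕ) (j : ℕ), IsControlledOn (phaseDomain m)
    (fun p => weightNorm l l' (kernelDeriv β α j k p))
    fun p => ENNReal.ofReal (kernelWeight d ν α j l l' p)

variable {k : PhaseSpace m × ℝ → ℂ} {l l' : ℕ}

theorem hasDilatedBound_japXi_iff (h : l' ≤ l) :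
    HasDilatedBound japXi d ν k l l' ↔ HasKernelBound d ν k l l' :=
  forall₃_congr fun _ α j => isControlledOn_weightNorm_dilate_iff
    (lam := fun p => (japXi p)⁻¹) (japXi_inv_rpow_mul_kernelWeight α j h)

theorem hasDilatedBound_japXiMu_iff (h : l ≤ l') :
    HasDilatedBound japXiMu d ν k l l' ↔ HasKernelBound d ν k l l' :=
  forall₃_congr fun _ α j => isControlledOn_weightNorm_dilate_iff
    (lam := fun p => (japXiMu p)⁻¹) (japXiMu_inv_rpow_mul_kernelWeight α j h)

theorem isWeakPoissonKernel_iff_hasKernelBound (hk : ContDiffOn ℝ ∞ k (kernelDomain m)) :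
    IsWeakPoissonKernel d ν k ↔ ∀ l l', HasKernelBound d ν k l l' := by
  have hnorm (β α : Fin m → ℕ) (j l l' : ℕ) {p : PhaseSpace m} (hp : p ∈ phaseDomain m) :
      eLpNorm (fun t => kernelDeriv β α j
        (fun q => (q.2 : ℂ) ^ l * (dirDeriv (kernelDomain m) (0, 1))^[l'] k q) p t)
        2 (volume.restrict (Ioi 0)) = weightNorm l l' (kernelDeriv β α j k p) := by
    refine eLpNorm_congr_ae ?_
    filter_upwards [ae_restrict_mem measurableSet_Ioi] with t ht
    exact kernelDeriv_pow_mul_iterate_dirDeriv hk β α j hp ht l l'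
  have hbound (β α : Fin m → ℕ) (j l l' : ℕ) := isControlledOn_ofReal_iff (S := phaseDomain m)
    (F := fun p => weightNorm l l' (kernelDeriv β α j k p))
    fun p _ => kernelWeight_nonneg (d := d) (ν := ν) α j l l' p
  constructor
  · rintro ⟨-, hest⟩ l l' β α j
    obtain ⟨C, hC⟩ := hest β α j l l'
    exact (hbound β α j l l').2
      ⟨C, fun p hp => (hnorm β α j l l' hp).symm.trans_le (hC p hp)⟩
  · refine fun h => ⟨hk, fun β α j l l' => ?_⟩
    obtain ⟨C, hC⟩ := (hbound β α j l l').1 (h l l' β α j)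
    exact ⟨C, fun p hp => (hnorm β α j l l' hp).trans_le (hC p hp)⟩

theorem isWeakPoissonKernel_iff_hasDilatedBound (hk : ContDiffOn ℝ ∞ k (kernelDomain m)) :
    IsWeakPoissonKernel d ν k ↔ (∀ l l', l' ≤ l → HasDilatedBound japXi d ν k l l') ∧
      ∀ l', HasDilatedBound japXiMu d ν k 0 l' := by
  rw [isWeakPoissonKernel_iff_hasKernelBound hk]
  refine ⟨fun h => ⟨fun l l' hl => (hasDilatedBound_japXi_iff hl).2 (h l l'),
    fun l' => (hasDilatedBound_japXiMu_iff l'.zero_le).2 (h 0 l')⟩, fun ⟨hXi, hXiMu⟩ l l' => ?_⟩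
  rcases le_total l' l with hl | hl
  · exact (hasDilatedBound_japXi_iff hl).1 (hXi l l' hl)
  -- For `l = l'` the two scalings give the same weight, so `t^l` is interpolated between
  -- `t^0` and `t^{l'}`.
  have hdiag : HasDilatedBound japXiMu d ν k l' l' :=
    (hasDilatedBound_japXiMu_iff le_rfl).2 ((hasDilatedBound_japXi_iff le_rfl).1 (hXi l' l' le_rfl))
  refine (hasDilatedBound_japXiMu_iff hl).1 fun β α j => .of_le_mul_add (c := 1) (fun p hp => ?_)
    (hXiMu l' β α j) (hdiag β α j)
  rw [ENNReal.coe_one, one_mul]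
  exact weightNorm_le_weightNorm_zero_add
    (contDiffOn_dilate (japXiMu p)⁻¹.2 (contDiffOn_kernelDeriv hk β α j hp)) hl

variable {E : Type*} [NormedAddCommGroup E] [NormedSpace ℂ E]
  {emb : E →ₗ[ℂ] 𝓓'(halfLine, ℂ)} {K : PhaseSpace m → ℂ →ₗ[ℂ] 𝓓'(halfLine, ℂ)}
  {lam : PhaseSpace m → {x : ℝ // 0 < x}}

section Lift

variable (hk : ContDiffOn ℝ ∞ k (kernelDomain m)) (hkK : IsKernelOf k K)
  (hH : SmoothInto (halfSobolevEmb 3) K) (hemb : ∀ φ : 𝓓(halfLine, ℝ), Continuous fun e => emb e φ)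

include hk hkK hH hemb

theorem represents_kappa_paramDeriv {A : PhaseSpace m → ℂ →L[ℂ] E} (hA : IsSmoothLift emb K A)
    (β α : Fin m → ℕ) (j : ℕ) (c : {x : ℝ // 0 < x}) {p : PhaseSpace m} (hp : p ∈ phaseDomain m) :
    Represents (kappa c (emb (paramDeriv LinearMap.id (phaseDomain m) β α j A p 1)))
      (dilate c (kernelDeriv β α j k p)) := by
  simpa only [one_mul] using (represents_paramDeriv hk hkK hH hemb hA β α j hp 1).kappa c

theorem isWeakSymbol_of_hasDilatedBound (hK : SmoothInto emb K) {G : Set (ℕ × ℕ)}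
    (hE : ContainsSmooth emb G) (hb : ∀ i ∈ G, HasDilatedBound lam d ν k i.1 i.2) :
    IsWeakSymbol emb lam d ν K := by
  obtain ⟨A, hA⟩ := hK
  obtain ⟨I, hI, D, hD⟩ := hE
  refine ⟨A, hA, fun β α j => ?_⟩
  obtain ⟨C, hC⟩ := IsControlledOn.sum fun i (hi : i ∈ I) => hb i (hI hi) β α j
  refine ⟨D * C, fun p hp c => ?_⟩
  obtain ⟨e, he, hnorm⟩ := hD _
    (contDiffOn_dilate (lam p)⁻¹.2 (contDiffOn_kernelDeriv hk β α j hp)) fun i hi =>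
      (hb i hi β α j).lt_top hp ENNReal.ofReal_lt_top
  refine ⟨c • e, ?_, ?_⟩
  · rw [map_smul, he.ext (represents_kappa_paramDeriv hk hkK hH hemb hA β α j (lam p)⁻¹ hp),
      ← map_smul, ← map_smul, ← map_smul, smul_eq_mul, mul_one]
  · have hle : ‖e‖ ≤ D * C * symbolWeight d ν α j p := by
      refine (ENNReal.ofReal_le_ofReal_iff (mul_nonneg (mul_nonneg D.coe_nonneg C.coe_nonneg)
        (symbolWeight_nonneg α j p))).1 ?_
      rw [ofReal_norm, mul_assoc, ENNReal.ofReal_mul D.coe_nonneg,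
        ENNReal.ofReal_mul C.coe_nonneg, ENNReal.ofReal_coe_nnreal, ENNReal.ofReal_coe_nnreal]
      exact hnorm.trans (mul_le_mul_right (hC p hp) _)
    rw [norm_smul, mul_comm ‖c‖]
    exact mul_le_mul_of_nonneg_right hle (norm_nonneg c)

theorem IsWeakSymbol.hasDilatedBound (h : IsWeakSymbol emb lam d ν K)
    (hE : ControlsWeightNorm emb l l') : HasDilatedBound lam d ν k l l' := by
  obtain ⟨A, hA, hest⟩ := h
  obtain ⟨D, hD⟩ := hE
  intro β α j
  obtain ⟨C, hC⟩ := hest β α j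
  refine (isControlledOn_ofReal_iff fun p _ => symbolWeight_nonneg α j p).2
    ⟨D * C, fun p hp => ?_⟩
  obtain ⟨e, he, hnorm⟩ := hC p hp 1
  have hrep := represents_kappa_paramDeriv hk hkK hH hemb hA β α j (lam p)⁻¹ hp
  calc weightNorm l l' (dilate (lam p)⁻¹ (kernelDeriv β α j k p)) ≤ D * ‖e‖ₑ :=
        hD (e, _) ⟨contDiffOn_dilate (lam p)⁻¹.2 (contDiffOn_kernelDeriv hk β α j hp), he ▸ hrep⟩
    _ ≤ D * ENNReal.ofReal (C * symbolWeight d ν α j p) := by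
        rw [norm_one, mul_one] at hnorm
        rw [← ofReal_norm]
        gcongr
        exact hnorm
    _ = _ := by rw [mul_assoc, ENNReal.ofReal_mul D.coe_nonneg, ENNReal.ofReal_coe_nnreal]

end Lift

end Estimates

end

theorem mainTheorem6 (m : ℕ) (d ν : ℝ) (χ : ℝ → ℝ) (hχ : IsCutoff χ)
    (K : PhaseSpace m → ℂ →ₗ[ℂ] 𝓓'(halfLine, ℂ))
    (hH : ∀ s δ : ℝ, SmoothInto (weightedSobolevEmb s δ) K)
    (hK : ∀ s ρ : ℝ, SmoothInto (weightedConeEmb hχ s 0 ρ) K) :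
    (∃ k : PhaseSpace m × ℝ → ℂ, IsWeakPoissonKernel d ν k ∧ IsKernelOf k K) ↔
      (∀ s ρ : ℝ, IsWeakSymbol (weightedConeEmb hχ s 0 ρ) japXi d ν K) ∧
      (∀ s : ℝ, IsWeakSymbol (halfSobolevEmb s) japXiMu d ν K) := by
  have hsobolev (s : ℝ) : SmoothInto (halfSobolevEmb s) K := weightedSobolevEmb_zero s ▸ hH s 0
  constructor
  · rintro ⟨k, hk, hkK⟩
    obtain ⟨hXi, hXiMu⟩ := (isWeakPoissonKernel_iff_hasDilatedBound hk.smooth).1 hk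
    refine ⟨fun s ρ => ?_, fun s => ?_⟩
    · exact isWeakSymbol_of_hasDilatedBound hk.smooth hkK (hsobolev 3)
        (continuous_weightedConeEmb_apply hχ s 0 ρ) (hK s ρ) (containsSmooth_weightedConeEmb hχ s ρ)
        fun i hi => hXi i.1 i.2 hi
    · refine isWeakSymbol_of_hasDilatedBound hk.smooth hkK (hsobolev 3)
        (continuous_halfSobolevEmb_apply s) (hsobolev s) (containsSmooth_halfSobolevEmb s) ?_
      rintro ⟨l, l'⟩ (rfl : l = 0)
      exact hXiMu l'
  · rintro ⟨hcone, hhalf⟩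
    obtain ⟨k, hk, hkK⟩ := exists_smooth_kernel hsobolev
    refine ⟨k, (isWeakPoissonKernel_iff_hasDilatedBound hk).2
      ⟨fun l l' hl => ?_, fun l' => ?_⟩, hkK⟩
    · exact (hcone l' l).hasDilatedBound hk hkK (hsobolev 3)
        (continuous_weightedConeEmb_apply hχ l' 0 l)
        (controlsWeightNorm_weightedConeEmb hχ hl le_rfl)
    · exact (hhalf l').hasDilatedBound hk hkK (hsobolev 3) (continuous_halfSobolevEmb_apply l')
        (controlsWeightNorm_halfSobolevEmb le_rfl)
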